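/- Setting. Let $n\ge 0$ and let $\Phi^i$ ($i$ in a finite set) be real fields on space-time $\mathbb R^n$ with ghost numbers $\mathrm{gh}\,\Phi^i\in\{0,1,2,\dots\}$ (original fields: $0$, ghosts: $1$, ghosts of ghosts: $2$, ...), with antifields $\Phi^*_i$, $\mathrm{gh}\,\Phi^*_i=-\mathrm{gh}\,\Phi^i-1$, all Grassmann parities being the ghost number mod $2$. Pure ghost number is $\mathrm{gh}\,\Phi^i$ on $\Phi^i$ and $0$ on $\Phi^*_i$; antifield number is $0$ on $\Phi^i$ and $\mathrm{gh}\,\Phi^i+1$ on $\Phi^*_i$. A local function is, in each pure ghost number and antifield number, a polynomial in the ghosts, the antifields and finitely many of their derivatives, whose coefficients are smooth functions of $x$ and finitely many derivatives of the original fields (at fixed ghost number: a formal sum over the antifield number). Let $\partial_\mu$ be the total derivative, $d=dx^\mu\partial_\mu$ the horizontal differential on local horizontal forms, and $(\int f\,d^nx,\int h\,d^nx)=\int d^nx\,\big[\frac{\delta^Rf}{\delta\Phi^i}\frac{\delta^Lh}{\delta\Phi^*_i}-\frac{\delta^Rf}{\delta\Phi^*_i}\frac{\delta^Lh}{\delta\Phi^i}\big]$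 the antibracket. Let $S=\int L\,d^nx$ be a proper solution of the master equation: $L$ is a local function of ghost number $0$, $(S,S)=0$ (that is, its density is a total divergence), and the Koszul–Tate differential $\delta$, the part of $s$ that lowers the antifield number by $1$, is acyclic in positive antifield number on local functions homogeneous in ghost and antifield number. Here $s=(S,\cdot)$ is the BRST differential: $s\Phi^i=-\delta^RL/\delta\Phi^*_i$, $s\Phi^*_i=\delta^RL/\delta\Phi^i$, $[s,\partial_\mu]=0$, $sd+ds=0$. Let $H^{g,k}(s|d)$ be the space of local $k$-forms $\alpha$ of ghost number $g$ with $s\alpha+d\eta=0$ for some local $\eta$ of ghost number $g+1$ and form degree $k-1$, modulo forms $s\beta+d\eta'$. Characteristic cohomology in form degrees $n-1$ and $n-2$ is taken in its BRST description $H^{-1,n}(s|d)$ and $H^{-2,n}(s|d)$. A class in $H^{-1,n}(s|d)$ is covariantizable if it has a representative $\alpha$ for which there is a local $(n-1)$-form $j$ of ghost number $0$ (a Noether current) with $s\alpha+dj=0$ and $sj=0$, i.e. if it has depth at most $1$. Statement. The antibracket of representatives induces well-defined bilinear maps $[\cdot,\cdot]:H^{-1,n}(s|d)\times H^{-1,n}(s|d)\to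 H^{-1,n}(s|d)$, a Lie bracket, and $H^{-1,n}(s|d)\times H^{-2,n}(s|d)\to H^{-2,n}(s|d)$, making $H^{-2,n}(s|d)$ a module over this Lie algebra. The covariantizable classes form an ideal of the Lie algebra $H^{-1,n}(s|d)$, and every covariantizable class acts as zero on $H^{-2,n}(s|d)$. -/

import Mathlib

noncomputable section

namespace BV

/-! Variables, monomials, local functions -/

/-- The undifferentiated variables `z`: a field or ghost `Φ^i`, or its antifield `Φ*_i`. -/
inductive Z (I : Type*) where
  | field (i : I) : Z I
  | anti (i : I) : Z I

/-- The jet variables `z_ν`, with `ν` a multi-index of space-time derivatives. -/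
abbrev Var (n : ℕ) (I : Type*) := Z I × (Fin n → ℕ)

/-- Monomials: exponents of the jet variables. -/
abbrev Mon (n : ℕ) (I : Type*) := Var n I →₀ ℕ

/-- Numerical coordinates: the space-time coordinates `x^μ` and (the values of) jet variables. -/
abbrev Coord (n : ℕ) (I : Type*) := Fin n ⊕ Var n I

/-- Formal superfunctions: each monomial in the ghosts, antifields and their derivatives (written
with its factors in increasing order) is given a coefficient, a function of `x` and the jets. -/
abbrev SFun (n : ℕ) (I : Type*) := Mon n I → (Coord n I → ℝ) → ℝ

section Grading

variable {n : ℕ} {I : Type*} (gh : I → ℕ)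

/-- Pure ghost number of a variable (`gh i` is the ghost number of the field `Φ^i`: `0` for the
original fields, `1` for the ghosts, `2` for ghosts of ghosts, ...). -/
def Z.puregh : Z I → ℕ
  | .field i => gh i
  | .anti _ => 0

/-- Antifield number of a variable. The ghost number is `puregh - antifd`, so that
`gh Φ*_i = - gh Φ^i - 1`. -/
def Z.antifd : Z I → ℕ
  | .field _ => 0
  | .anti i => gh i + 1

/-- Grassmann parity: the ghost number modulo two. -/
def Z.IsOdd (z : Z I) : Prop := Odd (z.puregh gh + z.antifd gh)

/-- The original (bosonic) fields `φ^a`, of ghost number zero. -/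
def Z.IsOriginal (z : Z I) : Prop := z.puregh gh + z.antifd gh = 0

/-- Pure ghost number of a monomial. -/
def Mon.puregh (m : Mon n I) : ℕ := m.sum fun v e => e * v.1.puregh gh

/-- Antifield number of a monomial. -/
def Mon.antifd (m : Mon n I) : ℕ := m.sum fun v e => e * v.1.antifd gh

/-- The monomials that occur: the original fields and their derivatives enter through the
coefficients only, and an odd variable squares to zero. -/
def Mon.Admissible (m : Mon n I) : Prop :=
  ∀ v, (v.1.IsOriginal gh → m v = 0) ∧ (v.1.IsOdd gh → m v ≤ 1)

open Classical in
/-- Sign of reordering the product of two ordered monomials. The variables are ordered by a fixed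
auxiliary well-order. -/
def sgn (a b : Mon n I) : ℝ :=
  (-1) ^ (∑ v ∈ a.support, ∑ w ∈ b.support,
    if v.1.IsOdd gh ∧ w.1.IsOdd gh ∧ WellOrderingRel w v then a v * b w else 0)

open Classical in
/-- The graded commutative product. -/
def mul (F G : SFun n I) : SFun n I := fun m p =>
  if Mon.Admissible gh m then
    ∑ ab ∈ Finset.HasAntidiagonal.antidiagonal m, sgn gh ab.1 ab.2 * F ab.1 p * G ab.2 p
  else 0

open Classical in
/-- The jet variable `z_ν` as a superfunction. -/
def X (v : Var n I) : SFun n I := fun m p =>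
  if v.1.IsOriginal gh then (if m = 0 then p (Sum.inr v) else 0)
  else (if m = Finsupp.single v 1 then 1 else 0)

/-- A coefficient is local: a smooth function of `x` and of finitely many derivatives of the
original fields. -/
def IsLocalCoeff (f : (Coord n I → ℝ) → ℝ) : Prop :=
  ∃ T : Finset (Coord n I), (∀ v : Var n I, Sum.inr v ∈ T → v.1.IsOriginal gh) ∧
    ∃ g : (T → ℝ) → ℝ, ContDiff ℝ (⊤ : ℕ∞) g ∧ ∀ p, f p = g fun c => p c

/-- Local functions. In each pure ghost number and antifield number they are polynomials in the
ghosts, the antifields and finitely many of their derivatives, with local coefficients. At a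
given ghost number this leaves a formal sum over the antifield number. -/
structure IsLocal (F : SFun n I) : Prop where
  coeff : ∀ m, IsLocalCoeff gh (F m)
  admissible : ∀ m, F m ≠ 0 → Mon.Admissible gh m
  finite : ∀ a b : ℕ, {m | F m ≠ 0 ∧ Mon.puregh gh m = a ∧ Mon.antifd gh m = b}.Finite

/-- Homogeneous of ghost number `g`. -/
def HasGhost (g : ℤ) (F : SFun n I) : Prop :=
  ∀ m, F m ≠ 0 → (Mon.puregh gh m : ℤ) - Mon.antifd gh m = g

/-- Homogeneous of antifield number `k`. -/
def HasAntifd (k : ℕ) (F : SFun n I) : Prop := ∀ m, F m ≠ 0 → Mon.antifd gh m = k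

open Classical in
/-- The component of antifield number `k`. -/
def antifdPart (k : ℕ) (F : SFun n I) : SFun n I :=
  fun m => if Mon.antifd gh m = k then F m else 0

/-! Derivations -/

open Classical in
/-- Partial derivative of the coefficients with respect to a numerical coordinate. -/
def pd (c : Coord n I) (F : SFun n I) : SFun n I :=
  fun m p => deriv (fun t => F m (Function.update p c t)) (p c)

open Classical in
/-- Left partial derivative `∂^L / ∂z_ν`. -/
def partialL (v : Var n I) (F : SFun n I) : SFun n I :=
  if v.1.IsOriginal gh then pd (Sum.inr v) F
  else fun m p => (m v + 1) * sgn gh (Finsupp.single v 1) m * F (m + Finsupp.single v 1) p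

open Classical in
/-- Right partial derivative `∂^R / ∂z_ν`. -/
def partialR (v : Var n I) (F : SFun n I) : SFun n I :=
  if v.1.IsOriginal gh then pd (Sum.inr v) F
  else fun m p => (m v + 1) * sgn gh m (Finsupp.single v 1) * F (m + Finsupp.single v 1) p

/-- The vector field `∑_v Q_v ∂^L / ∂v`. On local functions the sum is coefficientwise finite. -/
def along (Q : Var n I → SFun n I) (F : SFun n I) : SFun n I :=
  fun m p => ∑ᶠ v, mul gh (Q v) (partialL gh v F) m p

/-- The total derivative `∂_μ = ∂/∂x^μ + ∑ z_{ν+μ} ∂^L/∂z_ν`. -/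
def D (μ : Fin n) (F : SFun n I) : SFun n I :=
  pd (Sum.inl μ) F + along gh (fun v => X gh (v.1, v.2 + Pi.single μ 1)) F

/-- Iterated total derivative `∂_ν` for a multi-index `ν`. -/
def Dmulti (ν : Fin n → ℕ) (F : SFun n I) : SFun n I :=
  (List.finRange n).foldr (fun μ G => (D gh μ)^[ν μ] G) F

/-- Euler-Lagrange left derivative `δ^L F / δz`. -/
def eulerL (z : Z I) (F : SFun n I) : SFun n I :=
  fun m p => ∑ᶠ ν : Fin n → ℕ, (-1 : ℝ) ^ (∑ μ, ν μ) * Dmulti gh ν (partialL gh (z, ν) F) m p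

/-- Euler-Lagrange right derivative `δ^R F / δz`. -/
def eulerR (z : Z I) (F : SFun n I) : SFun n I :=
  fun m p => ∑ᶠ ν : Fin n → ℕ, (-1 : ℝ) ^ (∑ μ, ν μ) * Dmulti gh ν (partialR gh (z, ν) F) m p

/-- The antibracket of the functionals `∫ f dⁿx` and `∫ h dⁿx`, as a density. -/
def bracket [Fintype I] (f h : SFun n I) : SFun n I :=
  ∑ i, (mul gh (eulerR gh (.field i) f) (eulerL gh (.anti i) h)
    - mul gh (eulerR gh (.anti i) f) (eulerL gh (.field i) h))

/-- The BRST transformation of the undifferentiated variables: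
`sΦ^i = - δ^R L / δΦ*_i` and `sΦ*_i = δ^R L / δΦ^i`. -/
def brstZ (L : SFun n I) : Z I → SFun n I
  | .field i => - eulerR gh (.anti i) L
  | .anti i => eulerR gh (.field i) L

/-- The BRST differential `s = (S, ·)` of `S = ∫ L dⁿx`, extended to derivatives by
`[s, ∂_μ] = 0`. -/
def brst (L : SFun n I) : SFun n I → SFun n I :=
  along gh fun v => Dmulti gh v.2 (brstZ gh L v.1)

/-- Proper solutions of the master equation. `L = L₀ + φ*_a R^a_α C^α + ...` has ghost number
zero; `(S, S) = 0` holds up to a total derivative; the Koszul-Tate differential `δ`, which is the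
component of antifield number `-1` of `s`, is acyclic in positive antifield number (`L` encodes a
complete set of gauge symmetries, of reducibilities, ...). -/
structure IsMasterAction [Fintype I] (L : SFun n I) : Prop where
  isLocal : IsLocal gh L
  ghost : HasGhost gh 0 L
  master : ∃ k : Fin n → SFun n I, (∀ μ, IsLocal gh (k μ)) ∧ bracket gh L L = ∑ μ, D gh μ (k μ)
  proper : ∀ (k : ℕ) (g : ℤ) (F : SFun n I), IsLocal gh F → HasGhost gh g F →
    HasAntifd gh (k + 1) F → antifdPart gh k (brst gh L F) = 0 →
    ∃ G : SFun n I, IsLocal gh G ∧ HasGhost gh (g - 1) G ∧ HasAntifd gh (k + 2) G ∧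
      antifdPart gh (k + 1) (brst gh L G) = F

end Grading

/-! Horizontal forms and local BRST cohomology -/

/-- Horizontal forms `∑_S dx^S α_S`, with `dx^S` the ordered product of the `dx^μ`, `μ ∈ S`. -/
abbrev Form (n : ℕ) (I : Type*) := Finset (Fin n) → SFun n I

section Cohomology

variable {n : ℕ} {I : Type*} (gh : I → ℕ)

/-- Local horizontal forms of ghost number `g` and form degree `k`. -/
structure IsForm (g k : ℤ) (α : Form n I) : Prop where
  isLocal : ∀ S, IsLocal gh (α S)
  ghost : ∀ S, HasGhost gh g (α S)
  degree : ∀ S, (S.card : ℤ) ≠ k → α S = 0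

/-- Horizontal differential `d = dx^μ ∂_μ`. -/
def d (α : Form n I) : Form n I := fun T =>
  ∑ μ ∈ T, (-1 : ℝ) ^ (T.filter (· < μ)).card • D gh μ (α (T.erase μ))

/-- BRST differential on forms. It anticommutes with the `dx^μ`, so that `s d + d s = 0`. -/
def s (L : SFun n I) (α : Form n I) : Form n I := fun S =>
  (-1 : ℝ) ^ S.card • brst gh L (α S)

open Classical in
/-- The antibracket of two top forms `dⁿx f` and `dⁿx h`. -/
def antibracket [Fintype I] (α η : Form n I) : Form n I := fun S =>
  if S = Finset.univ then bracket gh (α Finset.univ) (η Finset.univ) else 0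

/-! Linearity on local functions -/

variable {gh}

lemma IsLocalCoeff.add {f h : (Coord n I → ℝ) → ℝ} (hf : IsLocalCoeff gh f)
    (hh : IsLocalCoeff gh h) : IsLocalCoeff gh (f + h) := by
  classical
  obtain ⟨T, hT, g, hg, e⟩ := hf
  obtain ⟨T', hT', g', hg', e'⟩ := hh
  refine ⟨T ∪ T', fun v hv => (Finset.mem_union.1 hv).elim (hT v) (hT' v),
    fun q => g (fun c => q ⟨c, Finset.mem_union_left _ c.2⟩)
      + g' (fun c => q ⟨c, Finset.mem_union_right _ c.2⟩), ?_, ?_⟩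
  · refine (hg.comp ?_).add (hg'.comp ?_) <;> fun_prop
  · intro p; simp [e, e']

lemma IsLocalCoeff.smul {f : (Coord n I → ℝ) → ℝ} (c : ℝ) (hf : IsLocalCoeff gh f) :
    IsLocalCoeff gh (c • f) := by
  obtain ⟨T, hT, g, hg, e⟩ := hf
  exact ⟨T, hT, fun q => c * g q, contDiff_const.mul hg, fun p => by simp [e]⟩

lemma IsLocal.zero : IsLocal gh (0 : SFun n I) where
  coeff _ := ⟨∅, by simp, fun _ => 0, contDiff_const, fun _ => rfl⟩
  admissible m h := absurd rfl h
  finite a b := by simp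

lemma IsLocal.add {F G : SFun n I} (hF : IsLocal gh F) (hG : IsLocal gh G) :
    IsLocal gh (F + G) where
  coeff m := (hF.coeff m).add (hG.coeff m)
  admissible m h := by
    by_cases h1 : F m = 0
    · refine hG.admissible m fun h2 => h (by simp [h1, h2])
    · exact hF.admissible m h1
  finite a b := by
    refine ((hF.finite a b).union (hG.finite a b)).subset ?_
    rintro m ⟨h, h'⟩
    by_cases h1 : F m = 0
    · exact Or.inr ⟨fun h2 => h (by simp [h1, h2]), h'⟩
    · exact Or.inl ⟨h1, h'⟩

lemma IsLocal.smul {F : SFun n I} (c : ℝ) (hF : IsLocal gh F) : IsLocal gh (c • F) where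
  coeff m := (hF.coeff m).smul c
  admissible m h := hF.admissible m fun h2 => h (by simp [h2])
  finite a b := by
    refine (hF.finite a b).subset ?_
    rintro m ⟨h, h'⟩
    exact ⟨fun h2 => h (by simp [h2]), h'⟩

lemma IsForm.zero {g k : ℤ} : IsForm gh g k (0 : Form n I) where
  isLocal _ := IsLocal.zero
  ghost _ _ h := absurd rfl h
  degree _ _ := rfl

lemma IsForm.add {g k : ℤ} {α η : Form n I} (hα : IsForm gh g k α) (hη : IsForm gh g k η) :
    IsForm gh g k (α + η) where
  isLocal S := (hα.isLocal S).add (hη.isLocal S)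
  ghost S m h := by
    by_cases h1 : α S m = 0
    · refine hη.ghost S m fun h2 => h (by simp [h1, h2])
    · exact hα.ghost S m h1
  degree S h := by simp [hα.degree S h, hη.degree S h]

lemma IsForm.smul {g k : ℤ} {α : Form n I} (c : ℝ) (hα : IsForm gh g k α) :
    IsForm gh g k (c • α) where
  isLocal S := (hα.isLocal S).smul c
  ghost S m h := hα.ghost S m fun h2 => h (by simp [h2])
  degree S h := by simp [hα.degree S h]

lemma IsLocalCoeff.differentiableAt [DecidableEq (Coord n I)] {f : (Coord n I → ℝ) → ℝ}
    (hf : IsLocalCoeff gh f) (c : Coord n I) (p : Coord n I → ℝ) (t : ℝ) :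
    DifferentiableAt ℝ (fun t => f (Function.update p c t)) t := by
  obtain ⟨T, -, g, hg, e⟩ := hf
  simp only [e]
  have h1 : Differentiable ℝ g := hg.differentiable (by simp)
  refine (h1 _).comp t ?_
  rw [differentiableAt_pi]
  intro i
  by_cases h : (i : Coord n I) = c
  · subst h; simp
  · simp [Function.update_of_ne h]

lemma pd_add {F G : SFun n I} (hF : IsLocal gh F) (hG : IsLocal gh G) (c : Coord n I) :
    pd c (F + G) = pd c F + pd c G := by
  classical
  funext m p
  exact deriv_fun_add ((hF.coeff m).differentiableAt c p _) ((hG.coeff m).differentiableAt c p _)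

lemma pd_smul (F : SFun n I) (c : Coord n I) (r : ℝ) : pd c (r • F) = r • pd c F := by
  classical
  funext m p
  exact deriv_const_mul_field r

lemma partialL_add {F G : SFun n I} (hF : IsLocal gh F) (hG : IsLocal gh G) (v : Var n I) :
    partialL gh v (F + G) = partialL gh v F + partialL gh v G := by
  unfold partialL
  split_ifs
  · exact pd_add hF hG _
  · funext m p; simp [mul_add]

lemma partialL_smul (F : SFun n I) (v : Var n I) (r : ℝ) :
    partialL gh v (r • F) = r • partialL gh v F := by
  unfold partialL
  split_ifs
  · exact pd_smul F _ _
  · funext m p; simp; ring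

lemma mul_add_right (P F G : SFun n I) : mul gh P (F + G) = mul gh P F + mul gh P G := by
  funext m p
  simp only [mul, Pi.add_apply]
  split_ifs
  · simp [mul_add, Finset.sum_add_distrib]
  · simp

lemma mul_smul_right (P F : SFun n I) (r : ℝ) : mul gh P (r • F) = r • mul gh P F := by
  funext m p
  simp only [mul, Pi.smul_apply, smul_eq_mul]
  split_ifs
  · rw [Finset.mul_sum]; exact Finset.sum_congr rfl fun _ _ => by ring
  · simp

instance [Finite I] : Finite (Z I) := by
  have : Function.Surjective (fun x : I ⊕ I => x.elim Z.field Z.anti) := by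
    rintro (i | i)
    · exact ⟨Sum.inl i, rfl⟩
    · exact ⟨Sum.inr i, rfl⟩
  exact Finite.of_surjective _ this

lemma finite_partialL [Finite I] {F : SFun n I} (hF : IsLocal gh F) (b : Mon n I)
    (p : Coord n I → ℝ) : {v | partialL gh v F b p ≠ 0}.Finite := by
  classical
  obtain ⟨T, hT, g, hg, e⟩ := hF.coeff b
  have h1 : {v : Var n I | Sum.inr v ∈ T}.Finite :=
    T.finite_toSet.preimage Sum.inr_injective.injOn
  have h2 : {v : Var n I | F (b + Finsupp.single v 1) ≠ 0}.Finite := by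
    have : (⋃ z : Z I, {m | F m ≠ 0 ∧ Mon.puregh gh m = Mon.puregh gh b + z.puregh gh ∧
        Mon.antifd gh m = Mon.antifd gh b + z.antifd gh}).Finite :=
      Set.finite_iUnion fun z => hF.finite _ _
    refine Set.Finite.of_finite_image (f := fun v => b + Finsupp.single v 1) (this.subset ?_) ?_
    · rintro _ ⟨v, hv, rfl⟩
      refine Set.mem_iUnion.2 ⟨v.1, hv, ?_, ?_⟩
      · unfold Mon.puregh
        rw [Finsupp.sum_add_index' (by simp) (by intros; ring)]
        simp
      · unfold Mon.antifd
        rw [Finsupp.sum_add_index' (by simp) (by intros; ring)]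
        simp
    · intro v _ w _ h
      have h' := add_left_cancel h
      exact Finsupp.single_left_injective one_ne_zero h'
  refine (h1.union h2).subset fun v hv => ?_
  simp only [Set.mem_ofPred_eq, partialL] at hv
  split_ifs at hv with ho
  · left
    by_contra hvT
    apply hv
    simp only [pd, e]
    have : (fun t : ℝ => g fun c : T => Function.update p (Sum.inr v) t c)
        = fun _ => g fun c : T => p c := by
      funext t
      congr 1
      funext c
      refine Function.update_of_ne ?_ _ _
      rintro h
      exact hvT (by have := c.2; rwa [h] at this)
    rw [this]
    simp
  · right
    intro h
    apply hv
    simp [h]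

lemma finite_along [Finite I] (Q : Var n I → SFun n I) {F : SFun n I} (hF : IsLocal gh F)
    (m : Mon n I) (p : Coord n I → ℝ) :
    (Function.support fun v => mul gh (Q v) (partialL gh v F) m p).Finite := by
  classical
  have : (⋃ ab ∈ Finset.HasAntidiagonal.antidiagonal m, {v | partialL gh v F ab.2 p ≠ 0}).Finite :=
    (Finset.finite_toSet _).biUnion fun ab _ => finite_partialL hF ab.2 p
  refine this.subset fun v hv => ?_
  by_contra h
  apply hv
  simp only [Set.mem_iUnion, Set.mem_ofPred_eq, not_exists, not_not] at h
  simp only [mul]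
  split_ifs
  · exact Finset.sum_eq_zero fun ab hab => by rw [h ab hab, mul_zero]
  · rfl

lemma along_add [Finite I] (Q : Var n I → SFun n I) {F G : SFun n I} (hF : IsLocal gh F)
    (hG : IsLocal gh G) : along gh Q (F + G) = along gh Q F + along gh Q G := by
  funext m p
  simp only [along, Pi.add_apply, partialL_add hF hG, mul_add_right]
  exact finsum_add_distrib (finite_along Q hF m p) (finite_along Q hG m p)

lemma along_smul (Q : Var n I → SFun n I) (F : SFun n I) (r : ℝ) :
    along gh Q (r • F) = r • along gh Q F := by
  funext m p
  simp only [along, Pi.smul_apply, partialL_smul, mul_smul_right]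
  exact (smul_finsum r _).symm

lemma D_add [Finite I] (μ : Fin n) {F G : SFun n I} (hF : IsLocal gh F) (hG : IsLocal gh G) :
    D gh μ (F + G) = D gh μ F + D gh μ G := by
  simp only [D, pd_add hF hG, along_add _ hF hG]
  abel

lemma D_smul (μ : Fin n) (F : SFun n I) (r : ℝ) : D gh μ (r • F) = r • D gh μ F := by
  simp only [D, pd_smul, along_smul, smul_add]

lemma d_add [Finite I] {g k : ℤ} {α η : Form n I} (hα : IsForm gh g k α) (hη : IsForm gh g k η) :
    d gh (α + η) = d gh α + d gh η := by
  funext T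
  simp only [d, Pi.add_apply, D_add _ (hα.isLocal _) (hη.isLocal _), smul_add,
    Finset.sum_add_distrib]

lemma d_smul (α : Form n I) (r : ℝ) : d gh (r • α) = r • d gh α := by
  funext T
  simp only [d, Pi.smul_apply, D_smul, Finset.smul_sum, smul_comm r]

lemma s_add [Finite I] (L : SFun n I) {g k : ℤ} {α η : Form n I} (hα : IsForm gh g k α)
    (hη : IsForm gh g k η) : s gh L (α + η) = s gh L α + s gh L η := by
  funext S
  simp only [s, brst, Pi.add_apply, along_add _ (hα.isLocal S) (hη.isLocal S), smul_add]

lemma s_smul (L : SFun n I) (α : Form n I) (r : ℝ) : s gh L (r • α) = r • s gh L α := by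
  funext S
  simp only [s, brst, Pi.smul_apply, along_smul, smul_comm r]

lemma s_zero (L : SFun n I) : s gh L 0 = 0 := by simpa using s_smul (gh := gh) L 0 0

lemma d_zero : d gh (0 : Form n I) = 0 := by simpa using d_smul (gh := gh) (0 : Form n I) 0

/-! The cohomology groups -/

variable (gh) [Finite I] (L : SFun n I)

/-- Cocycles of `H^{g,k}(s|d)`: `s α + d η = 0` for some local `η`. -/
def cocycles (g k : ℤ) : Submodule ℝ (Form n I) where
  carrier := {α | IsForm gh g k α ∧ ∃ η, IsForm gh (g + 1) (k - 1) η ∧ s gh L α + d gh η = 0}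
  zero_mem' := ⟨IsForm.zero, 0, IsForm.zero, by simp [s_zero, d_zero]⟩
  add_mem' := by
    rintro α α' ⟨h, η, hη, e⟩ ⟨h', η', hη', e'⟩
    refine ⟨h.add h', η + η', hη.add hη', ?_⟩
    rw [s_add L h h', d_add hη hη', add_add_add_comm, e, e', add_zero]
  smul_mem' := by
    rintro r α ⟨h, η, hη, e⟩
    refine ⟨h.smul r, r • η, hη.smul r, ?_⟩
    rw [s_smul, d_smul, ← smul_add, e, smul_zero]

/-- Coboundaries of `H^{g,k}(s|d)`: `α = s β + d η` with `β` and `η` local. -/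
def coboundaries (g k : ℤ) : Submodule ℝ (Form n I) where
  carrier := {α | ∃ β η, IsForm gh (g - 1) k β ∧ IsForm gh g (k - 1) η ∧ α = s gh L β + d gh η}
  zero_mem' := ⟨0, 0, IsForm.zero, IsForm.zero, by simp [s_zero, d_zero]⟩
  add_mem' := by
    rintro α α' ⟨β, η, hβ, hη, e⟩ ⟨β', η', hβ', hη', e'⟩
    refine ⟨β + β', η + η', hβ.add hβ', hη.add hη', ?_⟩
    rw [s_add L hβ hβ', d_add hη hη', add_add_add_comm, e, e']
  smul_mem' := by
    rintro r α ⟨β, η, hβ, hη, e⟩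
    refine ⟨r • β, r • η, hβ.smul r, hη.smul r, ?_⟩
    rw [s_smul, d_smul, ← smul_add, e]

/-- Local BRST cohomology `H^{g,k}(s|d)`. For `k = n` and `g = -1, -2` it describes
characteristic cohomology in form degree `n - 1`, `n - 2`. -/
abbrev H (g k : ℤ) : Type _ := cocycles gh L g k ⧸ (coboundaries gh L g k).submoduleOf (cocycles gh L g k)

/-- The class of a cocycle. -/
abbrev cls {g k : ℤ} (α : cocycles gh L g k) : H gh L g k := Submodule.Quotient.mk α

/-- The class `c` has depth at most `l`: it has a representative with a descent
`s α_0 + d α_1 = 0, ..., s α_{l-1} + d α_l = 0, s α_l = 0`. -/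
def DepthLE (l : ℕ) {g k : ℤ} (c : H gh L g k) : Prop :=
  ∃ α : cocycles gh L g k, cls gh L α = c ∧ ∃ η : ℕ → Form n I, η 0 = α ∧
    (∀ j ≤ l, IsForm gh (g + j) (k - j) (η j)) ∧
    (∀ j < l, s gh L (η j) + d gh (η (j + 1)) = 0) ∧ s gh L (η l) = 0

/-- Covariantizable classes: for some representative `α`, the Noether current `j` in
`s α + d j = 0` can be chosen gauge invariant, `s j = 0`. So these are the classes of depth at
most one. -/
def IsCovariantizable (c : H gh L (-1) n) : Prop := DepthLE gh L 1 c

end Cohomology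

end BV

end

noncomputable section

namespace BV

/-! Every local functional `∫ f` generates an evolutionary vector field `X_f = (f, ·)`, which is
`brst gh f`; the BRST differential is the case `f = L`. Four facts about these fields carry the
algebra. `X_f` commutes with total derivatives (`brst_D`). `X_f h` equals the antibracket density of
`f` and `h` up to a divergence (`isDiv_brst_sub_bracket`). `X_f` vanishes when `f` is a divergence
(`brst_of_isDiv_left`). Finally, `f ↦ X_f` turns the antibracket into the graded commutator
(`brst_commutator`). The last rests on the self-adjointness of second variations, which computes the
Euler derivatives of an antibracket (`euler_antibr`).

Consequently `s² = 0`, and `X_f` commutes up to sign with `s` whenever `f` is a cocycle modulo `d`,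
because `(L, f)` is then a divergence. So the antibracket descends to cohomology. In ghost number
`-1` the shifted parity is even, the bracket is strictly antisymmetric, and the Jacobi identity is
the commutator identity for `X_f` and `X_h` applied to a third density, modulo divergences. Applied
to a density of ghost number `-2`, the same identity is the module law.

Let `f` now have a closed current: `s f = ∂_μ k^μ` and `s k^μ = 0`. If `h` is a cocycle of ghost
number `-1`, then `X_h` commutes with `s` and with `∂_μ`, so `X_h k^μ` is a closed current for `X_h
f`; this gives the ideal. If `F` is a cocycle of ghost number `-2`, then `X_F` anticommutes with
`s`, so `X_F k^μ` is `s`-closed of ghost number `-1`. In negative ghost number `s` is acyclic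
(`exists_brst_eq`), hence `X_F k^μ = s l^μ`. Then `X_F f + ∂_μ l^μ` is `s`-closed of ghost number
`-2`, hence equal to some `s b`. Thus `(F, f)` is trivial in cohomology.

The acyclicity follows from that of the Koszul–Tate differential by removing the lowest antifield
number repeatedly. The resulting infinite sum is legitimate because local functions are formal sums
over the antifield number.

The calculus is carried out in an abstract graded commutative `JetAlgebra`, realised by the
polynomial local functions. It reaches formal sums by truncation: a component of bounded degree of
any result depends only on components of bounded degree of the arguments. -/

/-! Signs -/

/-- The sign `(-1)^a`. -/
def sg (a : ZMod 2) : ℝ := if a = 0 then 1 else -1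

@[simp] lemma sg_zero : sg 0 = 1 := by simp [sg]

@[simp] lemma sg_one : sg 1 = -1 := by simp [sg]

lemma zmod_two_cases (a : ZMod 2) : a = 0 ∨ a = 1 := by revert a; decide

lemma sg_add (a b : ZMod 2) : sg (a + b) = sg a * sg b := by
  rcases zmod_two_cases a with rfl | rfl <;> rcases zmod_two_cases b with rfl | rfl <;>
    simp [sg, show (1 + 1 : ZMod 2) = 0 from rfl]

@[simp] lemma sg_mul_self (a : ZMod 2) : sg a * sg a = 1 := by
  rcases zmod_two_cases a with rfl | rfl <;> simp

lemma sg_natCast (k : ℕ) : sg (k : ZMod 2) = (-1) ^ k := by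
  induction k with
  | zero => simp
  | succ k ih => rw [Nat.cast_succ, sg_add, ih, sg_one, pow_succ]

/-! Finite sums over families that are almost everywhere zero -/

lemma finsum_eq_finsum_of_injective {α β M : Type*} [AddCommMonoid M] {e : β → α}
    (he : Function.Injective e) {f : α → M} (h : ∀ x, x ∉ Set.range e → f x = 0) :
    ∑ᶠ x, f x = ∑ᶠ y, f (e y) := by
  rw [← finsum_mem_range he, ← finsum_mem_univ]
  refine finsum_mem_inter_support_eq f _ _ ?_
  ext x
  simp only [Set.univ_inter, Set.mem_inter_iff, Function.mem_support]
  exact ⟨fun hx => ⟨by_contra fun hn => hx (h x hn), hx⟩, And.right⟩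

/-! ### Vector fields on an abstract graded jet space -/

/-- A graded commutative algebra of functions on a jet space: `X v` are the jet variables, `del v`
the (left) derivatives with respect to them and `pdx μ` the explicit space-time derivatives. -/
structure JetAlgebra (n : ℕ) (ζ A : Type*) [Ring A] [Algebra ℝ A] where
  par : ζ → ZMod 2
  gr : ZMod 2 → Submodule ℝ A
  X : ζ × (Fin n → ℕ) → A
  del : ζ × (Fin n → ℕ) → A →ₗ[ℝ] A
  pdx : Fin n → A →ₗ[ℝ] A
  mul_mem {a b x y} : x ∈ gr a → y ∈ gr b → x * y ∈ gr (a + b)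
  comm {a b x y} : x ∈ gr a → y ∈ gr b → x * y = sg (a * b) • (y * x)
  X_mem v : X v ∈ gr (par v.1)
  del_mem {a x} (v) : x ∈ gr a → del v x ∈ gr (a + par v.1)
  pdx_mem {a x} (μ) : x ∈ gr a → pdx μ x ∈ gr a
  del_mul {a x} (v y) : x ∈ gr a →
    del v (x * y) = del v x * y + sg (par v.1 * a) • (x * del v y)
  pdx_mul (μ x y) : pdx μ (x * y) = pdx μ x * y + x * pdx μ y
  del_del (v w x) : del v (del w x) = sg (par v.1 * par w.1) • del w (del v x)
  del_pdx (v μ x) : del v (pdx μ x) = pdx μ (del v x)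
  pdx_pdx (μ l x) : pdx μ (pdx l x) = pdx l (pdx μ x)
  del_X_self v : del v (X v) = 1
  del_X_ne {v w} : v ≠ w → del v (X w) = 0
  pdx_X (μ v) : pdx μ (X v) = 0
  finite_del x : {v | del v x ≠ 0}.Finite

namespace JetAlgebra

variable {n : ℕ} {ζ A : Type*} [Ring A] [Algebra ℝ A] (J : JetAlgebra n ζ A)

lemma finite_support {M : Type*} [Zero M] (x : A) (φ : ζ × (Fin n → ℕ) → A → M)
    (h : ∀ v, φ v 0 = 0) : (Function.support fun v => φ v (J.del v x)).Finite :=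
  (J.finite_del x).subset fun v hv h0 => hv (by simp [h0, h])

lemma finite_support_fiber {M : Type*} [Zero M] (z : ζ) (x : A) (φ : (Fin n → ℕ) → A → M)
    (h : ∀ v, φ v 0 = 0) : (Function.support fun v => φ v (J.del (z, v) x)).Finite := by
  refine ((J.finite_del x).preimage (Prod.mk_right_injective z).injOn).subset
    fun v hv h0 => hv (by simp [h0, h])

lemma finsum_mem_gr {ι : Sort*} {a : ZMod 2} {f : ι → A} (h : ∀ i, f i ∈ J.gr a) :
    ∑ᶠ i, f i ∈ J.gr a :=
  finsum_induction (fun x => x ∈ J.gr a) (zero_mem _) (fun _ _ => add_mem) h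

/-- The vector field `∑_v P_v ∂/∂v`. -/
def along (P : ζ × (Fin n → ℕ) → A) : A →ₗ[ℝ] A where
  toFun x := ∑ᶠ v, P v * J.del v x
  map_add' x y := by
    simp only [map_add, mul_add]
    exact finsum_add_distrib (J.finite_support x (fun v a => P v * a) (by simp))
      (J.finite_support y (fun v a => P v * a) (by simp))
  map_smul' r x := by
    simp only [map_smul, mul_smul_comm, RingHom.id_apply]
    exact (smul_finsum r _).symm

lemma along_apply (P : ζ × (Fin n → ℕ) → A) (x : A) : J.along P x = ∑ᶠ v, P v * J.del v x := rfl

/-- A family of coefficients of parity `p` relative to the variables. -/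
def IsPar (p : ZMod 2) (P : ζ × (Fin n → ℕ) → A) : Prop := ∀ v, P v ∈ J.gr (J.par v.1 + p)

variable {J} {p q a b : ZMod 2} {P Q : ζ × (Fin n → ℕ) → A} {x y : A}

lemma along_mem (hP : J.IsPar p P) (hx : x ∈ J.gr a) : J.along P x ∈ J.gr (a + p) := by
  refine J.finsum_mem_gr fun v => ?_
  have := J.mul_mem (hP v) (J.del_mem v hx)
  convert this using 2
  exact (by decide : ∀ a p c : ZMod 2, a + p = c + p + (a + c)) _ _ _

/-- The parities of `P v` and of `∂/∂v` differ by `p`, so the parity of `v` drops out of the sign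
and the whole field obeys a Leibniz rule of parity `p`. -/
lemma along_mul (hP : J.IsPar p P) (hx : x ∈ J.gr a) (y : A) :
    J.along P (x * y) = J.along P x * y + sg (p * a) • (x * J.along P y) := by
  have h1 : ∀ v, P v * J.del v (x * y) = P v * J.del v x * y
      + sg (p * a) • (x * (P v * J.del v y)) := fun v => by
    rw [J.del_mul v y hx, mul_add, mul_smul_comm, ← mul_assoc, ← mul_assoc, J.comm (hP v) hx,
      smul_mul_assoc, smul_smul, ← sg_add, mul_assoc x]
    congr 3
    exact (by decide : ∀ a p c : ZMod 2, c * a + (c + p) * a = p * a) _ _ _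
  simp only [along_apply, h1]
  rw [finsum_add_distrib, ← smul_finsum, finsum_mul' _ _, mul_finsum' _ _]
  · exact J.finite_support y (fun v a => P v * a) (by simp)
  · exact J.finite_support x (fun v a => P v * a) (by simp)
  · exact J.finite_support x (fun v a => P v * a * y) (by simp)
  · exact J.finite_support y (fun v b => sg (p * a) • (x * (P v * b))) (by simp)

lemma del_along (hP : J.IsPar p P) (v : ζ × (Fin n → ℕ)) (x : A) :
    J.del v (J.along P x) = ∑ᶠ w, J.del v (P w) * J.del w x
      + sg (J.par v.1 * p) • J.along P (J.del v x) := by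
  have h1 : ∀ w, J.del v (P w * J.del w x) = J.del v (P w) * J.del w x
      + sg (J.par v.1 * p) • (P w * J.del w (J.del v x)) := fun w => by
    rw [J.del_mul v _ (hP w), J.del_del v w, mul_smul_comm, smul_smul, ← sg_add]
    congr 3
    exact (by decide : ∀ p c d : ZMod 2, c * (d + p) + c * d = c * p) _ _ _
  rw [along_apply, map_finsum _ (J.finite_support x (fun v a => P v * a) (by simp))]
  simp only [h1]
  rw [finsum_add_distrib, ← smul_finsum, along_apply]
  · exact J.finite_support x (fun w a => J.del v (P w) * a) (by simp)
  · refine (J.finite_support x (fun w a => sg (J.par v.1 * p) • (P w *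
      (sg (J.par w.1 * J.par v.1) • J.del v a))) (by simp)).subset fun w hw h => hw ?_
    simp only at h ⊢
    rwa [J.del_del w v]

/-- The second order part of a composition of two vector fields. -/
def secondOrder (J : JetAlgebra n ζ A) (p q : ZMod 2) (P Q : ζ × (Fin n → ℕ) → A) (x : A) : A :=
  ∑ᶠ v, sg (p * (J.par v.1 + q)) • (Q v * J.along P (J.del v x))

lemma along_along (hP : J.IsPar p P) (hQ : J.IsPar q Q) (x : A) :
    J.along P (J.along Q x) = ∑ᶠ v, J.along P (Q v) * J.del v x + J.secondOrder p q P Q x := by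
  rw [along_apply J Q, map_finsum _ (J.finite_support x (fun v a => Q v * a) (by simp))]
  simp only [along_mul hP (hQ _)]
  exact finsum_add_distrib (J.finite_support x (fun v a => J.along P (Q v) * a) (by simp))
    (J.finite_support x (fun v a => sg (p * (J.par v.1 + q)) • (Q v * J.along P a)) (by simp))

/-- Mixed second derivatives commute up to sign. All sums can be cut down to the finite set of
variables on which `x` depends, where exchanging the order of summation is allowed. -/
lemma secondOrder_symm (hP : J.IsPar p P) (hQ : J.IsPar q Q) (x : A) :
    J.secondOrder p q P Q x = sg (p * q) • J.secondOrder q p Q P x := by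
  classical
  set V := (J.finite_del x).toFinset with hV
  have h0 : ∀ v, v ∉ V → J.del v x = 0 := fun v hv => by simpa [hV] using hv
  have key : ∀ (p q) (P Q : ζ × (Fin n → ℕ) → A), J.secondOrder p q P Q x =
      ∑ v ∈ V, ∑ w ∈ V, sg (p * (J.par v.1 + q)) • (Q v * (P w * J.del w (J.del v x))) := by
    intro p q P Q
    rw [secondOrder, finsum_eq_sum_of_support_subset (s := V)]
    · refine Finset.sum_congr rfl fun v _ => ?_
      rw [along_apply, finsum_eq_sum_of_support_subset (s := V), Finset.mul_sum, Finset.smul_sum]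
      intro w hw
      by_contra h
      exact hw (by simp only [J.del_del w v, h0 w h, map_zero, smul_zero, mul_zero])
    · intro v hv
      by_contra h
      exact hv (by simp only [h0 v h, map_zero, smul_zero, mul_zero])
  rw [key, key, Finset.sum_comm, Finset.smul_sum]
  refine Finset.sum_congr rfl fun w _ => ?_
  rw [Finset.smul_sum]
  refine Finset.sum_congr rfl fun v _ => ?_
  rw [← mul_assoc, ← mul_assoc, J.comm (hQ v) (hP w), J.del_del w v]
  simp only [smul_mul_assoc, mul_smul_comm, smul_smul, ← sg_add]
  congr 2
  exact (by decide : ∀ p q c d : ZMod 2,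
    p * (c + q) + (d * c + (c + q) * (d + p)) = p * q + q * (d + p)) _ _ _ _

/-- The second-order parts cancel, so a graded commutator of vector fields is again a vector field,
determined by its coefficients. -/
lemma along_commutator (hP : J.IsPar p P) (hQ : J.IsPar q Q) (x : A) :
    J.along P (J.along Q x) - sg (p * q) • J.along Q (J.along P x) =
      J.along (fun v => J.along P (Q v) - sg (p * q) • J.along Q (P v)) x := by
  rw [along_along hP hQ, along_along hQ hP, secondOrder_symm hP hQ, smul_add,
    add_sub_add_right_eq_sub, smul_finsum, along_apply, ← finsum_sub_distrib]
  · simp only [sub_mul, smul_mul_assoc]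
  · exact J.finite_support x (fun v a => J.along P (Q v) * a) (by simp)
  · exact J.finite_support x (fun v a => sg (p * q) • (J.along Q (P v) * a)) (by simp)

lemma along_X (P : ζ × (Fin n → ℕ) → A) (v) : J.along P (J.X v) = P v := by
  rw [along_apply, finsum_eq_single _ v, J.del_X_self, mul_one]
  intro w hw
  rw [J.del_X_ne hw, mul_zero]

/-! Total derivatives -/

/-- Shift of the multi-index of a jet variable. -/
def shift (μ : Fin n) (v : ζ × (Fin n → ℕ)) : ζ × (Fin n → ℕ) := (v.1, v.2 + Pi.single μ 1)

variable (J) in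
/-- The total derivative. -/
def D (μ : Fin n) : A →ₗ[ℝ] A := J.pdx μ + J.along fun v => J.X (shift μ v)

lemma isPar_X (μ : Fin n) : J.IsPar 0 fun v => J.X (shift μ v) := fun v => by
  rw [add_zero]
  exact J.X_mem (shift μ v)

lemma D_mem (μ : Fin n) (hx : x ∈ J.gr a) : J.D μ x ∈ J.gr a := by
  refine add_mem (J.pdx_mem μ hx) ?_
  simpa using along_mem (isPar_X μ) hx

lemma D_mul (μ : Fin n) (hx : x ∈ J.gr a) (y : A) :
    J.D μ (x * y) = J.D μ x * y + x * J.D μ y := by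
  simp only [D, LinearMap.add_apply, J.pdx_mul, along_mul (isPar_X μ) hx, zero_mul, sg_zero,
    one_smul, add_mul, mul_add]
  abel

lemma shift_injective (μ : Fin n) : Function.Injective (shift (ζ := ζ) μ) := by
  rintro ⟨z, ν⟩ ⟨z', ν'⟩ h
  simp only [shift, Prod.mk.injEq, add_left_inj] at h
  exact Prod.ext h.1 h.2

lemma mem_range_shift {μ : Fin n} {v : ζ × (Fin n → ℕ)} (h : v.2 μ ≠ 0) :
    v ∈ Set.range (shift (ζ := ζ) μ) := by
  refine ⟨(v.1, v.2 - Pi.single μ 1), Prod.ext rfl ?_⟩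
  funext l
  by_cases hl : l = μ
  · subst hl; simp [shift]; omega
  · simp [shift, hl]

/-- The commutator of the two shift fields has coefficients `X (shift μ (shift l v)) - X (shift l
(shift μ v)) = 0`, and explicit derivatives pass through the shift fields because jet variables do
not depend on `x^μ`. -/
lemma D_comm (μ l : Fin n) (x : A) : J.D μ (J.D l x) = J.D l (J.D μ x) := by
  have h1 := along_commutator (isPar_X (J := J) μ) (isPar_X l) x
  simp only [mul_zero, sg_zero, one_smul, along_X] at h1
  have h2 : (fun v => J.X (shift μ (shift l v)) - J.X (shift l (shift μ v)))
      = fun _ : ζ × (Fin n → ℕ) => (0 : A) := by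
    funext v
    simp [shift, add_right_comm]
  have h4 : ∀ (μ l : Fin n) x, J.pdx μ (J.along (fun v => J.X (shift l v)) x)
      = J.along (fun v => J.X (shift l v)) (J.pdx μ x) := by
    intro μ l x
    rw [along_apply, map_finsum _ (J.finite_support x (fun v a => _ * a) (by simp)), along_apply]
    simp [J.pdx_mul, J.pdx_X, J.del_pdx]
  have h3 : J.along (fun v => J.X (shift μ v)) (J.along (fun v => J.X (shift l v)) x)
      = J.along (fun v => J.X (shift l v)) (J.along (fun v => J.X (shift μ v)) x) := by
    rw [← sub_eq_zero, h1, h2, along_apply]; simp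
  simp only [D, LinearMap.add_apply, map_add, h4, J.pdx_pdx μ l, h3]
  abel

/-- Among the coefficients of the total derivative, only that of `∂/∂v` is the variable `shift μ v`;
differentiating it produces the extra term. -/
lemma del_shift_D (μ : Fin n) (v) (x : A) :
    J.del (shift μ v) (J.D μ x) = J.D μ (J.del (shift μ v) x) + J.del v x := by
  classical
  rw [D, LinearMap.add_apply, map_add, J.del_pdx, del_along (isPar_X μ), LinearMap.add_apply,
    finsum_eq_single _ v, J.del_X_self, one_mul, mul_zero, sg_zero, one_smul]
  · abel
  · intro w hw
    rw [J.del_X_ne fun h => hw (shift_injective μ h).symm, zero_mul]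

/-- A variable with no derivative in direction `μ` is not a shift, so no coefficient of the total
derivative depends on it. -/
lemma del_D_of_eq_zero {μ : Fin n} {v : ζ × (Fin n → ℕ)} (hv : v.2 μ = 0) (x : A) :
    J.del v (J.D μ x) = J.D μ (J.del v x) := by
  rw [D, LinearMap.add_apply, map_add, J.del_pdx, del_along (isPar_X μ), LinearMap.add_apply,
    finsum_eq_zero_of_forall_eq_zero, mul_zero, sg_zero, one_smul, zero_add]
  intro w
  rw [J.del_X_ne, zero_mul]
  rintro rfl
  simp [shift] at hv

variable (J) in
/-- Iterated total derivatives. -/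
def DD (ν : Fin n → ℕ) : Module.End ℝ A := ((List.finRange n).map fun μ => (J.D μ) ^ (ν μ)).prod

lemma DD_zero : J.DD 0 = 1 := by simp [DD]

/-- `DD` is a product in a fixed order of directions; commutativity of total derivatives lets the
new factor move to the front. -/
lemma DD_add_single (ν : Fin n → ℕ) (μ : Fin n) : J.DD (ν + Pi.single μ 1) = J.D μ * J.DD ν := by
  classical
  have hc : ∀ l, Commute (J.D μ) (J.D l) := fun l => LinearMap.ext fun x => D_comm μ l x
  have key : ∀ l : List (Fin n), l.Nodup →
      (l.map fun k => (J.D k) ^ ((ν + Pi.single μ 1 : Fin n → ℕ) k)).prod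
        = if μ ∈ l then J.D μ * (l.map fun k => (J.D k) ^ (ν k)).prod
          else (l.map fun k => (J.D k) ^ (ν k)).prod := by
    intro l hl
    induction l with
    | nil => simp
    | cons k l ih =>
      rw [List.nodup_cons] at hl
      rw [List.map_cons, List.prod_cons, ih hl.2, List.map_cons, List.prod_cons]
      by_cases hk : k = μ
      · subst hk
        simp [hl.1, pow_succ', mul_assoc]
      · have hk' : ¬ μ = k := fun h => hk h.symm
        simp only [List.mem_cons, hk', false_or, Pi.add_apply, Pi.single_apply, hk, if_false,
          add_zero]
        split_ifs
        · rw [← mul_assoc, ← mul_assoc, ((hc k).pow_right _).eq]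
        · rfl
  rw [DD, key _ (List.nodup_finRange n), if_pos (List.mem_finRange μ), DD]

lemma DD_add_single_apply (ν : Fin n → ℕ) (μ : Fin n) (x : A) :
    J.DD (ν + Pi.single μ 1) x = J.D μ (J.DD ν x) := by rw [DD_add_single]; rfl

/-- Induction on multi-indices. -/
lemma multiIndex_induction {motive : (Fin n → ℕ) → Prop} (zero : motive 0)
    (add_single : ∀ ν μ, motive ν → motive (ν + Pi.single μ 1)) (ν) : motive ν := by
  induction h : ∑ μ, ν μ generalizing ν with
  | zero =>
    have : ν = 0 := by
      funext μ
      exact (Finset.sum_eq_zero_iff.1 h) μ (Finset.mem_univ _)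
    exact this ▸ zero
  | succ k ih =>
    obtain ⟨μ, hμ⟩ : ∃ μ, ν μ ≠ 0 := by
      by_contra hn
      push Not at hn
      simp [hn] at h
    have e : ν = (ν - Pi.single μ 1) + Pi.single μ 1 := by
      funext l
      by_cases hl : l = μ
      · subst hl; simp; omega
      · simp [hl]
    rw [e]
    refine add_single _ _ (ih _ ?_)
    rw [e] at h
    simp only [Pi.add_apply, Finset.sum_add_distrib, Finset.sum_pi_single', Finset.mem_univ,
      if_true] at h
    omega

lemma DD_mem (ν : Fin n → ℕ) (hx : x ∈ J.gr a) : J.DD ν x ∈ J.gr a := by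
  induction ν using multiIndex_induction with
  | zero => simpa [DD_zero]
  | add_single ν μ ih => rw [DD_add_single_apply]; exact D_mem μ ih

lemma DD_D (ν : Fin n → ℕ) (μ : Fin n) (x : A) : J.DD ν (J.D μ x) = J.D μ (J.DD ν x) := by
  induction ν using multiIndex_induction with
  | zero => simp [DD_zero]
  | add_single ν l ih => rw [DD_add_single_apply, DD_add_single_apply, ih, D_comm]

end JetAlgebra

end BV

namespace BV

namespace JetAlgebra

variable {n : ℕ} {ζ A : Type*} [Ring A] [Algebra ℝ A] {J : JetAlgebra n ζ A}
  {p q a b : ZMod 2} {x y : A}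

/-! Euler operators -/

/-- The sign `(-1)^|ν|` of a multi-index. -/
def mi (ν : Fin n → ℕ) : ℝ := (-1) ^ (∑ μ, ν μ)

lemma mi_zero : mi (0 : Fin n → ℕ) = 1 := by simp [mi]

lemma mi_add_single (ν : Fin n → ℕ) (μ : Fin n) : mi (ν + Pi.single μ 1) = - mi ν := by
  simp [mi, Finset.sum_add_distrib, pow_succ]

lemma mi_mul_self (ν : Fin n → ℕ) : mi ν * mi ν = 1 := by
  rw [mi, ← pow_add]
  exact Even.neg_one_pow ⟨_, rfl⟩

variable (J) in
/-- The adjoint `φ ↦ ∑_ν (-∂)_ν (φ (∂^L x / ∂z_ν))` of a linearization. -/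
def adjoint (z : ζ) (φ : A →ₗ[ℝ] A) : A →ₗ[ℝ] A where
  toFun x := ∑ᶠ ν : Fin n → ℕ, mi ν • J.DD ν (φ (J.del (z, ν) x))
  map_add' x y := by
    simp only [map_add, smul_add]
    exact finsum_add_distrib
      (J.finite_support_fiber z x (fun ν a => mi ν • J.DD ν (φ a)) (by simp))
      (J.finite_support_fiber z y (fun ν a => mi ν • J.DD ν (φ a)) (by simp))
  map_smul' r x := by
    simp only [map_smul, RingHom.id_apply, smul_finsum, smul_comm r]

lemma adjoint_apply (z : ζ) (φ : A →ₗ[ℝ] A) (x : A) :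
    J.adjoint z φ x = ∑ᶠ ν : Fin n → ℕ, mi ν • J.DD ν (φ (J.del (z, ν) x)) := rfl

lemma finite_support_adjoint (z : ζ) (φ : A →ₗ[ℝ] A) (x : A) :
    (Function.support fun ν : Fin n → ℕ => mi ν • J.DD ν (φ (J.del (z, ν) x))).Finite :=
  J.finite_support_fiber z x (fun ν a => mi ν • J.DD ν (φ a)) (by simp)

/-- `∂/∂z_ν` of a total derivative has an extra term `∂x/∂z_{ν-μ}`. Shifting the summation index
turns it into minus a total derivative outside `φ`, so only the commutator of `φ` with `∂_μ`
survives. With `φ` the identity this says that divergences have no Euler derivative; with `φ` a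
right multiplication it is integration by parts. -/
lemma adjoint_D (z : ζ) (φ : A →ₗ[ℝ] A) (μ : Fin n) (x : A) :
    J.adjoint z φ (J.D μ x) = J.adjoint z (φ ∘ₗ J.D μ - J.D μ ∘ₗ φ) x := by
  have h1 : ∀ ν : Fin n → ℕ, mi ν • J.DD ν (φ (J.del (z, ν) (J.D μ x))) =
      mi ν • J.DD ν (φ (J.D μ (J.del (z, ν) x))) + mi ν • J.DD ν (φ (J.del (z, ν) (J.D μ x)
        - J.D μ (J.del (z, ν) x))) := fun ν => by
    rw [← smul_add, ← map_add, ← map_add, add_sub_cancel]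
  have inj : Function.Injective fun ν : Fin n → ℕ => ν + Pi.single μ 1 :=
    add_left_injective _
  have h2 : ∑ᶠ ν : Fin n → ℕ, mi ν • J.DD ν (φ (J.del (z, ν) (J.D μ x)
        - J.D μ (J.del (z, ν) x))) =
      ∑ᶠ ν : Fin n → ℕ, -(mi ν • J.DD ν (J.D μ (φ (J.del (z, ν) x)))) := by
    rw [finsum_eq_finsum_of_injective inj]
    · refine finsum_congr fun ν => ?_
      have := del_shift_D (J := J) μ (z, ν) x
      simp only [shift] at this
      rw [this, add_sub_cancel_left, mi_add_single, DD_add_single_apply, DD_D, neg_smul]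
    · intro ν hν
      rw [del_D_of_eq_zero, sub_self, map_zero, map_zero, smul_zero]
      by_contra hc
      obtain ⟨⟨z', ν'⟩, hv⟩ := mem_range_shift (v := (z, ν)) hc
      exact hν ⟨ν', congrArg Prod.snd hv⟩
  rw [adjoint_apply, finsum_congr h1, finsum_add_distrib, h2, ← finsum_add_distrib,
    adjoint_apply]
  · refine finsum_congr fun ν => ?_
    simp [sub_eq_add_neg]
  · exact finite_support_adjoint z (φ ∘ₗ J.D μ) x
  · exact J.finite_support_fiber z x (fun ν a => -(mi ν • J.DD ν (J.D μ (φ a)))) (by simp)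
  · exact finite_support_adjoint z (φ ∘ₗ J.D μ) x
  · refine ((J.finite_support_fiber z (J.D μ x) (fun ν a => mi ν • J.DD ν (φ a)) (by simp)).union
      (finite_support_adjoint (J := J) z (φ ∘ₗ J.D μ) x)).subset fun ν hν => ?_
    by_contra h
    simp only [Set.mem_union, Function.mem_support, not_or, not_not, LinearMap.comp_apply] at h
    refine hν ?_
    simp only [map_sub, smul_sub, h.1, h.2, sub_zero]

variable (J) in
/-- The Euler-Lagrange left derivative. -/
def euler (z : ζ) : A →ₗ[ℝ] A := J.adjoint z LinearMap.id

variable (J) in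
/-- The operator `T_z(x, y) = ∑_ν (-∂)_ν (∂^L x / ∂z_ν · y)`. -/
def eulerMul (z : ζ) (x y : A) : A := J.adjoint z ((LinearMap.mul ℝ A).flip y) x

lemma euler_apply (z : ζ) (x : A) :
    J.euler z x = ∑ᶠ ν : Fin n → ℕ, mi ν • J.DD ν (J.del (z, ν) x) := rfl

lemma eulerMul_apply (z : ζ) (x y : A) :
    J.eulerMul z x y = ∑ᶠ ν : Fin n → ℕ, mi ν • J.DD ν (J.del (z, ν) x * y) := rfl

lemma finite_support_euler (z : ζ) (x : A) :
    (Function.support fun ν : Fin n → ℕ => mi ν • J.DD ν (J.del (z, ν) x)).Finite :=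
  finite_support_adjoint z LinearMap.id x

lemma euler_D (z : ζ) (μ : Fin n) (x : A) : J.euler z (J.D μ x) = 0 := by
  rw [euler, adjoint_D, LinearMap.id_comp, LinearMap.comp_id, sub_self, adjoint_apply]
  simp

lemma euler_mem (z : ζ) (hx : x ∈ J.gr a) : J.euler z x ∈ J.gr (a + J.par z) :=
  J.finsum_mem_gr fun ν => Submodule.smul_mem _ _ (DD_mem ν (J.del_mem (z, ν) hx))

/-- By the Leibniz rule, right multiplication by `y` commuted with `∂_μ` is minus right
multiplication by `∂_μ y`. -/
lemma eulerMul_D (z : ζ) (μ : Fin n) (hx : x ∈ J.gr a) (y : A) :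
    J.eulerMul z (J.D μ x) y = - J.eulerMul z x (J.D μ y) := by
  rw [eulerMul, adjoint_D, adjoint_apply, eulerMul_apply, ← finsum_neg_distrib]
  refine finsum_congr fun ν => ?_
  simp only [LinearMap.sub_apply, LinearMap.comp_apply, LinearMap.flip_apply,
    LinearMap.mul_apply', D_mul μ (J.del_mem (z, ν) hx)]
  rw [sub_add_cancel_left, map_neg, smul_neg]

lemma eulerMul_DD (z : ζ) (ν : Fin n → ℕ) (hx : x ∈ J.gr a) (y : A) :
    J.eulerMul z (J.DD ν x) y = mi ν • J.eulerMul z x (J.DD ν y) := by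
  induction ν using multiIndex_induction generalizing y with
  | zero => simp [DD_zero, mi_zero]
  | add_single ν μ ih =>
    rw [DD_add_single_apply, eulerMul_D z μ (DD_mem ν hx), ih, DD_D, DD_add_single_apply,
      mi_add_single, neg_smul]

lemma eulerMul_smul_left (z : ζ) (r : ℝ) (x y : A) :
    J.eulerMul z (r • x) y = r • J.eulerMul z x y := map_smul _ _ _

variable (J) in
/-- `eulerMul` as a linear map of its second argument. -/
def eulerMulRight (z : ζ) (x : A) : A →ₗ[ℝ] A where
  toFun := J.eulerMul z x
  map_add' y y' := by
    simp only [eulerMul_apply, mul_add, map_add, smul_add]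
    exact finsum_add_distrib
      (J.finite_support_fiber z x (fun ν a => mi ν • J.DD ν (a * y)) (by simp))
      (J.finite_support_fiber z x (fun ν a => mi ν • J.DD ν (a * y')) (by simp))
  map_smul' r y := by
    simp only [eulerMul_apply, mul_smul_comm, map_smul, RingHom.id_apply, smul_finsum,
      smul_comm r]

/-! Divergences -/

variable (J) in
/-- Total divergences. -/
def divergences : Submodule ℝ A := LinearMap.range (∑ μ, J.D μ ∘ₗ LinearMap.proj (φ := fun _ => A) μ)

lemma mem_divergences : x ∈ J.divergences ↔ ∃ k : Fin n → A, x = ∑ μ, J.D μ (k μ) := by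
  simp [divergences, eq_comm]

lemma D_mem_divergences (μ : Fin n) (x : A) : J.D μ x ∈ J.divergences := by
  refine mem_divergences.2 ⟨Pi.single μ x, ?_⟩
  rw [Finset.sum_eq_single μ] <;> simp +contextual

lemma euler_of_mem_divergences (z : ζ) (hx : x ∈ J.divergences) : J.euler z x = 0 := by
  obtain ⟨k, rfl⟩ := mem_divergences.1 hx
  simp [euler_D]

lemma integration_by_parts (ν : Fin n → ℕ) (hx : x ∈ J.gr a) (y : A) :
    J.DD ν x * y - mi ν • (x * J.DD ν y) ∈ J.divergences := by
  induction ν using multiIndex_induction generalizing y with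
  | zero => simp [DD_zero, mi_zero]
  | add_single ν μ ih =>
    have h1 := D_mul μ (DD_mem ν hx) y
    have h2 := sub_mem (D_mem_divergences μ (J.DD ν x * y)) (ih (J.D μ y))
    rw [h1, DD_D] at h2
    convert h2 using 1
    rw [DD_add_single_apply, DD_add_single_apply, mi_add_single, neg_smul]
    abel

/-! Evolutionary vector fields -/

variable (J) in
/-- The evolutionary vector field with characteristic `Q`. -/
def evol (Q : ζ → A) : A →ₗ[ℝ] A := J.along fun v => J.DD v.2 (Q v.1)

/-- A characteristic of parity `q` relative to the variables. -/
def IsChar (J : JetAlgebra n ζ A) (q : ZMod 2) (Q : ζ → A) : Prop :=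
  ∀ z, Q z ∈ J.gr (J.par z + q)

variable {P Q : ζ → A}

lemma IsChar.isPar (hQ : IsChar J q Q) : J.IsPar q fun v => J.DD v.2 (Q v.1) :=
  fun v => DD_mem v.2 (hQ v.1)

/-- The extra term in `∂/∂z_ν (∂_μ x)`, after reindexing, is exactly the one in which `∂_μ` hits the
coefficients `∂_ν Q`. This is why coefficients on derivatives must be derivatives of the
characteristic. -/
lemma evol_D (Q : ζ → A) (hQ : IsChar J q Q) (μ : Fin n) (x : A) :
    J.evol Q (J.D μ x) = J.D μ (J.evol Q x) := by
  have h1 : ∀ v, J.DD v.2 (Q v.1) * J.del v (J.D μ x) =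
      J.DD v.2 (Q v.1) * J.D μ (J.del v x) + J.DD v.2 (Q v.1) * (J.del v (J.D μ x)
        - J.D μ (J.del v x)) := fun v => by rw [← mul_add, add_sub_cancel]
  have h2 : ∑ᶠ v, J.DD v.2 (Q v.1) * (J.del v (J.D μ x) - J.D μ (J.del v x)) =
      ∑ᶠ v, J.D μ (J.DD v.2 (Q v.1)) * J.del v x := by
    rw [finsum_eq_finsum_of_injective (shift_injective μ)]
    · refine finsum_congr fun v => ?_
      rw [del_shift_D, add_sub_cancel_left]
      simp only [shift]
      rw [DD_add_single_apply]
    · intro v hv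
      rw [del_D_of_eq_zero, sub_self, mul_zero]
      by_contra h
      exact hv (mem_range_shift h)
  rw [evol, along_apply, finsum_congr h1, finsum_add_distrib, h2, along_apply, map_finsum]
  · rw [← finsum_add_distrib]
    · refine finsum_congr fun v => ?_
      rw [D_mul μ (hQ.isPar v), add_comm]
    · exact J.finite_support x (fun v a => _ * J.D μ a) (by simp)
    · exact J.finite_support x (fun v a => _ * a) (by simp)
  · exact J.finite_support x (fun v a => _ * a) (by simp)
  · exact J.finite_support x (fun v a => _ * J.D μ a) (by simp)
  · refine ((J.finite_support (J.D μ x) (fun v a => J.DD v.2 (Q v.1) * a) (by simp)).union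
      (J.finite_support x (fun v a => J.DD v.2 (Q v.1) * J.D μ a) (by simp))).subset
      fun ν hν => ?_
    by_contra h
    simp only [Set.mem_union, Function.mem_support, not_or, not_not] at h
    refine hν ?_
    simp only [mul_sub, h.1, h.2, sub_zero]

lemma evol_DD (hQ : IsChar J q Q) (ν : Fin n → ℕ) (x : A) :
    J.evol Q (J.DD ν x) = J.DD ν (J.evol Q x) := by
  induction ν using multiIndex_induction with
  | zero => simp [DD_zero]
  | add_single ν μ ih => rw [DD_add_single_apply, DD_add_single_apply, evol_D Q hQ, ih]

/-- Since both fields commute with iterated total derivatives, the coefficients of the commutator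
are the derivatives of a single characteristic. -/
lemma evol_commutator (hP : IsChar J p P) (hQ : IsChar J q Q) (x : A) :
    J.evol P (J.evol Q x) - sg (p * q) • J.evol Q (J.evol P x) =
      J.evol (fun z => J.evol P (Q z) - sg (p * q) • J.evol Q (P z)) x := by
  have := along_commutator hP.isPar hQ.isPar x
  rw [evol, evol, this]
  simp only [← evol.eq_1 J P, ← evol.eq_1 J Q, evol_DD hP, evol_DD hQ, ← map_smul, ← map_sub]
  rfl

lemma evol_euler (hQ : IsChar J q Q) (z : ζ) (x : A) :
    J.evol Q (J.euler z x) = ∑ᶠ ν, mi ν • J.DD ν (J.evol Q (J.del (z, ν) x)) := by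
  rw [euler_apply, map_finsum _ (finite_support_euler z x)]
  simp only [map_smul, evol_DD hQ]

variable [Fintype ζ]

lemma evol_eq_sum (Q : ζ → A) (x : A) :
    J.evol Q x = ∑ z, ∑ᶠ ν, J.DD ν (Q z) * J.del (z, ν) x := by
  rw [evol, along_apply, finsum_curry _ (J.finite_support x (fun v a => _ * a) (by simp)),
    finsum_eq_sum_of_fintype]

/-- Integrating by parts moves all derivatives from `Q` onto the partial derivatives of `x`. -/
lemma evol_sub_mem_divergences (hQ : IsChar J q Q) (x : A) :
    J.evol Q x - ∑ z, Q z * J.euler z x ∈ J.divergences := by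
  rw [evol_eq_sum, ← Finset.sum_sub_distrib]
  refine sum_mem fun z _ => ?_
  rw [euler_apply, mul_finsum' _ _ (finite_support_euler z x),
    ← finsum_sub_distrib]
  · refine finsum_induction (fun x => x ∈ J.divergences) (zero_mem _) (fun _ _ => add_mem)
      fun ν => ?_
    rw [mul_smul_comm]
    exact integration_by_parts ν (hQ z) _
  · exact J.finite_support_fiber z x (fun ν a => _ * a) (by simp)
  · exact J.finite_support_fiber z x (fun ν a => Q z * mi ν • J.DD ν a) (by simp)

/-- The Euler derivative of an evolutionary variation. -/
lemma euler_evol (hQ : IsChar J q Q) (z : ζ) (x : A) :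
    J.euler z (J.evol Q x) = ∑ w, J.eulerMul z (Q w) (J.euler w x)
      + sg (J.par z * q) • J.evol Q (J.euler z x) := by
  set V := (J.finite_del x).toFinset with hV
  have h0 : ∀ v, v ∉ V → J.del v x = 0 := fun v hv => by simpa [hV] using hv
  have e2 : ∀ ν, J.del (z, ν) (J.evol Q x) =
      ∑ w ∈ V, J.del (z, ν) (J.DD w.2 (Q w.1)) * J.del w x
        + sg (J.par z * q) • J.evol Q (J.del (z, ν) x) := fun ν => by
    rw [evol, del_along hQ.isPar, finsum_eq_sum_of_support_subset]
    intro w hw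
    by_contra h
    exact hw (by simp only [h0 w h, mul_zero])
  -- Moving the derivatives off `Q` with `eulerMul_DD` reassembles the terms `∂x/∂w_ν` into Euler
  -- derivatives of `x`.
  have e3 : ∑ w, J.eulerMul z (Q w) (J.euler w x) =
      ∑ w ∈ V, J.eulerMul z (J.DD w.2 (Q w.1)) (J.del w x) := by
    have : ∀ w : ζ, J.eulerMul z (Q w) (J.euler w x) =
        ∑ᶠ ν, J.eulerMul z (J.DD ν (Q w)) (J.del (w, ν) x) := fun w => by
      change J.eulerMulRight z (Q w) _ = _
      rw [euler_apply, map_finsum _ (finite_support_euler w x)]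
      refine finsum_congr fun ν => ?_
      rw [eulerMul_DD z ν (hQ w)]
      exact map_smul _ _ _
    have fin : (Function.support fun v : ζ × (Fin n → ℕ) =>
        J.eulerMul z (J.DD v.2 (Q v.1)) (J.del v x)) ⊆ V := by
      intro v hv
      by_contra h
      refine hv ?_
      simp only [h0 v h]
      exact map_zero (J.eulerMulRight z _)
    rw [← finsum_eq_sum_of_support_subset _ fin, finsum_curry _ (V.finite_toSet.subset fin),
      finsum_eq_sum_of_fintype]
    exact Finset.sum_congr rfl fun w _ => this w
  have fin2 : ∀ w ∈ V, (Function.support fun ν : Fin n → ℕ =>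
      mi ν • J.DD ν (J.del (z, ν) (J.DD w.2 (Q w.1)) * J.del w x)).Finite := fun w _ =>
    J.finite_support_fiber z _ (fun ν a => mi ν • J.DD ν (a * _)) (by simp)
  rw [euler_apply]
  simp only [e2, map_add, map_sum, smul_add, Finset.smul_sum]
  have fin3 : (Function.support fun ν : Fin n → ℕ =>
      mi ν • J.DD ν (J.evol Q (J.del (z, ν) x))).Finite :=
    J.finite_support_fiber z x (fun ν a => mi ν • J.DD ν (J.evol Q a)) (by simp)
  rw [finsum_add_distrib, finsum_sum_comm _ _ fin2, e3, evol_euler hQ, smul_finsum]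
  · simp only [map_smul, smul_comm (mi _) (sg _)]
    rfl
  · refine (V.finite_toSet.biUnion fin2).subset fun ν hν => ?_
    by_contra h
    simp only [Set.mem_iUnion, not_exists, Function.mem_support, not_not] at h
    exact hν (Finset.sum_eq_zero fun w hw => h w hw)
  · simp only [map_smul, smul_comm (mi _) (sg _)]
    exact fin3.subset fun ν hν h => hν (by simp only [h, smul_zero])

/-- The evolutionary variation of an Euler derivative (self-adjointness of the second
variation). -/
lemma evol_euler_eq_sum (hQ : IsChar J q Q) (hx : x ∈ J.gr a) (z : ζ) :
    J.evol Q (J.euler z x) = ∑ w, sg ((J.par w + q) * (a + J.par z + J.par w)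
      + J.par z * J.par w) • J.eulerMul z (J.euler w x) (Q w) := by
  set V := (J.finite_del x).toFinset with hV
  have h0 : ∀ v, v ∉ V → J.del v x = 0 := fun v hv => by simpa [hV] using hv
  -- The order of the second derivatives is exchanged and `Q` is moved to the right, so that the
  -- expression has the shape of `eulerMul` applied to derivatives of `x`.
  have e1 : ∀ ν, J.evol Q (J.del (z, ν) x) = ∑ w ∈ V, sg ((J.par w.1 + q) *
      (a + J.par z + J.par w.1) + J.par z * J.par w.1) •
        (J.del (z, ν) (J.del w x) * J.DD w.2 (Q w.1)) := fun ν => by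
    rw [evol, along_apply, finsum_eq_sum_of_support_subset (s := V)]
    · refine Finset.sum_congr rfl fun w _ => ?_
      rw [J.comm (hQ.isPar w) (J.del_mem w (J.del_mem (z, ν) hx)), J.del_del w, smul_mul_assoc,
        smul_smul, ← sg_add, mul_comm (J.par w.1) (J.par z)]
    · intro w hw
      by_contra h
      exact hw (by simp only [J.del_del w, h0 w h, map_zero, smul_zero, mul_zero])
  have fin2 : ∀ w ∈ V, (Function.support fun ν : Fin n → ℕ => mi ν • J.DD ν (sg ((J.par w.1 + q) *
      (a + J.par z + J.par w.1) + J.par z * J.par w.1) •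
        (J.del (z, ν) (J.del w x) * J.DD w.2 (Q w.1)))).Finite := fun w _ =>
    J.finite_support_fiber z _ (fun ν a => mi ν • J.DD ν (_ • (a * _))) (by simp)
  rw [evol_euler hQ]
  simp only [e1, map_sum, Finset.smul_sum]
  rw [finsum_sum_comm _ _ fin2]
  have e2 : ∀ w ∈ V, (∑ᶠ ν : Fin n → ℕ, mi ν • J.DD ν (sg ((J.par w.1 + q) *
      (a + J.par z + J.par w.1) + J.par z * J.par w.1) •
        (J.del (z, ν) (J.del w x) * J.DD w.2 (Q w.1)))) = sg ((J.par w.1 + q) *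
      (a + J.par z + J.par w.1) + J.par z * J.par w.1) •
        J.eulerMul z (J.del w x) (J.DD w.2 (Q w.1)) := fun w _ => by
    simp only [map_smul, smul_comm (mi _) (sg _)]
    rw [eulerMul_apply, smul_finsum]
  rw [Finset.sum_congr rfl e2]
  have fin : (Function.support fun w : ζ × (Fin n → ℕ) => sg ((J.par w.1 + q) *
      (a + J.par z + J.par w.1) + J.par z * J.par w.1) •
        J.eulerMul z (J.del w x) (J.DD w.2 (Q w.1))) ⊆ V := by
    intro v hv
    by_contra h
    refine hv ?_
    simp only [h0 v h, eulerMul, map_zero, smul_zero]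
  rw [← finsum_eq_sum_of_support_subset _ fin, finsum_curry _ (V.finite_toSet.subset fin),
    finsum_eq_sum_of_fintype]
  refine Finset.sum_congr rfl fun w _ => ?_
  dsimp only
  rw [← smul_finsum, euler_apply, eulerMul, map_finsum _ (finite_support_euler w x)]
  congr 1
  refine finsum_congr fun ν => ?_
  rw [map_smul]
  change _ = mi ν • J.eulerMul z (J.DD ν (J.del (w, ν) x)) (Q w)
  rw [eulerMul_DD z ν (J.del_mem (w, ν) hx), smul_smul, mi_mul_self, one_smul]

/-! The antibracket -/

/-- Pairing of the variables into conjugates of opposite parity. -/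
structure Conjugation (J : JetAlgebra n ζ A) where
  conj : Equiv.Perm ζ
  τ : ζ → ℝ
  conj_conj z : conj (conj z) = z
  par_conj z : J.par (conj z) = J.par z + 1
  τ_conj z : τ (conj z) = - τ z

variable (c : Conjugation J)

/-- The characteristic of `(x, ·)`, for `x` of parity `a`. -/
def ham (a : ZMod 2) (x : A) (z : ζ) : A :=
  (c.τ z * sg ((J.par z + 1) * (a + 1))) • J.euler (c.conj z) x

/-- The antibracket density, for `x` of parity `a`. -/
def antibr (a : ZMod 2) (x y : A) : A := ∑ z, ham c a x z * J.euler z y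

omit [Fintype ζ] in
lemma isChar_ham (hx : x ∈ J.gr a) : IsChar J (a + 1) (ham c a x) := fun z => by
  refine Submodule.smul_mem _ _ ?_
  have := euler_mem (c.conj z) hx
  rw [c.par_conj] at this
  rwa [show J.par z + (a + 1) = a + (J.par z + 1) by ring]

lemma antibr_mem (hx : x ∈ J.gr a) (hy : y ∈ J.gr b) : antibr c a x y ∈ J.gr (a + b + 1) := by
  refine sum_mem fun z _ => ?_
  have := J.mul_mem (isChar_ham c hx z) (euler_mem z hy)
  rwa [show J.par z + (a + 1) + (b + J.par z) = a + b + 1 from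
    (by decide : ∀ a b z : ZMod 2, z + (a + 1) + (b + z) = a + b + 1) _ _ _] at this

lemma evol_ham_sub_mem (hx : x ∈ J.gr a) (y : A) :
    J.evol (ham c a x) y - antibr c a x y ∈ J.divergences :=
  evol_sub_mem_divergences (isChar_ham c hx) y

/-- Conjugation of the summation variable exchanges the two Euler derivatives in every term; `τ`
supplies the overall minus sign and graded commutativity the rest. -/
lemma antibr_symm (hx : x ∈ J.gr a) (hy : y ∈ J.gr b) :
    antibr c a x y = -(sg ((a + 1) * (b + 1)) • antibr c b y x) := by
  rw [antibr, antibr, ← Equiv.sum_comp c.conj, Finset.smul_sum, ← Finset.sum_neg_distrib]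
  refine Finset.sum_congr rfl fun z _ => ?_
  have h1 := euler_mem z hx
  have h2 := euler_mem (c.conj z) hy
  rw [ham, ham, c.conj_conj, smul_mul_assoc, smul_mul_assoc, J.comm h1 h2, smul_smul, smul_smul,
    ← neg_smul, c.par_conj, c.τ_conj, neg_mul, neg_mul, mul_assoc, ← sg_add, mul_left_comm,
    ← sg_add]
  congr 4
  exact (by decide : ∀ a b z : ZMod 2, (z + 1 + 1) * (a + 1) + (a + z) * (b + (z + 1)) =
    (a + 1) * (b + 1) + (z + 1) * (b + 1)) _ _ _

/-- The bracket may be replaced by the variation of `y` along the field of `x`, since Euler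
derivatives kill divergences. In the resulting formula `euler_evol`, the sum containing derivatives
of the characteristic is, by self-adjointness (`evol_euler_eq_sum`), the variation of the Euler
derivative of `x` along the field of `y`. -/
lemma euler_antibr (hx : x ∈ J.gr a) (hy : y ∈ J.gr b) (z : ζ) :
    J.euler z (antibr c a x y) = sg (J.par z * (a + 1)) • J.evol (ham c a x) (J.euler z y)
      - sg ((a + 1) * (b + 1) + J.par z * (b + 1)) • J.evol (ham c b y) (J.euler z x) := by
  have h := euler_of_mem_divergences z (evol_ham_sub_mem c hx y)
  rw [map_sub, sub_eq_zero] at h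
  rw [← h, euler_evol (isChar_ham c hx), evol_euler_eq_sum (isChar_ham c hy) hx,
    ← Equiv.sum_comp c.conj, add_comm, sub_eq_add_neg, Finset.smul_sum, ← Finset.sum_neg_distrib]
  congr 1
  refine Finset.sum_congr rfl fun w _ => ?_
  simp only [ham, c.conj_conj, eulerMul_smul_left]
  have h2 : ∀ r : ℝ, J.eulerMul z (J.euler w x) (r • J.euler (c.conj w) y) =
      r • J.eulerMul z (J.euler w x) (J.euler (c.conj w) y) :=
    fun r => map_smul (J.eulerMulRight z (J.euler w x)) r _
  rw [h2, smul_smul, smul_smul, ← neg_smul, c.τ_conj, c.par_conj]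
  congr 1
  rw [neg_mul]
  congr 1
  rw [mul_assoc, mul_left_comm (sg _) (c.τ w), mul_left_comm (sg _) (c.τ w)]
  congr 1
  rw [← sg_add, ← sg_add]
  congr 1
  exact (by decide : ∀ a b z w : ZMod 2, (w + 1 + 1) * (a + 1) = (a + 1) * (b + 1) + z * (b + 1)
    + ((w + (b + 1)) * (a + z + w) + z * w + (w + 1) * (b + 1))) _ _ _ _

/-- Characteristics are Euler derivatives at the conjugate variable up to constant signs, so
`euler_antibr` gives the commutator of characteristics once the signs are compared. -/
lemma ham_antibr (hx : x ∈ J.gr a) (hy : y ∈ J.gr b) (z : ζ) :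
    ham c (a + b + 1) (antibr c a x y) z = J.evol (ham c a x) (ham c b y z)
      - sg ((a + 1) * (b + 1)) • J.evol (ham c b y) (ham c a x z) := by
  rw [ham, euler_antibr c hx hy, ham, ham, map_smul, map_smul, smul_sub, smul_smul, smul_smul,
    smul_smul, c.par_conj]
  congr 2
  · rw [mul_assoc, ← sg_add]
    congr 2
    exact (by decide : ∀ a b z : ZMod 2, (z + 1) * (a + b + 1 + 1) + (z + 1) * (a + 1)
      = (z + 1) * (b + 1)) _ _ _
  · rw [mul_assoc, ← sg_add, mul_left_comm, ← sg_add]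
    congr 2
    exact (by decide : ∀ a b z : ZMod 2, (z + 1) * (a + b + 1 + 1) + ((a + 1) * (b + 1) +
      (z + 1) * (b + 1)) = (a + 1) * (b + 1) + (z + 1) * (a + 1)) _ _ _

/-- `x ↦ (x, ·)` is a homomorphism to evolutionary vector fields. -/
theorem evol_ham_commutator (hx : x ∈ J.gr a) (hy : y ∈ J.gr b) (w : A) :
    J.evol (ham c a x) (J.evol (ham c b y) w)
      - sg ((a + 1) * (b + 1)) • J.evol (ham c b y) (J.evol (ham c a x) w) =
    J.evol (ham c (a + b + 1) (antibr c a x y)) w := by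
  rw [evol_commutator (isChar_ham c hx) (isChar_ham c hy)]
  congr 2
  funext z
  exact (ham_antibr c hx hy z).symm

end JetAlgebra

end BV

namespace BV

variable {n : ℕ} {I : Type*} {gh : I → ℕ}

/-! Weights of monomials -/

section Weight

variable {M : Type*} [AddCommMonoid M]

/-- The weight of a monomial with respect to weights of the variables. -/
def wt (w : Z I → M) : Mon n I →+ M :=
  Finsupp.liftAddHom fun v => (multiplesHom M (w v.1))

lemma wt_apply (w : Z I → M) (m : Mon n I) : wt w m = m.sum fun v e => e • w v.1 := rfl

lemma wt_single (w : Z I → M) (v : Var n I) (e : ℕ) :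
    wt w (Finsupp.single v e) = e • w v.1 := by
  rw [wt_apply]
  exact Finsupp.sum_single_index (zero_smul ℕ (w v.1))

lemma puregh_eq_wt (m : Mon n I) : Mon.puregh gh m = wt (Z.puregh gh) m := rfl

lemma antifd_eq_wt (m : Mon n I) : Mon.antifd gh m = wt (Z.antifd gh) m := rfl

end Weight

variable (gh) in
/-- The total number `puregh + antifd` of a monomial. -/
def Mon.deg (m : Mon n I) : ℕ := m.puregh gh + m.antifd gh

variable (gh) in
/-- Grassmann parity of a variable. -/
def Z.par (z : Z I) : ZMod 2 := (z.puregh gh + z.antifd gh : ℕ)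

variable (gh) in
/-- Grassmann parity of a monomial. -/
def Mon.par (m : Mon n I) : ZMod 2 := (m.deg gh : ℕ)

lemma Mon.puregh_add (a b : Mon n I) : (a + b).puregh gh = a.puregh gh + b.puregh gh := by
  simp only [puregh_eq_wt, map_add]

lemma Mon.antifd_add (a b : Mon n I) : (a + b).antifd gh = a.antifd gh + b.antifd gh := by
  simp only [antifd_eq_wt, map_add]

lemma Mon.deg_add (a b : Mon n I) : (a + b).deg gh = a.deg gh + b.deg gh := by
  simp only [Mon.deg, puregh_add, antifd_add]; ring

lemma Mon.par_add (a b : Mon n I) : (a + b).par gh = a.par gh + b.par gh := by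
  simp only [Mon.par, deg_add, Nat.cast_add]

lemma Mon.puregh_single (v : Var n I) : Mon.puregh gh (Finsupp.single v 1) = v.1.puregh gh := by
  simp [puregh_eq_wt, wt_single]

lemma Mon.antifd_single (v : Var n I) : Mon.antifd gh (Finsupp.single v 1) = v.1.antifd gh := by
  simp [antifd_eq_wt, wt_single]

lemma Mon.par_single (v : Var n I) : Mon.par gh (Finsupp.single v 1) = v.1.par gh := by
  rw [Mon.par, Mon.deg, puregh_single, antifd_single, Z.par]

lemma Mon.par_zero : Mon.par gh (0 : Mon n I) = 0 := by
  simpa using Mon.par_add (gh := gh) (0 : Mon n I) 0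

lemma Z.par_of_isOriginal {z : Z I} (h : z.IsOriginal gh) : z.par gh = 0 := by
  rw [Z.par, h, Nat.cast_zero]

lemma Z.isOdd_iff {z : Z I} : z.IsOdd gh ↔ z.par gh = 1 := by
  rw [Z.IsOdd, Z.par, ZMod.natCast_eq_one_iff_odd]

lemma Z.par_of_not_isOdd {z : Z I} (h : ¬ z.IsOdd gh) : z.par gh = 0 := by
  rw [Z.isOdd_iff] at h
  exact (zmod_two_cases _).resolve_right h

/-! Admissible monomials -/

lemma Mon.Admissible.mono {a b : Mon n I} (h : b.Admissible gh) (hab : a ≤ b) :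
    a.Admissible gh := fun v =>
  ⟨fun ho => Nat.eq_zero_of_le_zero ((hab v).trans_eq ((h v).1 ho)),
    fun ho => (hab v).trans ((h v).2 ho)⟩

lemma Mon.Admissible.left {a b : Mon n I} (h : (a + b).Admissible gh) : a.Admissible gh :=
  h.mono (by simp)

lemma Mon.Admissible.right {a b : Mon n I} (h : (a + b).Admissible gh) : b.Admissible gh :=
  h.mono (by simp)

lemma Mon.admissible_zero : Mon.Admissible gh (0 : Mon n I) := fun v => by simp

lemma Mon.admissible_single {v : Var n I} (hv : ¬ v.1.IsOriginal gh) :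
    Mon.Admissible gh (Finsupp.single v 1) := fun w => by
  classical
  rw [Finsupp.single_apply]
  split_ifs with h
  · subst h; simp [hv]
  · simp

/-! Signs of reordering -/

open Classical in
lemma sgn_eq_sum (a b : Mon n I) : sgn gh a b = (-1) ^ (a.sum fun v i => b.sum fun w j =>
    if v.1.IsOdd gh ∧ w.1.IsOdd gh ∧ WellOrderingRel w v then i * j else 0) := rfl

lemma sgn_add_left (a b c : Mon n I) : sgn gh (a + b) c = sgn gh a c * sgn gh b c := by
  classical
  rw [sgn_eq_sum, sgn_eq_sum, sgn_eq_sum, ← pow_add, Finsupp.sum_add_index']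
  · intro v
    simp
  · intro v i j
    rw [← Finsupp.sum_add]
    refine Finset.sum_congr rfl fun w _ => ?_
    dsimp only
    split_ifs <;> ring

lemma sgn_add_right (a b c : Mon n I) : sgn gh a (b + c) = sgn gh a b * sgn gh a c := by
  classical
  rw [sgn_eq_sum, sgn_eq_sum, sgn_eq_sum, ← pow_add, ← Finsupp.sum_add]
  congr 1
  refine Finset.sum_congr rfl fun w _ => ?_
  refine Finsupp.sum_add_index' ?_ ?_
  · simp
  · intro v i j
    split_ifs <;> ring

lemma sgn_mul_self (a b : Mon n I) : sgn gh a b * sgn gh a b = 1 := by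
  rw [sgn, ← pow_add]
  exact Even.neg_one_pow ⟨_, rfl⟩

@[simp] lemma sgn_zero_left (a : Mon n I) : sgn gh 0 a = 1 := by simp [sgn]

@[simp] lemma sgn_zero_right (a : Mon n I) : sgn gh a 0 = 1 := by simp [sgn]

/-- The two exponents together count all pairs of odd factors, one from each monomial, at distinct
variables. Admissibility of the product excludes a common odd variable, so nothing is missing on the
diagonal and the count has the parity of the product of parities. -/
lemma sgn_comm {a b : Mon n I} (h : (a + b).Admissible gh) :
    sgn gh a b = sg (a.par gh * b.par gh) * sgn gh b a := by
  classical
  have h1 : ∀ m : Mon n I, m.par gh = ∑ v ∈ m.support, (m v : ZMod 2) * v.1.par gh := by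
    intro m
    rw [Mon.par, Mon.deg, Mon.puregh, Mon.antifd, Finsupp.sum, Finsupp.sum,
      ← Finset.sum_add_distrib, Nat.cast_sum]
    refine Finset.sum_congr rfl fun v _ => ?_
    rw [Z.par]
    push_cast
    ring
  rw [← mul_one (sgn gh a b), ← sgn_mul_self b a, ← mul_assoc]
  congr 1
  rw [sgn, sgn, ← pow_add, ← sg_natCast, h1, h1]
  congr 1
  push_cast
  rw [Finset.sum_comm (s := b.support), Finset.sum_mul_sum, ← Finset.sum_add_distrib]
  refine Finset.sum_congr rfl fun v _ => ?_
  rw [← Finset.sum_add_distrib]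
  refine Finset.sum_congr rfl fun w _ => ?_
  by_cases hv : v.1.IsOdd gh
  · by_cases hw : w.1.IsOdd gh
    · have ev := Z.isOdd_iff.1 hv
      have ew := Z.isOdd_iff.1 hw
      simp only [hv, hw, true_and, ev, ew, mul_one]
      rcases trichotomous_of WellOrderingRel v w with hlt | rfl | hlt
      · have : ¬ WellOrderingRel w v := fun h' => asymm_of _ hlt h'
        simp [hlt, this, mul_comm]
      · have := (h v).2 hv
        have hz : a v * b v = 0 := by
          rw [Finsupp.add_apply] at this
          rcases Nat.eq_zero_or_pos (a v) with h0 | h0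
          · rw [h0, zero_mul]
          · rw [show b v = 0 by omega, mul_zero]
        have hz' : (a v : ZMod 2) * b v = 0 := by rw [← Nat.cast_mul, hz, Nat.cast_zero]
        have hz2 : (b v : ZMod 2) * a v = 0 := by rw [mul_comm]; exact hz'
        simp [hz', hz2]
      · have : ¬ WellOrderingRel v w := fun h' => asymm_of _ hlt h'
        simp [hlt, this]
    · simp [hw, Z.par_of_not_isOdd hw]
  · simp [hv, Z.par_of_not_isOdd hv]

/-! The product -/

open Classical in
lemma mul_apply (F G : SFun n I) (m : Mon n I) (p : Coord n I → ℝ) : mul gh F G m p =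
    if m.Admissible gh then
      ∑ ab ∈ Finset.HasAntidiagonal.antidiagonal m, sgn gh ab.1 ab.2 * F ab.1 p * G ab.2 p
    else 0 := rfl

lemma mul_add_left (F F' G : SFun n I) : mul gh (F + F') G = mul gh F G + mul gh F' G := by
  classical
  funext m p
  simp only [mul_apply, Pi.add_apply]
  split_ifs
  · simp [mul_add, add_mul, Finset.sum_add_distrib]
  · simp

lemma mul_smul_left (F G : SFun n I) (r : ℝ) : mul gh (r • F) G = r • mul gh F G := by
  classical
  funext m p
  simp only [mul_apply, Pi.smul_apply, smul_eq_mul]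
  split_ifs
  · rw [Finset.mul_sum]; exact Finset.sum_congr rfl fun _ _ => by ring
  · simp

lemma mul_zero_right (F : SFun n I) : mul gh F 0 = 0 := by
  simpa using mul_smul_right (gh := gh) F 0 0

lemma mul_zero_left (F : SFun n I) : mul gh 0 F = 0 := by
  simpa using mul_smul_left (gh := gh) 0 F 0

lemma exists_of_mul_ne_zero {F G : SFun n I} {m : Mon n I} (h : mul gh F G m ≠ 0) :
    m.Admissible gh ∧ ∃ a b, a + b = m ∧ F a ≠ 0 ∧ G b ≠ 0 := by
  classical
  obtain ⟨p, hp⟩ := Function.ne_iff.1 h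
  rw [mul_apply] at hp
  split_ifs at hp with hm
  · refine ⟨hm, ?_⟩
    obtain ⟨ab, hab, h0⟩ := Finset.exists_ne_zero_of_sum_ne_zero hp
    refine ⟨ab.1, ab.2, Finset.HasAntidiagonal.mem_antidiagonal.1 hab, ?_, ?_⟩
    · intro h1; rw [h1] at h0; simp at h0
    · intro h1; rw [h1] at h0; simp at h0
  · exact absurd rfl hp

/-- Both sides sum over splittings of `m` into three parts, and the two signs agree because `sgn` is
multiplicative in each argument. The intermediate admissibility tests are automatic, as parts of an
admissible monomial are admissible. -/
lemma mul_assoc' (F G H : SFun n I) : mul gh (mul gh F G) H = mul gh F (mul gh G H) := by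
  classical
  funext m p
  rw [mul_apply, mul_apply]
  split_ifs with hm
  swap
  · rfl
  have h1 : ∀ ab ∈ Finset.HasAntidiagonal.antidiagonal m,
      sgn gh ab.1 ab.2 * mul gh F G ab.1 p * H ab.2 p =
      ∑ cd ∈ Finset.HasAntidiagonal.antidiagonal ab.1,
        sgn gh ab.1 ab.2 * (sgn gh cd.1 cd.2 * F cd.1 p * G cd.2 p) * H ab.2 p := by
    intro ab hab
    rw [Finset.HasAntidiagonal.mem_antidiagonal] at hab
    rw [mul_apply, if_pos (hab ▸ hm).left, Finset.mul_sum, Finset.sum_mul]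
  have h2 : ∀ ab ∈ Finset.HasAntidiagonal.antidiagonal m,
      sgn gh ab.1 ab.2 * F ab.1 p * mul gh G H ab.2 p =
      ∑ cd ∈ Finset.HasAntidiagonal.antidiagonal ab.2,
        sgn gh ab.1 ab.2 * F ab.1 p * (sgn gh cd.1 cd.2 * G cd.1 p * H cd.2 p) := by
    intro ab hab
    rw [Finset.HasAntidiagonal.mem_antidiagonal] at hab
    rw [mul_apply, if_pos (hab ▸ hm).right, Finset.mul_sum]
  rw [Finset.sum_congr rfl h1, Finset.sum_congr rfl h2, Finset.sum_sigma', Finset.sum_sigma']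
  refine Finset.sum_nbij' (fun ⟨⟨_, c⟩, ⟨a, b⟩⟩ => ⟨(a, b + c), (b, c)⟩)
    (fun ⟨⟨a, _⟩, ⟨b, c⟩⟩ => ⟨(a + b, c), (a, b)⟩) ?_ ?_ ?_ ?_ ?_
  · rintro ⟨⟨ab, c⟩, ⟨a, b⟩⟩ h
    simp only [Finset.mem_sigma, Finset.HasAntidiagonal.mem_antidiagonal] at h ⊢
    exact ⟨by rw [← h.1, ← h.2, add_assoc], trivial⟩
  · rintro ⟨⟨a, bc⟩, ⟨b, c⟩⟩ h
    simp only [Finset.mem_sigma, Finset.HasAntidiagonal.mem_antidiagonal] at h ⊢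
    exact ⟨by rw [← h.1, ← h.2, add_assoc], trivial⟩
  · rintro ⟨⟨ab, c⟩, ⟨a, b⟩⟩ h
    simp only [Finset.mem_sigma, Finset.HasAntidiagonal.mem_antidiagonal] at h ⊢
    simp [h.2]
  · rintro ⟨⟨a, bc⟩, ⟨b, c⟩⟩ h
    simp only [Finset.mem_sigma, Finset.HasAntidiagonal.mem_antidiagonal] at h ⊢
    simp [h.2]
  · rintro ⟨⟨ab, c⟩, ⟨a, b⟩⟩ h
    simp only [Finset.mem_sigma, Finset.HasAntidiagonal.mem_antidiagonal] at h ⊢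
    rw [← h.2, sgn_add_left, sgn_add_right]
    ring

open Classical in
/-- The constant function one. -/
def one : SFun n I := fun m _ => if m = 0 then 1 else 0

/-- The product discards inadmissible monomials, so the unit law needs `F` to have none. -/
lemma one_mul' {F : SFun n I} (hF : ∀ m, F m ≠ 0 → m.Admissible gh) : mul gh one F = F := by
  classical
  funext m p
  rw [mul_apply]
  split_ifs with hm
  · rw [Finset.sum_eq_single (0, m)]
    · simp [one]
    · rintro ⟨a, b⟩ hab hne
      have : a ≠ 0 := by
        rintro rfl
        rw [Finset.HasAntidiagonal.mem_antidiagonal, zero_add] at hab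
        exact hne (by simp only at hab; rw [hab])
      simp [one, this]
    · simp
  · have : F m = 0 := by_contra fun h => hm (hF m h)
    rw [this]; rfl

lemma mul_one' {F : SFun n I} (hF : ∀ m, F m ≠ 0 → m.Admissible gh) : mul gh F one = F := by
  classical
  funext m p
  rw [mul_apply]
  split_ifs with hm
  · rw [Finset.sum_eq_single (m, 0)]
    · simp [one]
    · rintro ⟨a, b⟩ hab hne
      have : b ≠ 0 := by
        rintro rfl
        rw [Finset.HasAntidiagonal.mem_antidiagonal, add_zero] at hab
        exact hne (by simp only at hab; rw [hab])
      simp [one, this]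
    · simp
  · have : F m = 0 := by_contra fun h => hm (hF m h)
    rw [this]; rfl

/-- Homogeneous of Grassmann parity `a`. -/
def HasPar (gh : I → ℕ) (a : ZMod 2) (F : SFun n I) : Prop := ∀ m, F m ≠ 0 → m.par gh = a

lemma mul_comm' {a b : ZMod 2} {F G : SFun n I} (hF : HasPar gh a F) (hG : HasPar gh b G) :
    mul gh F G = sg (a * b) • mul gh G F := by
  classical
  funext m p
  rw [Pi.smul_apply, Pi.smul_apply, mul_apply, mul_apply]
  split_ifs with hm
  · rw [smul_eq_mul, Finset.mul_sum]
    refine Finset.sum_nbij' Prod.swap Prod.swap ?_ ?_ ?_ ?_ ?_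
    · simp [add_comm]
    · simp [add_comm]
    · simp
    · simp
    · rintro ⟨c, d⟩ hcd
      rw [Finset.HasAntidiagonal.mem_antidiagonal] at hcd
      simp only [Prod.fst_swap, Prod.snd_swap] at hcd ⊢
      by_cases hc : F c = 0
      · simp [hc]
      by_cases hd : G d = 0
      · simp [hd]
      rw [sgn_comm (hcd ▸ hm), hF c hc, hG d hd]
      ring
  · simp

/-! Derivatives with respect to the ghosts and antifields -/

/-- The weight `ab.1 v` kills the splittings in which the first part does not contain `v`; the
others come from splittings of `m` by adding one `v` to the first part. This is the Leibniz rule at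
the level of exponents. -/
lemma sum_antidiagonal_add_single [DecidableEq (Var n I)] (m : Mon n I) (v : Var n I)
    (f : Mon n I → Mon n I → ℝ) :
    ∑ ab ∈ Finset.HasAntidiagonal.antidiagonal (m + Finsupp.single v 1 : Mon n I), (ab.1 v : ℝ) * f ab.1 ab.2
    = ∑ ab ∈ Finset.HasAntidiagonal.antidiagonal m, ((ab.1 v : ℝ) + 1) *
        f (ab.1 + Finsupp.single v 1) ab.2 := by
  have e : ∀ a : Mon n I, a v ≠ 0 → a - Finsupp.single v 1 + Finsupp.single v 1 = a := by
    intro a ha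
    refine tsub_add_cancel_of_le ?_
    rw [Finsupp.single_le_iff]
    omega
  refine Finset.sum_bij_ne_zero (fun ab _ _ => (ab.1 - Finsupp.single v 1, ab.2)) ?_ ?_ ?_ ?_
  · rintro ⟨a, b⟩ hab h0
    rw [Finset.HasAntidiagonal.mem_antidiagonal] at hab ⊢
    have ha : a v ≠ 0 := fun h => h0 (by simp [h])
    have h1 := e a ha
    simp only at hab ⊢
    rw [← h1, add_right_comm] at hab
    exact add_right_cancel hab
  · rintro ⟨a, b⟩ hab h0 ⟨a', b'⟩ hab' h0' h
    have ha : a v ≠ 0 := fun h => h0 (by simp [h])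
    have ha' : a' v ≠ 0 := fun h => h0' (by simp [h])
    simp only [Prod.mk.injEq] at h ⊢
    exact ⟨by rw [← e a ha, ← e a' ha', h.1], h.2⟩
  · rintro ⟨a, b⟩ hab h0
    rw [Finset.HasAntidiagonal.mem_antidiagonal] at hab
    simp only at hab h0
    refine ⟨(a + Finsupp.single v 1, b), ?_, ?_, ?_⟩
    · rw [Finset.HasAntidiagonal.mem_antidiagonal, ← hab]
      simp only
      rw [add_right_comm]
    · simpa using h0
    · simp
  · rintro ⟨a, b⟩ hab h0
    have ha : a v ≠ 0 := fun h => h0 (by simp [h])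
    simp only
    rw [e a ha]
    congr 1
    rw [Finsupp.tsub_apply, Finsupp.single_eq_same, Nat.cast_sub (by omega)]
    simp

lemma sum_antidiagonal_add_single' [DecidableEq (Var n I)] (m : Mon n I) (v : Var n I)
    (f : Mon n I → Mon n I → ℝ) :
    ∑ ab ∈ Finset.HasAntidiagonal.antidiagonal (m + Finsupp.single v 1 : Mon n I), (ab.2 v : ℝ) * f ab.1 ab.2
    = ∑ ab ∈ Finset.HasAntidiagonal.antidiagonal m, ((ab.2 v : ℝ) + 1) *
        f ab.1 (ab.2 + Finsupp.single v 1) := by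
  have h := sum_antidiagonal_add_single m v fun a b => f b a
  have sw : ∀ (k : Mon n I) (φ : Mon n I → Mon n I → ℝ),
      ∑ ab ∈ Finset.HasAntidiagonal.antidiagonal k, φ ab.1 ab.2 =
      ∑ ab ∈ Finset.HasAntidiagonal.antidiagonal k, φ ab.2 ab.1 := fun k φ =>
    Finset.sum_nbij' Prod.swap Prod.swap (by simp [add_comm]) (by simp [add_comm]) (by simp)
      (by simp) (by simp)
  rw [sw _ fun a b => (b v : ℝ) * f a b, h]
  exact sw m fun a b => ((a v : ℝ) + 1) * f b (a + Finsupp.single v 1)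

lemma partialL_apply {v : Var n I} (hv : ¬ v.1.IsOriginal gh) (F : SFun n I) (m : Mon n I)
    (p : Coord n I → ℝ) : partialL gh v F m p =
      (m v + 1) * sgn gh (Finsupp.single v 1) m * F (m + Finsupp.single v 1) p := by
  rw [partialL, if_neg hv]

lemma admissible_add_single {m : Mon n I} {v : Var n I} (hm : m.Admissible gh)
    (hv : ¬ v.1.IsOriginal gh) (h : v.1.IsOdd gh → m v = 0) :
    (m + Finsupp.single v 1).Admissible gh := fun w => by
  classical
  refine ⟨fun hw => ?_, fun hw => ?_⟩
  · have : v ≠ w := by rintro rfl; exact hv hw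
    simp [this, (hm w).1 hw]
  · by_cases hvw : v = w
    · subst hvw
      simp [h hw]
    · simpa [Finsupp.single_apply, hvw] using (hm w).2 hw

/-- When `m + v` is admissible, the exponent `m v + 1` is distributed over the two factors.
Otherwise `v` is odd and already in `m`: the left side is zero by `z_v² = 0`, and the two terms on
the right cancel. -/
lemma partialL_mul_of_not_isOriginal {a : ZMod 2} {v : Var n I} (hv : ¬ v.1.IsOriginal gh)
    {F G : SFun n I} (hF : HasPar gh a F) (hF' : ∀ m, F m ≠ 0 → m.Admissible gh)
    (hG' : ∀ m, G m ≠ 0 → m.Admissible gh) :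
    partialL gh v (mul gh F G) = mul gh (partialL gh v F) G
      + sg (v.1.par gh * a) • mul gh F (partialL gh v G) := by
  classical
  funext m p
  rw [partialL_apply hv, Pi.add_apply, Pi.add_apply, Pi.smul_apply, Pi.smul_apply, mul_apply,
    mul_apply, mul_apply]
  by_cases hm : m.Admissible gh
  swap
  · rw [if_neg hm, if_neg hm, if_neg fun h => hm h.left]
    simp
  rw [if_pos hm, if_pos hm, smul_eq_mul]
  simp only [partialL_apply hv]
  set u : Mon n I := Finsupp.single v 1 with hu
  by_cases hmv : (m + u).Admissible gh
  · rw [if_pos hmv]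
    have e1 : (m v + 1 : ℝ) * sgn gh u m * ∑ ab ∈ Finset.HasAntidiagonal.antidiagonal (m + u),
        sgn gh ab.1 ab.2 * F ab.1 p * G ab.2 p =
        ∑ ab ∈ Finset.HasAntidiagonal.antidiagonal (m + u),
          ((ab.1 v : ℝ) * (sgn gh u m * sgn gh ab.1 ab.2 * F ab.1 p * G ab.2 p)) +
        ∑ ab ∈ Finset.HasAntidiagonal.antidiagonal (m + u),
          ((ab.2 v : ℝ) * (sgn gh u m * sgn gh ab.1 ab.2 * F ab.1 p * G ab.2 p)) := by
      rw [Finset.mul_sum, ← Finset.sum_add_distrib]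
      refine Finset.sum_congr rfl fun ab hab => ?_
      rw [Finset.HasAntidiagonal.mem_antidiagonal] at hab
      have : (m v + 1 : ℝ) = ab.1 v + ab.2 v := by
        have := DFunLike.congr_fun hab v
        simp only [Finsupp.add_apply, hu, Finsupp.single_eq_same] at this
        exact_mod_cast this.symm
      rw [this]
      ring
    rw [e1, sum_antidiagonal_add_single m v fun a b => sgn gh u m * sgn gh a b * F a p * G b p,
      sum_antidiagonal_add_single' m v fun a b => sgn gh u m * sgn gh a b * F a p * G b p,
      Finset.mul_sum]
    congr 1
    · refine Finset.sum_congr rfl fun ab hab => ?_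
      rw [Finset.HasAntidiagonal.mem_antidiagonal] at hab
      rw [← hab, ← hu, sgn_add_right, sgn_add_left]
      linear_combination (ab.1 v + 1 : ℝ) * sgn gh u ab.1 * sgn gh ab.1 ab.2 * F (ab.1 + u) p
        * G ab.2 p * sgn_mul_self (gh := gh) u ab.2
    · refine Finset.sum_congr rfl fun ab hab => ?_
      rw [Finset.HasAntidiagonal.mem_antidiagonal] at hab
      by_cases hFa : F ab.1 = 0
      · simp [hFa]
      have adm : (ab.1 + u).Admissible gh := hmv.mono (by rw [← hab]; simp)
      have hp : ab.1.par gh = a := hF _ hFa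
      have hc := sgn_comm adm
      rw [hp, hu, Mon.par_single, ← hu, mul_comm a] at hc
      rw [← hab, ← hu, sgn_add_right, sgn_add_right, hc]
      linear_combination (ab.2 v + 1 : ℝ) * sgn gh u ab.2 * sgn gh ab.1 ab.2 * F ab.1 p
        * G (ab.2 + u) p * sg (v.1.par gh * a) * sgn_mul_self (gh := gh) u ab.1
  -- Here `v` is odd with exponent one in `m`. Both terms on the right reduce to sums over
  -- splittings of `m' = m - v` with a `v` added to each part, with opposite signs.
  · rw [if_neg hmv, mul_zero]
    have hodd : v.1.IsOdd gh := by
      by_contra h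
      exact hmv (admissible_add_single hm hv fun h' => absurd h' h)
    have hmv1 : m v = 1 := by
      have h1 := (hm v).2 hodd
      have h2 : m v ≠ 0 := fun h => hmv (admissible_add_single hm hv fun _ => h)
      omega
    set m' := m - u with hm'
    have hmm : m = m' + u := by
      refine (tsub_add_cancel_of_le ?_).symm
      rw [hu, Finsupp.single_le_iff]
      omega
    have hmv' : m' v = 0 := by
      rw [hm', Finsupp.tsub_apply, hu, Finsupp.single_eq_same, hmv1]
    have vanF : ∀ k : Mon n I, k v ≠ 0 → F (k + u) = 0 := fun k hk => by
      by_contra h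
      have := (hF' _ h v).2 hodd
      rw [hu, Finsupp.add_apply, Finsupp.single_eq_same] at this
      omega
    have vanG : ∀ k : Mon n I, k v ≠ 0 → G (k + u) = 0 := fun k hk => by
      by_contra h
      have := (hG' _ h v).2 hodd
      rw [hu, Finsupp.add_apply, Finsupp.single_eq_same] at this
      omega
    -- The factor `F (ab.1 + u)` vanishes unless `v` lies in the second part, so the weight `ab.2 v`
    -- may be inserted and the sum rewritten over splittings of `m'`.
    have t1 : ∑ ab ∈ Finset.HasAntidiagonal.antidiagonal m, sgn gh ab.1 ab.2 *
          ((ab.1 v + 1) * sgn gh u ab.1 * F (ab.1 + u) p) * G ab.2 p =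
        ∑ ab ∈ Finset.HasAntidiagonal.antidiagonal m', sgn gh ab.1 (ab.2 + u) *
          (sgn gh u ab.1 * F (ab.1 + u) p) * G (ab.2 + u) p := by
      have : ∀ ab ∈ Finset.HasAntidiagonal.antidiagonal m, sgn gh ab.1 ab.2 *
          ((ab.1 v + 1) * sgn gh u ab.1 * F (ab.1 + u) p) * G ab.2 p =
          (ab.2 v : ℝ) * (sgn gh ab.1 ab.2 * (sgn gh u ab.1 * F (ab.1 + u) p) * G ab.2 p) := by
        intro ab hab
        rw [Finset.HasAntidiagonal.mem_antidiagonal] at hab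
        have hs := DFunLike.congr_fun hab v
        rw [Finsupp.add_apply, hmv1] at hs
        by_cases h0 : ab.1 v = 0
        · rw [h0, show ab.2 v = 1 by omega]; push_cast; ring
        · rw [vanF _ h0]; simp
      rw [Finset.sum_congr rfl this, hmm, hu, sum_antidiagonal_add_single' m' v fun a b =>
        sgn gh a b * (sgn gh u a * F (a + u) p) * G b p]
      refine Finset.sum_congr rfl fun ab hab => ?_
      rw [Finset.HasAntidiagonal.mem_antidiagonal] at hab
      have hs := DFunLike.congr_fun hab v
      rw [Finsupp.add_apply, hmv'] at hs
      rw [show ab.2 v = 0 by omega]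
      push_cast
      ring
    have t2 : ∑ ab ∈ Finset.HasAntidiagonal.antidiagonal m, sgn gh ab.1 ab.2 * F ab.1 p *
          ((ab.2 v + 1) * sgn gh u ab.2 * G (ab.2 + u) p) =
        ∑ ab ∈ Finset.HasAntidiagonal.antidiagonal m', sgn gh (ab.1 + u) ab.2 * F (ab.1 + u) p *
          (sgn gh u ab.2 * G (ab.2 + u) p) := by
      have : ∀ ab ∈ Finset.HasAntidiagonal.antidiagonal m, sgn gh ab.1 ab.2 * F ab.1 p *
          ((ab.2 v + 1) * sgn gh u ab.2 * G (ab.2 + u) p) =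
          (ab.1 v : ℝ) * (sgn gh ab.1 ab.2 * F ab.1 p * (sgn gh u ab.2 * G (ab.2 + u) p)) := by
        intro ab hab
        rw [Finset.HasAntidiagonal.mem_antidiagonal] at hab
        have hs := DFunLike.congr_fun hab v
        rw [Finsupp.add_apply, hmv1] at hs
        by_cases h0 : ab.2 v = 0
        · rw [h0, show ab.1 v = 1 by omega]; push_cast; ring
        · rw [vanG _ h0]; simp
      rw [Finset.sum_congr rfl this, hmm, hu, sum_antidiagonal_add_single m' v fun a b =>
        sgn gh a b * F a p * (sgn gh u b * G (b + u) p)]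
      refine Finset.sum_congr rfl fun ab hab => ?_
      rw [Finset.HasAntidiagonal.mem_antidiagonal] at hab
      have hs := DFunLike.congr_fun hab v
      rw [Finsupp.add_apply, hmv'] at hs
      rw [show ab.1 v = 0 by omega]
      push_cast
      ring
    rw [t1, t2, Finset.mul_sum, ← Finset.sum_add_distrib]
    refine (Finset.sum_eq_zero fun ab hab => ?_).symm
    rw [Finset.HasAntidiagonal.mem_antidiagonal] at hab
    by_cases hFa : F (ab.1 + u) = 0
    · simp [hFa]
    have adm := hF' _ hFa
    have hp : ab.1.par gh + v.1.par gh = a := by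
      rw [← hF _ hFa, Mon.par_add, hu, Mon.par_single]
    have hc := sgn_comm adm
    rw [hu, Mon.par_single, ← hu] at hc
    have ho := Z.isOdd_iff.1 hodd
    rw [ho] at hp
    rw [ho, mul_one] at hc
    rw [sgn_add_right, sgn_add_left, hc, ho, ← hp, one_mul, sg_add, sg_one]
    linear_combination sgn gh ab.1 ab.2 * F (ab.1 + u) p * G (ab.2 + u) p * sg (ab.1.par gh) *
      (sgn_mul_self (gh := gh) u ab.1 - sgn_mul_self (gh := gh) u ab.2)

/-- The sign is that of reordering the two variables. If they are one odd variable, the relevant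
coefficient of `F` is already zero by admissibility. -/
lemma partialL_partialL_of_not_isOriginal {v w : Var n I} (hv : ¬ v.1.IsOriginal gh)
    (hw : ¬ w.1.IsOriginal gh) {F : SFun n I} (hF : ∀ m, F m ≠ 0 → m.Admissible gh) :
    partialL gh v (partialL gh w F) =
      sg (v.1.par gh * w.1.par gh) • partialL gh w (partialL gh v F) := by
  classical
  funext m p
  rw [Pi.smul_apply, Pi.smul_apply, smul_eq_mul]
  simp only [partialL_apply hv, partialL_apply hw]
  rw [add_right_comm m (Finsupp.single w 1)]
  by_cases h : F (m + Finsupp.single v 1 + Finsupp.single w 1) = 0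
  · simp [h]
  have adm := (hF _ h).mono (a := Finsupp.single v 1 + Finsupp.single w 1)
    (by rw [add_assoc]; simp)
  have hc := sgn_comm adm
  rw [Mon.par_single, Mon.par_single] at hc
  have key : ((m v : ℝ) + 1) * (((m + Finsupp.single v 1 : Mon n I) w : ℕ) + 1) =
      ((m w : ℝ) + 1) * (((m + Finsupp.single w 1 : Mon n I) v : ℕ) + 1) := by
    by_cases hvw : v = w
    · subst hvw; rfl
    · simp [hvw, Ne.symm hvw]; ring
  rw [sgn_add_right, sgn_add_right, hc]
  linear_combination sgn gh (Finsupp.single v 1) m * sgn gh (Finsupp.single w 1) m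
    * sgn gh (Finsupp.single w 1) (Finsupp.single v 1) *
    F (m + Finsupp.single v 1 + Finsupp.single w 1) p * key
    - sgn gh (Finsupp.single v 1) m * sgn gh (Finsupp.single w 1) m
    * sgn gh (Finsupp.single w 1) (Finsupp.single v 1) *
    F (m + Finsupp.single v 1 + Finsupp.single w 1) p
    * ((m w : ℝ) + 1) * (((m + Finsupp.single w 1 : Mon n I) v : ℕ) + 1) *
      (sg_mul_self (v.1.par gh * w.1.par gh))

/-- The right derivative in terms of the left derivative. -/
lemma partialR_eq {a : ZMod 2} {F : SFun n I} (hF : HasPar gh a F)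
    (hF' : ∀ m, F m ≠ 0 → m.Admissible gh) (v : Var n I) :
    partialR gh v F = sg (v.1.par gh * (a + 1)) • partialL gh v F := by
  classical
  by_cases hv : v.1.IsOriginal gh
  · rw [partialR, partialL, if_pos hv, if_pos hv, Z.par_of_isOriginal hv]
    simp
  funext m p
  rw [Pi.smul_apply, Pi.smul_apply, smul_eq_mul, partialL_apply hv, partialR, if_neg hv]
  by_cases h : F (m + Finsupp.single v 1) = 0
  · simp [h]
  have hc := sgn_comm (hF' _ h)
  have hp := hF _ h
  rw [Mon.par_add, Mon.par_single] at hp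
  rw [Mon.par_single] at hc
  rw [hc, ← hp, (by decide : ∀ x y : ZMod 2, y * (x + y + 1) = x * y) _ _]
  ring

end BV

namespace BV

variable {n : ℕ} {I : Type*} {gh : I → ℕ}

/-! Calculus of local coefficients -/

open Classical in
/-- Partial derivative of a function of the numerical coordinates. -/
def pdCoeff (c : Coord n I) (f : (Coord n I → ℝ) → ℝ) (p : Coord n I → ℝ) : ℝ :=
  deriv (fun t => f (Function.update p c t)) (p c)

lemma pd_apply (c : Coord n I) (F : SFun n I) (m : Mon n I) : pd c F m = pdCoeff c (F m) := rfl

open Classical in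
/-- The direction of a coordinate among finitely many coordinates. -/
def direction (T : Finset (Coord n I)) (c : Coord n I) : T → ℝ := fun t => if t = c then 1 else 0

/-- Reduces derivatives in infinitely many coordinates to the Fréchet derivative of a smooth
function of finitely many, which gives smoothness and symmetry of second derivatives. -/
lemma pdCoeff_eq_fderiv {T : Finset (Coord n I)} {g : (T → ℝ) → ℝ} (hg : Differentiable ℝ g)
    {f : (Coord n I → ℝ) → ℝ} (hf : ∀ p, f p = g fun c => p c) (c : Coord n I)
    (p : Coord n I → ℝ) :
    pdCoeff c f p = fderiv ℝ g (fun t : T => p t) (direction T c) := by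
  classical
  have h1 : HasDerivAt (fun (t : ℝ) (i : T) => Function.update p c t i) (direction T c) (p c) := by
    rw [hasDerivAt_pi]
    intro i
    by_cases h : (i : Coord n I) = c
    · subst h
      simp only [Function.update_self, direction, if_true]
      exact hasDerivAt_id' _
    · simp only [direction, h, Function.update_of_ne h, if_false]
      exact hasDerivAt_const _ _
  have h2 : HasFDerivAt g (fderiv ℝ g fun t : T => p t)
      ((fun (t : ℝ) (i : T) => Function.update p c t i) (p c)) := by
    simpa using (hg fun t : T => p t).hasFDerivAt
  have h3 := h2.comp_hasDerivAt _ h1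
  have h4 : (fun t => f (Function.update p c t)) =
      g ∘ fun (t : ℝ) (i : T) => Function.update p c t i := by
    funext t
    exact hf _
  rw [pdCoeff, ← h3.deriv, ← h4]

namespace IsLocalCoeff

variable {f h : (Coord n I → ℝ) → ℝ}

lemma const (r : ℝ) : IsLocalCoeff (n := n) gh fun _ => r :=
  ⟨∅, by simp, fun _ => r, contDiff_const, fun _ => rfl⟩

lemma zero : IsLocalCoeff (n := n) gh 0 := const 0

lemma coord {v : Var n I} (hv : v.1.IsOriginal gh) :
    IsLocalCoeff gh fun p => p (Sum.inr v) := by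
  refine ⟨{Sum.inr v}, ?_, fun q => q ⟨Sum.inr v, by simp⟩, by fun_prop, fun _ => rfl⟩
  intro w hw
  rw [Finset.mem_singleton, Sum.inr.injEq] at hw
  rwa [hw]

lemma mul (hf : IsLocalCoeff gh f) (hh : IsLocalCoeff gh h) : IsLocalCoeff gh (f * h) := by
  classical
  obtain ⟨T, hT, g, hg, e⟩ := hf
  obtain ⟨T', hT', g', hg', e'⟩ := hh
  refine ⟨T ∪ T', fun v hv => (Finset.mem_union.1 hv).elim (hT v) (hT' v),
    fun q => g (fun c => q ⟨c, Finset.mem_union_left _ c.2⟩)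
      * g' (fun c => q ⟨c, Finset.mem_union_right _ c.2⟩), ?_, ?_⟩
  · refine (hg.comp ?_).mul (hg'.comp ?_) <;> fun_prop
  · intro p; simp [e, e']

lemma sum {ι : Type*} {s : Finset ι} {f : ι → (Coord n I → ℝ) → ℝ}
    (hf : ∀ i ∈ s, IsLocalCoeff gh (f i)) : IsLocalCoeff gh (∑ i ∈ s, f i) := by
  classical
  induction s using Finset.induction_on with
  | empty => simpa using zero
  | insert i s hi ih =>
    rw [Finset.sum_insert hi]
    exact (hf i (by simp)).add (ih fun j hj => hf j (by simp [hj]))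

lemma pd (hf : IsLocalCoeff gh f) (c : Coord n I) : IsLocalCoeff gh (pdCoeff c f) := by
  obtain ⟨T, hT, g, hg, e⟩ := hf
  refine ⟨T, hT, fun q => fderiv ℝ g q (direction T c), ?_, fun p =>
    pdCoeff_eq_fderiv (hg.differentiable (by simp)) e c p⟩
  exact (hg.fderiv_right (m := (⊤ : ℕ∞)) (by simp)).clm_apply contDiff_const

lemma pdCoeff_comm (hf : IsLocalCoeff gh f) (c c' : Coord n I) :
    pdCoeff c (pdCoeff c' f) = pdCoeff c' (pdCoeff c f) := by
  obtain ⟨T, hT, g, hg, e⟩ := hf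
  have hd : Differentiable ℝ g := hg.differentiable (by simp)
  have hd' : ContDiff ℝ (⊤ : ℕ∞) (fderiv ℝ g) := hg.fderiv_right (by simp)
  have hd2 : Differentiable ℝ (fderiv ℝ g) := hd'.differentiable (by simp)
  funext p
  have key : ∀ c c', pdCoeff c (pdCoeff c' f) p =
      fderiv ℝ (fderiv ℝ g) (fun t : T => p t) (direction T c) (direction T c') := by
    intro c c'
    rw [pdCoeff_eq_fderiv (g := fun q => fderiv ℝ g q (direction T c')) ?_
      (pdCoeff_eq_fderiv hd e c'), fderiv_clm_apply (hd2 _) (by fun_prop)]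
    · simp
    · exact hd2.clm_apply (by fun_prop)
  rw [key, key]
  have := (hg.contDiffAt (x := fun t : T => p t)).isSymmSndFDerivAt
    (by simpa using (mod_cast le_top : ((2 : ℕ∞) : WithTop ℕ∞) ≤ ((⊤ : ℕ∞) : WithTop ℕ∞)))
  exact this _ _

lemma finite_pd (hf : IsLocalCoeff gh f) :
    {v : Var n I | pdCoeff (Sum.inr v) f ≠ 0}.Finite := by
  obtain ⟨T, hT, g, hg, e⟩ := hf
  refine (T.finite_toSet.preimage Sum.inr_injective.injOn).subset fun v hv => ?_
  by_contra h
  refine hv ?_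
  funext p
  rw [pdCoeff_eq_fderiv (hg.differentiable (by simp)) e]
  have : direction T (Sum.inr v) = 0 := by
    funext t
    have : (t : Coord n I) ≠ Sum.inr v := fun h' => h (by
      have := t.2
      rw [h'] at this
      exact this)
    simp [direction, this]
  rw [this, map_zero, Pi.zero_apply]

open Classical in
lemma hasDerivAt (hf : IsLocalCoeff gh f) (c : Coord n I) (p : Coord n I → ℝ) :
    HasDerivAt (fun t => f (Function.update p c t)) (pdCoeff c f p) (p c) :=
  (hf.differentiableAt c p (p c)).hasDerivAt

end IsLocalCoeff

lemma pdCoeff_zero (c : Coord n I) : pdCoeff c (0 : (Coord n I → ℝ) → ℝ) = 0 := by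
  funext p
  simp [pdCoeff]

lemma pdCoeff_const (c : Coord n I) (r : ℝ) : pdCoeff c (fun _ => r) = 0 := by
  funext p
  simp [pdCoeff]

lemma pdCoeff_coord_self (c : Coord n I) : pdCoeff c (fun p => p c) = fun _ => 1 := by
  classical
  funext p
  simp [pdCoeff]

lemma pdCoeff_coord_ne {c c' : Coord n I} (h : c ≠ c') : pdCoeff c (fun p => p c') = 0 := by
  classical
  funext p
  simp [pdCoeff, Function.update_of_ne (Ne.symm h)]

lemma pdCoeff_smul (c : Coord n I) (r : ℝ) (f : (Coord n I → ℝ) → ℝ) :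
    pdCoeff c (r • f) = r • pdCoeff c f := by
  funext p
  exact deriv_const_mul_field r

open Classical in
lemma pd_mul {F G : SFun n I} (hF : ∀ m, IsLocalCoeff gh (F m)) (hG : ∀ m, IsLocalCoeff gh (G m))
    (c : Coord n I) : pd c (mul gh F G) = mul gh (pd c F) G + mul gh F (pd c G) := by
  funext m p
  rw [Pi.add_apply, Pi.add_apply, mul_apply, mul_apply, pd_apply]
  by_cases hm : m.Admissible gh
  · have h1 : HasDerivAt (fun t => mul gh F G m (Function.update p c t))
        (∑ ab ∈ Finset.HasAntidiagonal.antidiagonal m, (sgn gh ab.1 ab.2 * pd c F ab.1 p *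
          G ab.2 p + sgn gh ab.1 ab.2 * F ab.1 p * pd c G ab.2 p)) (p c) := by
      simp only [mul_apply, if_pos hm]
      refine HasDerivAt.fun_sum fun ab _ => ?_
      have := (((hF ab.1).hasDerivAt c p).const_mul (sgn gh ab.1 ab.2)).mul
        ((hG ab.2).hasDerivAt c p)
      simp only [Function.update_eq_self] at this
      exact this
    rw [if_pos hm, if_pos hm, ← Finset.sum_add_distrib, ← h1.deriv, pdCoeff]
  · have : mul gh F G m = 0 := by funext p; rw [mul_apply, if_neg hm]; rfl
    rw [if_neg hm, if_neg hm, this, pdCoeff_zero, add_zero]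
    rfl

/-! Polynomial local functions -/

variable (gh) in
/-- Local functions that are polynomials in the ghosts, the antifields and their derivatives. -/
def LocPoly (n : ℕ) : Submodule ℝ (SFun n I) where
  carrier := {F | (∀ m, IsLocalCoeff gh (F m)) ∧ (∀ m, F m ≠ 0 → m.Admissible gh) ∧
    {m | F m ≠ 0}.Finite}
  zero_mem' := ⟨fun _ => IsLocalCoeff.zero, fun _ h => absurd rfl h, by simp⟩
  add_mem' := by
    rintro F G ⟨h1, h2, h3⟩ ⟨k1, k2, k3⟩
    refine ⟨fun m => (h1 m).add (k1 m), fun m h => ?_, (h3.union k3).subset fun m h => ?_⟩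
    · by_cases h0 : F m = 0
      · exact k2 m fun h' => h (by simp [h0, h'])
      · exact h2 m h0
    · by_contra h'
      simp only [Set.mem_union, Set.mem_ofPred_eq, not_or, not_not] at h'
      exact h (by simp [h'.1, h'.2])
  smul_mem' := by
    rintro r F ⟨h1, h2, h3⟩
    exact ⟨fun m => (h1 m).smul r, fun m h => h2 m fun h' => h (by simp [h']),
      h3.subset fun m h h' => h (by simp [h'])⟩

namespace LocPoly

variable {F G : SFun n I}

lemma isLocal (hF : F ∈ LocPoly gh n) : IsLocal gh F :=
  ⟨hF.1, hF.2.1, fun _ _ => hF.2.2.subset fun _ h => h.1⟩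

lemma one_mem : one ∈ LocPoly gh (I := I) n := by
  classical
  refine ⟨fun m => ?_, fun m h => ?_, (Set.finite_singleton 0).subset fun m h => ?_⟩
  · exact IsLocalCoeff.const (if m = 0 then 1 else 0)
  · by_cases h0 : m = 0
    · rw [h0]; exact Mon.admissible_zero
    · exact absurd (funext fun _ => by simp [one, h0]) h
  · by_contra h0
    exact h (funext fun _ => by simp [one, show m ≠ 0 from h0])

lemma mul_mem (hF : F ∈ LocPoly gh n) (hG : G ∈ LocPoly gh n) : mul gh F G ∈ LocPoly gh n := by
  classical
  refine ⟨fun m => ?_, fun m h => (exists_of_mul_ne_zero h).1, ?_⟩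
  · by_cases hm : m.Admissible gh
    · have : mul gh F G m = ∑ ab ∈ Finset.HasAntidiagonal.antidiagonal m,
          sgn gh ab.1 ab.2 • (F ab.1 * G ab.2) := by
        funext p
        rw [mul_apply, if_pos hm, Finset.sum_apply]
        exact Finset.sum_congr rfl fun ab _ => by simp [mul_assoc]
      rw [this]
      exact IsLocalCoeff.sum fun ab _ => ((hF.1 _).mul (hG.1 _)).smul _
    · have : mul gh F G m = 0 := by funext p; rw [mul_apply, if_neg hm]; rfl
      rw [this]
      exact IsLocalCoeff.zero
  · refine (hF.2.2.image2 (· + ·) hG.2.2).subset fun m h => ?_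
    obtain ⟨-, a, b, hab, ha, hb⟩ := exists_of_mul_ne_zero h
    exact ⟨a, ha, b, hb, hab⟩

lemma pd_mem (hF : F ∈ LocPoly gh n) (c : Coord n I) : pd c F ∈ LocPoly gh n := by
  have h0 : ∀ m, pd c F m ≠ 0 → F m ≠ 0 := fun m h h' => h (by rw [pd_apply, h', pdCoeff_zero])
  exact ⟨fun m => (hF.1 m).pd c, fun m h => hF.2.1 m (h0 m h), hF.2.2.subset h0⟩

lemma partialL_mem (hF : F ∈ LocPoly gh n) (v : Var n I) : partialL gh v F ∈ LocPoly gh n := by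
  by_cases hv : v.1.IsOriginal gh
  · rw [partialL, if_pos hv]
    exact pd_mem hF _
  have h0 : ∀ m, partialL gh v F m ≠ 0 → F (m + Finsupp.single v 1) ≠ 0 := fun m h h' =>
    h (by funext p; rw [partialL_apply hv, h']; simp)
  refine ⟨fun m => ?_, fun m h => (hF.2.1 _ (h0 m h)).left, ?_⟩
  · have : partialL gh v F m =
        ((m v + 1) * sgn gh (Finsupp.single v 1) m) • F (m + Finsupp.single v 1) := by
      funext p; rw [partialL_apply hv]; rfl
    rw [this]
    exact (hF.1 _).smul _
  · exact (hF.2.2.preimage (add_left_injective (Finsupp.single v 1)).injOn).subset h0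

lemma X_mem (v : Var n I) : X gh v ∈ LocPoly gh n := by
  classical
  by_cases hv : v.1.IsOriginal gh
  · have h1 : ∀ m, X gh v m = if m = 0 then (fun p => p (Sum.inr v)) else (0 : (Coord n I → ℝ) → ℝ) := by
      intro m; funext p; rw [X, if_pos hv]; split_ifs <;> rfl
    refine ⟨fun m => ?_, fun m h => ?_, (Set.finite_singleton 0).subset fun m h => ?_⟩
    · rw [h1]
      split_ifs
      · exact IsLocalCoeff.coord hv
      · exact IsLocalCoeff.zero
    · rw [h1] at h
      split_ifs at h with h0
      · rw [h0]; exact Mon.admissible_zero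
      · exact absurd rfl h
    · by_contra h0
      exact h (by rw [h1, if_neg (by simpa using h0)])
  · have h1 : ∀ m, X gh v m = if m = Finsupp.single v 1 then (fun _ => 1) else (0 : (Coord n I → ℝ) → ℝ) := by
      intro m; funext p; rw [X, if_neg hv]; split_ifs <;> rfl
    refine ⟨fun m => ?_, fun m h => ?_, (Set.finite_singleton (Finsupp.single v 1)).subset
      fun m h => ?_⟩
    · rw [h1]
      split_ifs
      · exact IsLocalCoeff.const 1
      · exact IsLocalCoeff.zero
    · rw [h1] at h
      split_ifs at h with h0
      · rw [h0]; exact Mon.admissible_single hv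
      · exact absurd rfl h
    · by_contra h0
      exact h (by rw [h1, if_neg (by simpa using h0)])

instance : Ring ↥(LocPoly gh (I := I) n) where
  __ := (inferInstance : AddCommGroup (LocPoly gh (I := I) n))
  mul F G := ⟨mul gh F.1 G.1, mul_mem F.2 G.2⟩
  one := ⟨one, one_mem⟩
  left_distrib _ _ _ := Subtype.ext (mul_add_right _ _ _)
  right_distrib _ _ _ := Subtype.ext (mul_add_left _ _ _)
  zero_mul _ := Subtype.ext (mul_zero_left _)
  mul_zero _ := Subtype.ext (mul_zero_right _)
  mul_assoc _ _ _ := Subtype.ext (mul_assoc' _ _ _)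
  one_mul F := Subtype.ext (one_mul' F.2.2.1)
  mul_one F := Subtype.ext (mul_one' F.2.2.1)

lemma coe_mul (F G : LocPoly gh (I := I) n) : (F * G : LocPoly gh n).1 = mul gh F.1 G.1 := rfl

instance : Algebra ℝ (LocPoly gh (I := I) n) :=
  Algebra.ofModule (fun _ _ _ => Subtype.ext (mul_smul_left _ _ _))
    fun _ _ _ => Subtype.ext (mul_smul_right _ _ _)

end LocPoly

end BV

namespace BV

variable {n : ℕ} {I : Type*} {gh : I → ℕ}

/-! Gradings of products and derivatives -/

section Weight

variable {M : Type*} [AddCommGroup M] {w : Z I → M} {c c' : M} {F G : SFun n I}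

/-- Homogeneous of weight `c`. -/
def HasWt (w : Z I → M) (c : M) (F : SFun n I) : Prop := ∀ m, F m ≠ 0 → wt w m = c

lemma HasWt.zero : HasWt w c (0 : SFun n I) := fun _ h => absurd rfl h

lemma HasWt.add (hF : HasWt w c F) (hG : HasWt w c G) : HasWt w c (F + G) := fun m h => by
  by_cases h1 : F m = 0
  · exact hG m fun h2 => h (by simp [h1, h2])
  · exact hF m h1

lemma HasWt.smul (r : ℝ) (hF : HasWt w c F) : HasWt w c (r • F) := fun m h =>
  hF m fun h' => h (by simp [h'])

lemma HasWt.neg (hF : HasWt w c F) : HasWt w c (-F) := fun m h =>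
  hF m fun h' => h (by simp [h'])

lemma HasWt.sum {ι : Type*} {s : Finset ι} {F : ι → SFun n I} (h : ∀ i ∈ s, HasWt w c (F i)) :
    HasWt w c (∑ i ∈ s, F i) := fun m hm => by
  rw [Finset.sum_apply] at hm
  obtain ⟨i, hi, h0⟩ := Finset.exists_ne_zero_of_sum_ne_zero hm
  exact h i hi m h0

lemma HasWt.finsum {ι : Type*} {F : ι → SFun n I} (h : ∀ i, HasWt w c (F i)) :
    HasWt w c fun m p => ∑ᶠ i, F i m p := fun m hm => by
  by_contra hc
  refine hm (funext fun p => ?_)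
  refine finsum_eq_zero_of_forall_eq_zero (f := fun i => F i m p) fun i => ?_
  rw [show F i m = 0 from by_contra fun h0 => hc (h i m h0), Pi.zero_apply]

lemma HasWt.mul (hF : HasWt w c F) (hG : HasWt w c' G) : HasWt w (c + c') (mul gh F G) :=
  fun m h => by
  obtain ⟨-, a, b, rfl, ha, hb⟩ := exists_of_mul_ne_zero h
  rw [map_add, hF a ha, hG b hb]

lemma HasWt.pd (x : Coord n I) (hF : HasWt w c F) : HasWt w c (pd x F) := fun m h =>
  hF m fun h' => h (by rw [pd_apply, h', pdCoeff_zero])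

variable (hw : ∀ z : Z I, z.IsOriginal gh → w z = 0)

include hw

/-- Original fields sit in the coefficients and are invisible to `wt`, so a weight must vanish on
them for every derivative to shift it by the weight of its variable. Parity, ghost number and
bidegree all satisfy this. -/
lemma HasWt.partialL (v : Var n I) (hF : HasWt w c F) :
    HasWt w (c - w v.1) (partialL gh v F) := fun m h => by
  by_cases hv : v.1.IsOriginal gh
  · rw [BV.partialL, if_pos hv] at h
    rw [hw _ hv, sub_zero]
    exact hF.pd _ m h
  · have := hF (m + Finsupp.single v 1) fun h' => h (by
      funext p; rw [partialL_apply hv, h']; simp)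
    rw [map_add, wt_single, one_smul] at this
    rw [← this, add_sub_cancel_right]

lemma HasWt.partialR (v : Var n I) (hF : HasWt w c F) :
    HasWt w (c - w v.1) (partialR gh v F) := fun m h => by
  by_cases hv : v.1.IsOriginal gh
  · rw [BV.partialR, if_pos hv] at h
    rw [hw _ hv, sub_zero]
    exact hF.pd _ m h
  · have := hF (m + Finsupp.single v 1) fun h' => h (by
      funext p; rw [BV.partialR, if_neg hv]; simp [h'])
    rw [map_add, wt_single, one_smul] at this
    rw [← this, add_sub_cancel_right]

lemma HasWt.X (v : Var n I) : HasWt w (w v.1) (X gh v) := fun m h => by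
  classical
  by_cases hv : v.1.IsOriginal gh
  · have : m = 0 := by
      by_contra h0
      exact h (by funext p; rw [BV.X, if_pos hv, if_neg h0]; rfl)
    rw [this, map_zero, hw _ hv]
  · have : m = Finsupp.single v 1 := by
      by_contra h0
      exact h (by funext p; rw [BV.X, if_neg hv, if_neg h0]; rfl)
    rw [this, wt_single, one_smul]

lemma HasWt.along {q : M} {Q : Var n I → SFun n I} (hQ : ∀ v, HasWt w (w v.1 + q) (Q v))
    (hF : HasWt w c F) : HasWt w (c + q) (along gh Q F) := by
  refine HasWt.finsum fun v => ?_
  have := (hQ v).mul (gh := gh) (hF.partialL hw v)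
  rwa [show w v.1 + q + (c - w v.1) = c + q by abel] at this

lemma HasWt.D (μ : Fin n) (hF : HasWt w c F) : HasWt w c (D gh μ F) := by
  refine (hF.pd _).add ?_
  have := HasWt.along hw (q := 0) (fun v => by
    simpa using HasWt.X hw (gh := gh) (n := n) (v.1, v.2 + Pi.single μ 1)) hF
  simpa using this

lemma HasWt.Dmulti (ν : Fin n → ℕ) (hF : HasWt w c F) : HasWt w c (Dmulti gh ν F) := by
  unfold BV.Dmulti
  induction List.finRange n with
  | nil => exact hF
  | cons μ l ih =>
    rw [List.foldr_cons]
    induction ν μ with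
    | zero => exact ih
    | succ k ih' =>
      rw [Function.iterate_succ_apply']
      exact ih'.D hw μ

lemma HasWt.eulerL (z : Z I) (hF : HasWt w c F) : HasWt w (c - w z) (eulerL gh z F) :=
  HasWt.finsum fun ν => ((hF.partialL hw (z, ν)).Dmulti hw ν).smul _

lemma HasWt.eulerR (z : Z I) (hF : HasWt w c F) : HasWt w (c - w z) (eulerR gh z F) :=
  HasWt.finsum fun ν => ((hF.partialR hw (z, ν)).Dmulti hw ν).smul _

end Weight

lemma par_eq_wt (m : Mon n I) : m.par gh = wt (Z.par gh) m := by
  induction m using Finsupp.induction_linear with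
  | zero => rw [Mon.par_zero, map_zero]
  | add f g hf hg => rw [Mon.par_add, map_add, hf, hg]
  | single v e =>
    rw [wt_single]
    induction e with
    | zero => rw [Finsupp.single_zero, Mon.par_zero, zero_smul]
    | succ e ih => rw [Finsupp.single_add, Mon.par_add, ih, Mon.par_single, succ_nsmul]

lemma hasPar_iff {a : ZMod 2} {F : SFun n I} : HasPar gh a F ↔ HasWt (Z.par gh) a F := by
  simp only [HasPar, HasWt, par_eq_wt]

variable (gh) in
/-- The ghost number of a variable. -/
def Z.ghost (z : Z I) : ℤ := z.puregh gh - z.antifd gh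

lemma Z.ghost_of_isOriginal {z : Z I} (h : z.IsOriginal gh) : z.ghost gh = 0 := by
  have h' : z.puregh gh + z.antifd gh = 0 := h
  rw [Z.ghost]
  omega

lemma hasGhost_iff {g : ℤ} {F : SFun n I} : HasGhost gh g F ↔ HasWt (Z.ghost gh) g F := by
  have h : ∀ m : Mon n I, (m.puregh gh : ℤ) - m.antifd gh = wt (Z.ghost gh) m := by
    intro m
    rw [Mon.puregh, Mon.antifd, wt_apply, Finsupp.sum, Finsupp.sum, Finsupp.sum]
    push_cast
    rw [← Finset.sum_sub_distrib]
    refine Finset.sum_congr rfl fun v _ => ?_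
    rw [Z.ghost, nsmul_eq_mul]
    ring
  simp only [HasGhost, HasWt, h]

lemma HasGhost.hasPar {g : ℤ} {F : SFun n I} (hF : HasGhost gh g F) : HasPar gh (g : ZMod 2) F := by
  intro m hm
  rw [← hF m hm, Mon.par, Mon.deg]
  push_cast
  exact (by decide : ∀ a b : ZMod 2, a + b = a - b) _ _

/-! The jet algebra of polynomial local functions -/

lemma partialL_X_self (v : Var n I) : partialL gh v (X gh v) = one := by
  classical
  by_cases hv : v.1.IsOriginal gh
  · rw [partialL, if_pos hv]
    funext m
    by_cases hm : m = 0
    · have : X gh v m = fun p => p (Sum.inr v) := by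
        funext p; rw [X, if_pos hv, if_pos hm]
      rw [pd_apply, this, pdCoeff_coord_self]
      funext p
      simp [one, hm]
    · have : X gh v m = 0 := by
        funext p; rw [X, if_pos hv, if_neg hm]; rfl
      rw [pd_apply, this, pdCoeff_zero]
      funext p
      simp [one, hm]
  · funext m p
    rw [partialL_apply hv, X, if_neg hv, one]
    by_cases hm : m = 0
    · simp [hm]
    · simp [hm]

lemma partialL_X_ne {v w : Var n I} (h : v ≠ w) : partialL gh v (X gh w) = 0 := by
  classical
  by_cases hv : v.1.IsOriginal gh
  · rw [partialL, if_pos hv]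
    funext m
    rw [pd_apply]
    by_cases hw : w.1.IsOriginal gh
    · by_cases hm : m = 0
      · have : X gh w m = fun p => p (Sum.inr w) := by
          funext p; rw [X, if_pos hw, if_pos hm]
        rw [this, pdCoeff_coord_ne (by simpa using h)]
        rfl
      · have : X gh w m = 0 := by
          funext p; rw [X, if_pos hw, if_neg hm]; rfl
        rw [this, pdCoeff_zero]
        rfl
    · have : X gh w m = fun _ => if m = Finsupp.single w 1 then 1 else 0 := by
        funext p; rw [X, if_neg hw]
      rw [this, pdCoeff_const]
      rfl
  · funext m p
    rw [partialL_apply hv, X]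
    have h1 : m + Finsupp.single v 1 ≠ 0 := fun h0 => by
      have := DFunLike.congr_fun h0 v
      simp at this
    have h2 : m + Finsupp.single v 1 ≠ Finsupp.single w 1 := fun h0 => by
      have := DFunLike.congr_fun h0 v
      simp [Ne.symm h] at this
    simp [h1, h2]

lemma pd_inl_X (μ : Fin n) (v : Var n I) : pd (Sum.inl μ) (X gh v) = 0 := by
  classical
  funext m
  rw [pd_apply]
  by_cases hv : v.1.IsOriginal gh
  · by_cases hm : m = 0
    · have : X gh v m = fun p => p (Sum.inr v) := by
        funext p; rw [X, if_pos hv, if_pos hm]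
      rw [this, pdCoeff_coord_ne (by simp)]
      rfl
    · have : X gh v m = 0 := by
        funext p; rw [X, if_pos hv, if_neg hm]; rfl
      rw [this, pdCoeff_zero]
      rfl
  · have : X gh v m = fun _ => if m = Finsupp.single v 1 then 1 else 0 := by
      funext p; rw [X, if_neg hv]
    rw [this, pdCoeff_const]
    rfl

namespace LocPoly

variable {F G : SFun n I}

lemma pd_partialL_comm (hF : F ∈ LocPoly gh n) (c : Coord n I) (v : Var n I) :
    partialL gh v (pd c F) = pd c (partialL gh v F) := by
  by_cases hv : v.1.IsOriginal gh
  · rw [partialL, partialL, if_pos hv, if_pos hv]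
    funext m
    simp only [pd_apply]
    exact (hF.1 m).pdCoeff_comm _ _
  · funext m
    have : partialL gh v F m =
        ((m v + 1) * sgn gh (Finsupp.single v 1) m) • F (m + Finsupp.single v 1) := by
      funext p; rw [partialL_apply hv]; rfl
    rw [pd_apply, this, pdCoeff_smul]
    funext p
    rw [partialL_apply hv]
    rfl

lemma partialL_mul {a : ZMod 2} (hF : F ∈ LocPoly gh n) (hG : G ∈ LocPoly gh n)
    (hp : HasPar gh a F) (v : Var n I) :
    partialL gh v (mul gh F G) = mul gh (partialL gh v F) G
      + sg (v.1.par gh * a) • mul gh F (partialL gh v G) := by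
  by_cases hv : v.1.IsOriginal gh
  · simp only [partialL, if_pos hv]
    rw [pd_mul hF.1 hG.1, Z.par_of_isOriginal hv, zero_mul, sg_zero, one_smul]
  · exact partialL_mul_of_not_isOriginal hv hp hF.2.1 hG.2.1

lemma partialL_partialL (hF : F ∈ LocPoly gh n) (v w : Var n I) :
    partialL gh v (partialL gh w F) =
      sg (v.1.par gh * w.1.par gh) • partialL gh w (partialL gh v F) := by
  by_cases hv : v.1.IsOriginal gh
  · have e : ∀ G : SFun n I, partialL gh v G = pd (Sum.inr v) G := fun G => by
      rw [partialL, if_pos hv]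
    rw [e, e, pd_partialL_comm hF, Z.par_of_isOriginal hv, zero_mul, sg_zero, one_smul]
  by_cases hw : w.1.IsOriginal gh
  · have e : ∀ G : SFun n I, partialL gh w G = pd (Sum.inr w) G := fun G => by
      rw [partialL, if_pos hw]
    rw [e, e, pd_partialL_comm hF, Z.par_of_isOriginal hw, mul_zero, sg_zero, one_smul]
  · exact partialL_partialL_of_not_isOriginal hv hw hF.2.1

/-- A polynomial has finitely many coefficients, each depending on finitely many jets. This can fail
for formal sums, which is why the jet algebra consists of polynomials and formal sums are reached by
truncation. -/
lemma finite_partialL_ne_zero (hF : F ∈ LocPoly gh n) :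
    {v : Var n I | partialL gh v F ≠ 0}.Finite := by
  refine ((hF.2.2.biUnion fun m _ => (hF.1 m).finite_pd).union
    (hF.2.2.biUnion fun m _ => m.support.finite_toSet)).subset fun v hv => ?_
  obtain ⟨m, hm⟩ := Function.ne_iff.1 hv
  by_cases ho : v.1.IsOriginal gh
  · rw [partialL, if_pos ho] at hm
    left
    simp only [Set.mem_iUnion]
    exact ⟨m, fun h => hm (by rw [pd_apply, h, pdCoeff_zero]; rfl), hm⟩
  · right
    simp only [Set.mem_iUnion]
    refine ⟨m + Finsupp.single v 1, fun h => hm ?_, by simp⟩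
    funext p
    rw [partialL_apply ho, h]
    simp

variable (gh n) in
/-- The jet algebra of polynomial local functions. -/
def jet : JetAlgebra n (Z I) (LocPoly gh (I := I) n) where
  par := Z.par gh
  gr a :=
    { carrier := {F | HasWt (Z.par gh) a F.1}
      zero_mem' := HasWt.zero
      add_mem' := fun h h' => HasWt.add h h'
      smul_mem' := fun r _ h => HasWt.smul r h }
  X v := ⟨X gh v, X_mem v⟩
  del v :=
    { toFun := fun F => ⟨partialL gh v F.1, partialL_mem F.2 v⟩
      map_add' := fun F G => Subtype.ext (partialL_add (isLocal F.2) (isLocal G.2) v)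
      map_smul' := fun r F => Subtype.ext (partialL_smul F.1 v r) }
  pdx μ :=
    { toFun := fun F => ⟨pd (Sum.inl μ) F.1, pd_mem F.2 _⟩
      map_add' := fun F G => Subtype.ext (pd_add (isLocal F.2) (isLocal G.2) _)
      map_smul' := fun r F => Subtype.ext (pd_smul F.1 _ r) }
  mul_mem h h' := HasWt.mul h h'
  comm h h' := Subtype.ext (mul_comm' (hasPar_iff.2 h) (hasPar_iff.2 h'))
  X_mem v := HasWt.X (fun _ => Z.par_of_isOriginal) v
  del_mem {a F} v h := by
    have := HasWt.partialL (fun _ => Z.par_of_isOriginal) v h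
    rwa [(by decide : ∀ a b : ZMod 2, a - b = a + b) _ _] at this
  pdx_mem μ h := HasWt.pd _ h
  del_mul {a F} v G h := Subtype.ext (partialL_mul F.2 G.2 (hasPar_iff.2 h) v)
  pdx_mul μ F G := Subtype.ext (pd_mul F.2.1 G.2.1 _)
  del_del v w F := Subtype.ext (partialL_partialL F.2 v w)
  del_pdx v μ F := Subtype.ext (pd_partialL_comm F.2 _ v)
  pdx_pdx μ l F := Subtype.ext (by
    funext m
    exact (F.2.1 m).pdCoeff_comm _ _)
  del_X_self v := Subtype.ext (partialL_X_self v)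
  del_X_ne h := Subtype.ext (partialL_X_ne h)
  pdx_X μ v := Subtype.ext (pd_inl_X μ v)
  finite_del F := (finite_partialL_ne_zero F.2).subset fun v hv h => hv (Subtype.ext h)

end LocPoly

end BV

namespace BV

variable {n : ℕ} {I : Type*} {gh : I → ℕ}

/-! Operations on polynomial local functions in terms of the jet algebra -/

namespace LocPoly

/-- Evaluation of a coefficient. -/
def eval (m : Mon n I) (p : Coord n I → ℝ) : LocPoly gh (I := I) n →+ ℝ where
  toFun F := F.1 m p
  map_zero' := rfl
  map_add' _ _ := rfl

/-- The sum in the algebra has finite support, so evaluation at a monomial and a point passes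
through it and gives the pointwise sum. -/
lemma coe_along (P : Var n I → LocPoly gh (I := I) n) (F : LocPoly gh (I := I) n) :
    ((jet n gh).along P F).1 = along gh (fun v => (P v).1) F.1 := by
  funext m p
  change eval m p _ = _
  rw [JetAlgebra.along_apply, map_finsum _ ((jet n gh).finite_support F (fun v a => P v * a)
    (by simp))]
  rfl

lemma coe_D (μ : Fin n) (F : LocPoly gh (I := I) n) : ((jet n gh).D μ F).1 = D gh μ F.1 := by
  rw [JetAlgebra.D, LinearMap.add_apply, D, Submodule.coe_add, coe_along]
  rfl

lemma coe_D_pow (μ : Fin n) (k : ℕ) (F : LocPoly gh (I := I) n) :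
    (((jet n gh).D μ ^ k) F).1 = (D gh μ)^[k] F.1 := by
  induction k with
  | zero => rfl
  | succ k ih => rw [pow_succ', Module.End.mul_apply, coe_D, ih, Function.iterate_succ_apply']

lemma coe_DD (ν : Fin n → ℕ) (F : LocPoly gh (I := I) n) :
    ((jet n gh).DD ν F).1 = Dmulti gh ν F.1 := by
  unfold JetAlgebra.DD Dmulti
  induction List.finRange n with
  | nil => rfl
  | cons μ l ih =>
    rw [List.map_cons, List.prod_cons, List.foldr_cons, Module.End.mul_apply, coe_D_pow, ih]

lemma coe_euler (z : Z I) (F : LocPoly gh (I := I) n) :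
    ((jet n gh).euler z F).1 = eulerL gh z F.1 := by
  funext m p
  change eval m p _ = _
  rw [JetAlgebra.euler_apply, map_finsum _ (JetAlgebra.finite_support_euler z F)]
  refine finsum_congr fun ν => ?_
  change JetAlgebra.mi ν * ((jet n gh).DD ν _).1 m p = _
  rw [coe_DD]
  rfl

lemma coe_evol (Q : Z I → LocPoly gh (I := I) n) (F : LocPoly gh (I := I) n) :
    ((jet n gh).evol Q F).1 = along gh (fun v => Dmulti gh v.2 (Q v.1).1) F.1 := by
  rw [JetAlgebra.evol, coe_along]
  simp only [coe_DD]

end LocPoly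

lemma Dmulti_smul (ν : Fin n → ℕ) (F : SFun n I) (r : ℝ) :
    Dmulti gh ν (r • F) = r • Dmulti gh ν F := by
  unfold Dmulti
  induction List.finRange n with
  | nil => rfl
  | cons μ l ih =>
    rw [List.foldr_cons, List.foldr_cons, ih]
    induction ν μ with
    | zero => rfl
    | succ k ih' => rw [Function.iterate_succ_apply', Function.iterate_succ_apply', ih', D_smul]

lemma Dmulti_zero (ν : Fin n → ℕ) : Dmulti gh ν (0 : SFun n I) = 0 := by
  simpa using Dmulti_smul (gh := gh) ν (0 : SFun n I) 0

lemma eulerR_eq {a : ZMod 2} {F : SFun n I} (hF : HasPar gh a F)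
    (hF' : ∀ m, F m ≠ 0 → m.Admissible gh) (z : Z I) :
    eulerR gh z F = sg (z.par gh * (a + 1)) • eulerL gh z F := by
  funext m p
  simp only [eulerR, eulerL, Pi.smul_apply, smul_finsum]
  refine finsum_congr fun ν => ?_
  rw [partialR_eq hF hF', Dmulti_smul, Pi.smul_apply, Pi.smul_apply, smul_eq_mul, smul_eq_mul]
  ring

/-! Conjugate variables -/

/-- The field conjugate to an antifield and conversely. -/
def Z.conj : Z I → Z I
  | .field i => .anti i
  | .anti i => .field i

lemma Z.conj_conj (z : Z I) : z.conj.conj = z := by cases z <;> rfl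

lemma Z.par_conj (z : Z I) : z.conj.par gh = z.par gh + 1 := by
  cases z with
  | field i => simp [Z.conj, Z.par, Z.puregh, Z.antifd]
  | anti i =>
    simp only [Z.conj, Z.par, Z.puregh, Z.antifd]
    push_cast
    exact (by decide : ∀ a : ZMod 2, a + 0 = 0 + (a + 1) + 1) _

/-- Variables are fields and antifields. -/
def Z.equivSum : I ⊕ I ≃ Z I where
  toFun x := x.elim .field .anti
  invFun
    | .field i => .inl i
    | .anti i => .inr i
  left_inv x := by cases x <;> rfl
  right_inv z := by cases z <;> rfl

variable (gh n) in
/-- Conjugation of fields and antifields. -/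
def conjugation : JetAlgebra.Conjugation (LocPoly.jet n gh) where
  conj := ⟨Z.conj, Z.conj, Z.conj_conj, Z.conj_conj⟩
  τ
    | .field _ => -1
    | .anti _ => 1
  conj_conj := Z.conj_conj
  par_conj := Z.par_conj
  τ_conj z := by cases z <;> simp [Z.conj]

/-- The sign in `ham` is the one turning right into left Euler derivatives at the conjugate
variable; `τ` is the sign distinguishing fields from antifields in `brstZ`. -/
lemma LocPoly.coe_ham {a : ZMod 2} {F : LocPoly gh (I := I) n} (hF : HasPar gh a F.1) (z : Z I) :
    (JetAlgebra.ham (conjugation n gh) a F z).1 = brstZ gh F.1 z := by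
  have e : ∀ z, ((jet n gh).euler z F).1 = eulerL gh z F.1 := fun z => coe_euler z F
  rw [JetAlgebra.ham]
  change _ • ((jet n gh).euler z.conj F).1 = _
  rw [e]
  change (_ * sg ((z.par gh + 1) * (a + 1))) • _ = _
  rw [← Z.par_conj]
  cases z with
  | field i =>
    rw [brstZ, eulerR_eq hF F.2.2.1, ← neg_smul]
    simp [conjugation, Z.conj]
  | anti i =>
    rw [brstZ, eulerR_eq hF F.2.2.1]
    simp [conjugation, Z.conj]

lemma LocPoly.coe_evol_ham {a : ZMod 2} {F : LocPoly gh (I := I) n} (hF : HasPar gh a F.1)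
    (G : LocPoly gh (I := I) n) :
    ((jet n gh).evol (JetAlgebra.ham (conjugation n gh) a F) G).1 = brst gh F.1 G.1 := by
  rw [coe_evol, brst]
  simp only [coe_ham hF]

section

variable [Fintype I]

instance : Fintype (Z I) := Fintype.ofEquiv _ Z.equivSum

lemma Z.sum_eq {M : Type*} [AddCommMonoid M] (f : Z I → M) :
    ∑ z, f z = ∑ i, (f (.anti i) + f (.field i)) := by
  rw [← Equiv.sum_comp Z.equivSum, Fintype.sum_sum_type, ← Finset.sum_add_distrib]
  exact Finset.sum_congr rfl fun i _ => add_comm _ _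

/-- Puts the two halves of the bracket into one sum over fields and antifields, with the same
characteristic that defines `brst`. -/
lemma bracket_eq (F G : SFun n I) :
    bracket gh F G = ∑ z, mul gh (brstZ gh F z) (eulerL gh z G) := by
  rw [Z.sum_eq, bracket]
  refine Finset.sum_congr rfl fun i _ => ?_
  rw [brstZ, brstZ, ← neg_one_smul ℝ, mul_smul_left, neg_one_smul, sub_eq_add_neg]

lemma LocPoly.coe_antibr {a : ZMod 2} {F : LocPoly gh (I := I) n} (hF : HasPar gh a F.1)
    (G : LocPoly gh (I := I) n) :
    (JetAlgebra.antibr (conjugation n gh) a F G).1 = bracket gh F.1 G.1 := by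
  rw [bracket_eq, JetAlgebra.antibr, Submodule.coe_sum]
  refine Finset.sum_congr rfl fun z _ => ?_
  rw [coe_mul, coe_ham hF, coe_euler]

end

/-! Dependence of the operations on the coefficients -/

section Weight

variable {M : Type*} [AddCommGroup M] {w : Z I → M} {F G : SFun n I}

lemma pd_congr {m : Mon n I} (h : F m = G m) (c : Coord n I) : pd c F m = pd c G m := by
  rw [pd_apply, pd_apply, h]

variable (hw : ∀ z : Z I, z.IsOriginal gh → w z = 0)

include hw

lemma partialL_congr {v : Var n I} {m : Mon n I}
    (h : ∀ a, wt w a = wt w m + w v.1 → F a = G a) : partialL gh v F m = partialL gh v G m := by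
  by_cases hv : v.1.IsOriginal gh
  · rw [partialL, partialL, if_pos hv, if_pos hv]
    exact pd_congr (h m (by rw [hw _ hv, add_zero])) _
  · funext p
    rw [partialL_apply hv, partialL_apply hv, h _ (by rw [map_add, wt_single, one_smul])]

lemma partialR_congr {v : Var n I} {m : Mon n I}
    (h : ∀ a, wt w a = wt w m + w v.1 → F a = G a) : partialR gh v F m = partialR gh v G m := by
  by_cases hv : v.1.IsOriginal gh
  · rw [partialR, partialR, if_pos hv, if_pos hv]
    exact pd_congr (h m (by rw [hw _ hv, add_zero])) _
  · funext p
    rw [partialR, partialR, if_neg hv, if_neg hv]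
    rw [h _ (by rw [map_add, wt_single, one_smul])]

/-- Total derivatives preserve every weight of this kind, so the coefficient at `m` only sees
coefficients of the same weight. This makes truncation compatible with them without loss. -/
lemma D_congr {m : Mon n I} (h : ∀ a, wt w a = wt w m → F a = G a) (μ : Fin n) :
    D gh μ F m = D gh μ G m := by
  classical
  rw [D, D, Pi.add_apply, Pi.add_apply, pd_congr (h m rfl)]
  congr 1
  funext p
  refine finsum_congr fun v => ?_
  rw [mul_apply, mul_apply]
  split_ifs
  · refine Finset.sum_congr rfl fun ab hab => ?_
    rw [Finset.HasAntidiagonal.mem_antidiagonal] at hab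
    by_cases hX : X gh (v.1, v.2 + Pi.single μ 1) ab.1 = 0
    · simp [hX]
    have hX' := HasWt.X hw _ _ hX
    rw [partialL_congr hw fun a ha => h a ?_]
    rw [ha, ← hab, map_add, hX', add_comm]
  · rfl

lemma Dmulti_congr {m : Mon n I} (h : ∀ a, wt w a = wt w m → F a = G a) (ν : Fin n → ℕ) :
    Dmulti gh ν F m = Dmulti gh ν G m := by
  suffices H : ∀ b, wt w b = wt w m → Dmulti gh ν F b = Dmulti gh ν G b from H m rfl
  unfold Dmulti
  induction List.finRange n with
  | nil => exact h
  | cons μ l ih =>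
    rw [List.foldr_cons, List.foldr_cons]
    induction ν μ with
    | zero => exact ih
    | succ k ih' =>
      intro b hb
      rw [Function.iterate_succ_apply', Function.iterate_succ_apply']
      exact D_congr hw (fun a ha => ih' a (ha.trans hb)) μ

lemma eulerL_congr {m : Mon n I} {z : Z I} (h : ∀ a, wt w a = wt w m + w z → F a = G a) :
    eulerL gh z F m = eulerL gh z G m := by
  funext p
  refine finsum_congr fun ν => ?_
  rw [Dmulti_congr hw fun b hb => partialL_congr hw fun a ha => h a (by rw [ha, hb])]

lemma eulerR_congr {m : Mon n I} {z : Z I} (h : ∀ a, wt w a = wt w m + w z → F a = G a) :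
    eulerR gh z F m = eulerR gh z G m := by
  funext p
  refine finsum_congr fun ν => ?_
  rw [Dmulti_congr hw fun b hb => partialR_congr hw fun a ha => h a (by rw [ha, hb])]

end Weight

/-! Truncation -/

variable (gh) in
/-- Pure ghost number and antifield number of a variable. -/
def Z.bideg (z : Z I) : ℤ × ℤ := (z.puregh gh, z.antifd gh)

lemma Z.bideg_of_isOriginal (z : Z I) (h : z.IsOriginal gh) : z.bideg gh = 0 := by
  have h' : z.puregh gh + z.antifd gh = 0 := h
  ext <;> simp [Z.bideg] <;> omega

lemma wt_bideg (m : Mon n I) : wt (Z.bideg gh) m = ((m.puregh gh : ℤ), (m.antifd gh : ℤ)) := by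
  rw [wt_apply, Finsupp.sum, Mon.puregh, Mon.antifd, Finsupp.sum, Finsupp.sum]
  ext
  · simp [Prod.fst_sum, Z.bideg]
  · simp [Prod.snd_sum, Z.bideg]

/-- A bound for the degrees of the variables. -/
def IsBound (gh : I → ℕ) (K : ℕ) : Prop := ∀ i, gh i + 1 ≤ K

lemma exists_isBound [Finite I] (gh : I → ℕ) : ∃ K, IsBound gh K := by
  obtain ⟨K, hK⟩ := (Set.finite_range fun i => gh i + 1).bddAbove
  exact ⟨K, fun i => hK ⟨i, rfl⟩⟩

variable (gh) in
/-- Equality of the components of degree at most `N`. -/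
def EqUpTo (N : ℕ) (F G : SFun n I) : Prop := ∀ m, m.deg gh ≤ N → F m = G m

namespace EqUpTo

variable {N K : ℕ} {F G F' G' : SFun n I}

lemma refl (F : SFun n I) : EqUpTo gh N F F := fun _ _ => rfl

lemma symm (h : EqUpTo gh N F G) : EqUpTo gh N G F := fun m hm => (h m hm).symm

lemma trans {H : SFun n I} (h : EqUpTo gh N F G) (h' : EqUpTo gh N G H) : EqUpTo gh N F H :=
  fun m hm => (h m hm).trans (h' m hm)

lemma mono {N' : ℕ} (h : EqUpTo gh N F G) (hN : N' ≤ N) : EqUpTo gh N' F G :=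
  fun m hm => h m (hm.trans hN)

lemma add (h : EqUpTo gh N F F') (h' : EqUpTo gh N G G') : EqUpTo gh N (F + G) (F' + G') :=
  fun m hm => by rw [Pi.add_apply, Pi.add_apply, h m hm, h' m hm]

lemma sub (h : EqUpTo gh N F F') (h' : EqUpTo gh N G G') : EqUpTo gh N (F - G) (F' - G') :=
  fun m hm => by rw [Pi.sub_apply, Pi.sub_apply, h m hm, h' m hm]

lemma neg (h : EqUpTo gh N F F') : EqUpTo gh N (-F) (-F') :=
  fun m hm => by rw [Pi.neg_apply, Pi.neg_apply, h m hm]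

lemma smul (r : ℝ) (h : EqUpTo gh N F F') : EqUpTo gh N (r • F) (r • F') :=
  fun m hm => by rw [Pi.smul_apply, Pi.smul_apply, h m hm]

lemma sum {ι : Type*} {s : Finset ι} {F G : ι → SFun n I} (h : ∀ i ∈ s, EqUpTo gh N (F i) (G i)) :
    EqUpTo gh N (∑ i ∈ s, F i) (∑ i ∈ s, G i) := fun m hm => by
  rw [Finset.sum_apply, Finset.sum_apply]
  exact Finset.sum_congr rfl fun i hi => h i hi m hm

lemma finsum {ι : Sort*} {F G : ι → SFun n I} (h : ∀ i, EqUpTo gh N (F i) (G i)) :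
    EqUpTo gh N (fun m p => ∑ᶠ i, F i m p) fun m p => ∑ᶠ i, G i m p := fun m hm => by
  funext p
  exact finsum_congr fun i => congrFun (h i m hm) p

lemma mul (h : EqUpTo gh N F F') (h' : EqUpTo gh N G G') :
    EqUpTo gh N (mul gh F G) (mul gh F' G') := fun m hm => by
  classical
  funext p
  rw [mul_apply, mul_apply]
  split_ifs
  · refine Finset.sum_congr rfl fun ab hab => ?_
    rw [Finset.HasAntidiagonal.mem_antidiagonal] at hab
    rw [← hab, Mon.deg_add] at hm
    rw [h _ (by omega), h' _ (by omega)]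
  · rfl

lemma deg_of_bideg {a b : Mon n I} (h : wt (Z.bideg gh) a = wt (Z.bideg gh) b) :
    a.puregh gh = b.puregh gh ∧ a.antifd gh = b.antifd gh ∧ a.deg gh = b.deg gh := by
  rw [wt_bideg, wt_bideg, Prod.mk.injEq, Nat.cast_inj, Nat.cast_inj] at h
  exact ⟨h.1, h.2, by rw [Mon.deg, Mon.deg, h.1, h.2]⟩

/-- One derivative with respect to a variable looks at monomials of degree at most `K` higher; this
is the price paid by every field or bracket in a truncation. -/
lemma deg_of_bideg_add (hK : IsBound gh K) {a b : Mon n I} {z : Z I}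
    (h : wt (Z.bideg gh) a = wt (Z.bideg gh) b + z.bideg gh) : a.deg gh ≤ b.deg gh + K := by
  rw [wt_bideg, wt_bideg, Z.bideg, Prod.mk_add_mk, Prod.mk.injEq] at h
  have hz : z.puregh gh + z.antifd gh ≤ K := by
    cases z with
    | field i => have := hK i; simp only [Z.puregh, Z.antifd]; omega
    | anti i => have := hK i; simp only [Z.puregh, Z.antifd]; omega
  rw [Mon.deg, Mon.deg]
  omega

lemma D (h : EqUpTo gh N F G) (μ : Fin n) : EqUpTo gh N (D gh μ F) (D gh μ G) := fun m hm =>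
  D_congr Z.bideg_of_isOriginal (fun a ha => h a (by rwa [(deg_of_bideg ha).2.2])) μ

lemma Dmulti (h : EqUpTo gh N F G) (ν : Fin n → ℕ) :
    EqUpTo gh N (Dmulti gh ν F) (Dmulti gh ν G) := fun m hm =>
  Dmulti_congr Z.bideg_of_isOriginal (fun a ha => h a (by rwa [(deg_of_bideg ha).2.2])) ν

variable (hK : IsBound gh K)

include hK

lemma partialL (h : EqUpTo gh (N + K) F G) (v : Var n I) :
    EqUpTo gh N (partialL gh v F) (partialL gh v G) := fun m hm =>
  partialL_congr Z.bideg_of_isOriginal fun a ha =>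
    h a ((deg_of_bideg_add hK ha).trans (by omega))

lemma eulerL (h : EqUpTo gh (N + K) F G) (z : Z I) :
    EqUpTo gh N (eulerL gh z F) (eulerL gh z G) := fun m hm =>
  eulerL_congr Z.bideg_of_isOriginal fun a ha =>
    h a ((deg_of_bideg_add hK ha).trans (by omega))

lemma eulerR (h : EqUpTo gh (N + K) F G) (z : Z I) :
    EqUpTo gh N (eulerR gh z F) (eulerR gh z G) := fun m hm =>
  eulerR_congr Z.bideg_of_isOriginal fun a ha =>
    h a ((deg_of_bideg_add hK ha).trans (by omega))

lemma brstZ (h : EqUpTo gh (N + K) F G) (z : Z I) :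
    EqUpTo gh N (brstZ gh F z) (brstZ gh G z) := by
  cases z with
  | field i => exact (h.eulerR hK _).neg
  | anti i => exact h.eulerR hK _

lemma brst (h : EqUpTo gh (N + K) F F') (h' : EqUpTo gh (N + K) G G') :
    EqUpTo gh N (brst gh F G) (brst gh F' G') :=
  finsum fun v => ((h.brstZ hK v.1).Dmulti v.2).mul (h'.partialL hK v)

lemma bracket [Fintype I] (h : EqUpTo gh (N + K) F F') (h' : EqUpTo gh (N + K) G G') :
    EqUpTo gh N (bracket gh F G) (bracket gh F' G') := by
  rw [bracket_eq, bracket_eq]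
  exact sum fun z _ => (h.brstZ hK z).mul (h'.eulerL hK z)

end EqUpTo

lemma eq_of_forall_eqUpTo {F G : SFun n I} (h : ∀ N, EqUpTo gh N F G) : F = G :=
  funext fun m => h _ m le_rfl

variable (gh) in
/-- The components of degree at most `N`. -/
def trunc (N : ℕ) (F : SFun n I) : SFun n I := fun m => if m.deg gh ≤ N then F m else 0

lemma eqUpTo_trunc {N K : ℕ} (h : N ≤ K) (F : SFun n I) : EqUpTo gh N F (trunc gh K F) :=
  fun m hm => by rw [trunc, if_pos (hm.trans h)]

lemma HasWt.trunc {M : Type*} [AddCommGroup M] {w : Z I → M} {c : M} {F : SFun n I}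
    (hF : HasWt w c F) (N : ℕ) : HasWt w c (trunc gh N F) := fun m h =>
  hF m fun h' => h (by rw [BV.trunc, h', ite_self])

lemma IsLocal.trunc_mem {F : SFun n I} (hF : IsLocal gh F) (N : ℕ) :
    trunc gh N F ∈ LocPoly gh n := by
  have h0 : ∀ m, trunc gh N F m ≠ 0 → m.deg gh ≤ N ∧ F m ≠ 0 := fun m h => by
    rw [trunc] at h
    split_ifs at h with hm
    · exact ⟨hm, h⟩
    · exact absurd rfl h
  refine ⟨fun m => ?_, fun m h => hF.admissible m (h0 m h).2, ?_⟩
  · rw [trunc]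
    split_ifs
    · exact hF.coeff m
    · exact IsLocalCoeff.zero
  · refine (Set.Finite.biUnion (Set.finite_Iic N) fun a _ =>
      Set.Finite.biUnion (Set.finite_Iic N) fun b _ => hF.finite a b).subset fun m h => ?_
    have h1 := (h0 m h).1
    rw [Mon.deg] at h1
    simp only [Set.mem_iUnion, Set.mem_Iic]
    exact ⟨m.puregh gh, by omega, m.antifd gh, by omega, (h0 m h).2, rfl, rfl⟩

/-- Finiteness is only required in each bidegree `(a, b)`, where the polynomial approximation of
degree `a + b` already agrees with `F`. -/
lemma isLocal_of_eqUpTo {F : SFun n I} (h : ∀ N, ∃ G ∈ LocPoly gh n, EqUpTo gh N F G) :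
    IsLocal gh F where
  coeff m := by
    obtain ⟨G, hG, e⟩ := h (m.deg gh)
    rw [e m le_rfl]
    exact hG.1 m
  admissible m hm := by
    obtain ⟨G, hG, e⟩ := h (m.deg gh)
    rw [e m le_rfl] at hm
    exact hG.2.1 m hm
  finite a b := by
    obtain ⟨G, hG, e⟩ := h (a + b)
    refine hG.2.2.subset fun m hm => ?_
    have := hm.1
    rwa [e m (by rw [Mon.deg, hm.2.1, hm.2.2])] at this

end BV

namespace BV

variable {n : ℕ} {I : Type*} {gh : I → ℕ} {f h k F G : SFun n I} {g g' : ℤ} {a b : ZMod 2}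

/-! Ghost numbers -/

lemma HasGhost.add (hF : HasGhost gh g F) (hG : HasGhost gh g G) : HasGhost gh g (F + G) :=
  hasGhost_iff.2 ((hasGhost_iff.1 hF).add (hasGhost_iff.1 hG))

lemma HasGhost.smul (r : ℝ) (hF : HasGhost gh g F) : HasGhost gh g (r • F) :=
  hasGhost_iff.2 ((hasGhost_iff.1 hF).smul r)

lemma HasGhost.sum {ι : Type*} {s : Finset ι} {F : ι → SFun n I}
    (h : ∀ i ∈ s, HasGhost gh g (F i)) : HasGhost gh g (∑ i ∈ s, F i) :=
  hasGhost_iff.2 (HasWt.sum fun i hi => hasGhost_iff.1 (h i hi))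

lemma HasGhost.D (μ : Fin n) (hF : HasGhost gh g F) : HasGhost gh g (D gh μ F) :=
  hasGhost_iff.2 ((hasGhost_iff.1 hF).D (fun _ => Z.ghost_of_isOriginal) μ)

lemma HasGhost.brstZ (hf : HasGhost gh g f) (z : Z I) :
    HasWt (Z.ghost gh) (z.ghost gh + (g + 1)) (brstZ gh f z) := by
  have h := fun z => (hasGhost_iff.1 hf).eulerR (gh := gh) (fun _ => Z.ghost_of_isOriginal) z
  cases z with
  | field i =>
    have h1 := (h (.anti i)).neg
    rwa [show g - Z.ghost gh (.anti i) = Z.ghost gh (.field i) + (g + 1) by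
      simp [Z.ghost, Z.puregh, Z.antifd]; ring] at h1
  | anti i =>
    have h1 := h (.field i)
    rwa [show g - Z.ghost gh (.field i) = Z.ghost gh (.anti i) + (g + 1) by
      simp [Z.ghost, Z.puregh, Z.antifd]; ring] at h1

lemma HasGhost.brst (hf : HasGhost gh g f) (hF : HasGhost gh g' F) :
    HasGhost gh (g' + (g + 1)) (brst gh f F) :=
  hasGhost_iff.2 <| HasWt.along (fun _ => Z.ghost_of_isOriginal)
    (fun v => (hf.brstZ v.1).Dmulti (fun _ => Z.ghost_of_isOriginal) v.2) (hasGhost_iff.1 hF)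

lemma HasGhost.bracket [Fintype I] (hf : HasGhost gh g f) (hF : HasGhost gh g' F) :
    HasGhost gh (g' + (g + 1)) (bracket gh f F) := by
  rw [bracket_eq, hasGhost_iff]
  refine HasWt.sum fun z _ => ?_
  have := (hf.brstZ z).mul (gh := gh)
    ((hasGhost_iff.1 hF).eulerL (fun _ => Z.ghost_of_isOriginal) z)
  rwa [show z.ghost gh + (g + 1) + (g' - z.ghost gh) = g' + (g + 1) by ring] at this

/-! Extension of the identities to formal sums -/

/-- Truncation of a local function to a polynomial one. -/
def IsLocal.poly (hF : IsLocal gh F) (N : ℕ) : LocPoly gh (I := I) n :=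
  ⟨trunc gh N F, hF.trunc_mem N⟩

lemma IsLocal.eqUpTo_poly (hF : IsLocal gh F) (N : ℕ) : EqUpTo gh N F (hF.poly N).1 :=
  eqUpTo_trunc le_rfl F

lemma HasPar.poly (hF : IsLocal gh F) (hp : HasPar gh a F) (N : ℕ) :
    HasPar gh a (hF.poly N).1 := hasPar_iff.2 ((hasPar_iff.1 hp).trunc N)

lemma LocPoly.mem_gr {F : LocPoly gh (I := I) n} (h : HasPar gh a F.1) :
    F ∈ (LocPoly.jet n gh).gr a := hasPar_iff.1 h

lemma LocPoly.hasPar_of_mem_gr {F : LocPoly gh (I := I) n} (h : F ∈ (LocPoly.jet n gh).gr a) :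
    HasPar gh a F.1 := hasPar_iff.2 h

lemma IsLocal.D (hF : IsLocal gh F) (μ : Fin n) : IsLocal gh (D gh μ F) := by
  refine isLocal_of_eqUpTo fun N => ⟨_, ((LocPoly.jet n gh).D μ (hF.poly N)).2, ?_⟩
  rw [LocPoly.coe_D]
  exact (hF.eqUpTo_poly N).D μ

lemma IsLocal.sum {ι : Type*} {s : Finset ι} {F : ι → SFun n I}
    (h : ∀ i ∈ s, IsLocal gh (F i)) : IsLocal gh (∑ i ∈ s, F i) := by
  classical
  induction s using Finset.induction_on with
  | empty => simpa using IsLocal.zero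
  | insert i s hi ih =>
    rw [Finset.sum_insert hi]
    exact (h i (by simp)).add (ih fun j hj => h j (by simp [hj]))

variable [Fintype I]

lemma IsLocal.brst (hf : IsLocal gh f) (hp : HasPar gh a f) (hF : IsLocal gh F) :
    IsLocal gh (brst gh f F) := by
  obtain ⟨K, hK⟩ := exists_isBound gh
  refine isLocal_of_eqUpTo fun N => ⟨_, ((LocPoly.jet n gh).evol
    (JetAlgebra.ham (conjugation n gh) a (hf.poly (N + K))) (hF.poly (N + K))).2, ?_⟩
  rw [LocPoly.coe_evol_ham (hp.poly hf _)]
  exact (hf.eqUpTo_poly _).brst hK (hF.eqUpTo_poly _)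

lemma IsLocal.bracket (hf : IsLocal gh f) (hp : HasPar gh a f) (hF : IsLocal gh F) :
    IsLocal gh (bracket gh f F) := by
  obtain ⟨K, hK⟩ := exists_isBound gh
  refine isLocal_of_eqUpTo fun N => ⟨_, (JetAlgebra.antibr (conjugation n gh) a
    (hf.poly (N + K)) (hF.poly (N + K))).2, ?_⟩
  rw [LocPoly.coe_antibr (hp.poly hf _)]
  exact (hf.eqUpTo_poly _).bracket hK (hF.eqUpTo_poly _)

/-- Hamiltonian vector fields commute with total derivatives. -/
lemma brst_D (hf : IsLocal gh f) (hp : HasPar gh a f) (hF : IsLocal gh F) (μ : Fin n) :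
    brst gh f (D gh μ F) = D gh μ (brst gh f F) := by
  -- To compare components of degree at most `N`, the arguments are truncated at `N + K`, where the
  -- identity holds in the jet algebra.
  obtain ⟨K, hK⟩ := exists_isBound gh
  refine eq_of_forall_eqUpTo (gh := gh) fun N => ?_
  have ef := hf.eqUpTo_poly (N + K)
  have eF := hF.eqUpTo_poly (N + K)
  have hp' := hp.poly hf (N + K)
  have key := congrArg Subtype.val (JetAlgebra.evol_D _
    (JetAlgebra.isChar_ham (conjugation n gh) (LocPoly.mem_gr hp')) μ (hF.poly (N + K)))
  rw [LocPoly.coe_evol_ham hp', LocPoly.coe_D, LocPoly.coe_D, LocPoly.coe_evol_ham hp'] at key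
  refine (ef.brst hK (eF.D μ)).trans (EqUpTo.trans ?_ ((ef.brst hK eF).D μ).symm)
  rw [key]
  exact EqUpTo.refl _

lemma brst_add (f : SFun n I) (hF : IsLocal gh F) (hG : IsLocal gh G) :
    brst gh f (F + G) = brst gh f F + brst gh f G := along_add _ hF hG

omit [Fintype I] in
lemma brst_smul (f F : SFun n I) (r : ℝ) : brst gh f (r • F) = r • brst gh f F :=
  along_smul _ _ _

omit [Fintype I] in
lemma brst_zero (f : SFun n I) : brst gh f 0 = 0 := by
  simpa using brst_smul (gh := gh) f 0 0

lemma brst_sum (f : SFun n I) {ι : Type*} {s : Finset ι} {F : ι → SFun n I}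
    (hF : ∀ i ∈ s, IsLocal gh (F i)) :
    brst gh f (∑ i ∈ s, F i) = ∑ i ∈ s, brst gh f (F i) := by
  classical
  induction s using Finset.induction_on with
  | empty => simpa using brst_zero f
  | insert i s hi ih =>
    rw [Finset.sum_insert hi, Finset.sum_insert hi, brst_add f (hF i (by simp))
      (IsLocal.sum fun j hj => hF j (by simp [hj])), ih fun j hj => hF j (by simp [hj])]

/-- `f ↦ (f, ·)` is a homomorphism to vector fields. -/
theorem brst_commutator (hf : IsLocal gh f) (hfp : HasPar gh a f) (hh : IsLocal gh h)
    (hhp : HasPar gh b h) (hF : IsLocal gh F) :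
    brst gh f (brst gh h F) - sg ((a + 1) * (b + 1)) • brst gh h (brst gh f F) =
      brst gh (bracket gh f h) F := by
  obtain ⟨K, hK⟩ := exists_isBound gh
  refine eq_of_forall_eqUpTo (gh := gh) fun N => ?_
  -- Two nested operations each lose `K` degrees, so the truncation is at `N + 2K`.
  have ef := hf.eqUpTo_poly (N + K + K)
  have eh := hh.eqUpTo_poly (N + K + K)
  have eF := hF.eqUpTo_poly (N + K + K)
  have hfp' := hfp.poly hf (N + K + K)
  have hhp' := hhp.poly hh (N + K + K)
  have gf := LocPoly.mem_gr hfp'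
  have gH := LocPoly.mem_gr hhp'
  have gb := LocPoly.hasPar_of_mem_gr (JetAlgebra.antibr_mem (conjugation n gh) gf gH)
  have key := congrArg Subtype.val (JetAlgebra.evol_ham_commutator (conjugation n gh) gf gH
    (hF.poly (N + K + K)))
  rw [LocPoly.coe_evol_ham gb, LocPoly.coe_antibr hfp', Submodule.coe_sub, Submodule.coe_smul,
    LocPoly.coe_evol_ham hfp', LocPoly.coe_evol_ham hhp', LocPoly.coe_evol_ham hhp',
    LocPoly.coe_evol_ham hfp'] at key
  have le : N + K ≤ N + K + K := by omega
  refine (((ef.mono le).brst hK (eh.brst hK eF)).sub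
    (((eh.mono le).brst hK (ef.brst hK eF)).smul _)).trans (EqUpTo.trans ?_
    ((ef.bracket hK eh).brst hK (eF.mono le)).symm)
  rw [key]
  exact EqUpTo.refl _

lemma bracket_symm (hf : IsLocal gh f) (hfp : HasPar gh a f) (hh : IsLocal gh h)
    (hhp : HasPar gh b h) :
    bracket gh f h = -(sg ((a + 1) * (b + 1)) • bracket gh h f) := by
  obtain ⟨K, hK⟩ := exists_isBound gh
  refine eq_of_forall_eqUpTo (gh := gh) fun N => ?_
  have ef := hf.eqUpTo_poly (N + K)
  have eh := hh.eqUpTo_poly (N + K)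
  have hfp' := hfp.poly hf (N + K)
  have hhp' := hhp.poly hh (N + K)
  have key := congrArg Subtype.val (JetAlgebra.antibr_symm (conjugation n gh)
    (LocPoly.mem_gr hfp') (LocPoly.mem_gr hhp'))
  rw [LocPoly.coe_antibr hfp', Submodule.coe_neg, Submodule.coe_smul,
    LocPoly.coe_antibr hhp'] at key
  refine (ef.bracket hK eh).trans (EqUpTo.trans ?_ ((eh.bracket hK ef).smul _).neg.symm)
  rw [key]
  exact EqUpTo.refl _

/-! Total divergences -/

variable (gh) in
/-- Total divergences of local functions of ghost number `g`. -/
def IsDiv (g : ℤ) (F : SFun n I) : Prop :=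
  ∃ k : Fin n → SFun n I, (∀ μ, IsLocal gh (k μ) ∧ HasGhost gh g (k μ)) ∧
    F = ∑ μ, D gh μ (k μ)

lemma IsDiv.add (hF : IsDiv gh g F) (hG : IsDiv gh g G) : IsDiv gh g (F + G) := by
  obtain ⟨k, hk, rfl⟩ := hF
  obtain ⟨l, hl, rfl⟩ := hG
  refine ⟨k + l, fun μ => ⟨(hk μ).1.add (hl μ).1, (hk μ).2.add (hl μ).2⟩, ?_⟩
  rw [← Finset.sum_add_distrib]
  exact Finset.sum_congr rfl fun μ _ => (D_add μ (hk μ).1 (hl μ).1).symm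

omit [Fintype I] in
lemma IsDiv.smul (r : ℝ) (hF : IsDiv gh g F) : IsDiv gh g (r • F) := by
  obtain ⟨k, hk, rfl⟩ := hF
  refine ⟨fun μ => r • k μ, fun μ => ⟨(hk μ).1.smul r, (hk μ).2.smul r⟩, ?_⟩
  rw [Finset.smul_sum]
  exact Finset.sum_congr rfl fun μ _ => (D_smul μ _ r).symm

omit [Fintype I] in
lemma IsDiv.neg (hF : IsDiv gh g F) : IsDiv gh g (-F) := by
  simpa using hF.smul (-1)

lemma IsDiv.sub (hF : IsDiv gh g F) (hG : IsDiv gh g G) : IsDiv gh g (F - G) := by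
  rw [sub_eq_add_neg]
  exact hF.add hG.neg

omit [Fintype I] in
lemma IsDiv.isLocal (hF : IsDiv gh g F) : IsLocal gh F := by
  obtain ⟨k, hk, rfl⟩ := hF
  exact IsLocal.sum fun μ _ => (hk μ).1.D μ

omit [Fintype I] in
lemma IsDiv.zero : IsDiv gh g (0 : SFun n I) :=
  ⟨0, fun _ => ⟨IsLocal.zero, fun _ h => absurd rfl h⟩, by
    rw [Finset.sum_eq_zero fun μ _ => ?_]
    simpa using D_smul (gh := gh) μ 0 0⟩

omit [Fintype I] in
/-- Divergences can be recognized degree by degree. -/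
lemma isDiv_of_eqUpTo (hF : HasGhost gh g F)
    (h : ∀ N, ∃ k : Fin n → SFun n I, (∀ μ, k μ ∈ LocPoly gh n) ∧
      EqUpTo gh N F (∑ μ, D gh μ (k μ))) : IsDiv gh g F := by
  classical
  choose k hk e using h
  -- The currents obtained for different `N` need not be compatible. They are glued by taking the
  -- coefficient at `m` from the current for `N = deg m`; this works because the total derivative
  -- preserves the bidegree. Components of ghost number other than `g` are dropped.
  let l : Fin n → SFun n I := fun μ m =>
    if (m.puregh gh : ℤ) - m.antifd gh = g then k (m.deg gh) μ m else 0
  have hl0 : ∀ μ m, l μ m ≠ 0 →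
      (m.puregh gh : ℤ) - m.antifd gh = g ∧ k (m.deg gh) μ m ≠ 0 := fun μ m h => by
    simp only [l] at h
    split_ifs at h with h1
    · exact ⟨h1, h⟩
    · exact absurd rfl h
  refine ⟨l, fun μ => ⟨⟨fun m => ?_, fun m h => ?_, fun a b => ?_⟩, fun m h => (hl0 μ m h).1⟩, ?_⟩
  · simp only [l]
    split_ifs
    · exact (hk _ μ).1 m
    · exact IsLocalCoeff.zero
  · exact (hk _ μ).2.1 m (hl0 μ m h).2
  · refine (hk (a + b) μ).2.2.subset fun m hm => ?_
    have := (hl0 μ m hm.1).2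
    rwa [Mon.deg, hm.2.1, hm.2.2] at this
  · funext m
    rw [Finset.sum_apply]
    by_cases hm : (m.puregh gh : ℤ) - m.antifd gh = g
    · rw [e (m.deg gh) m le_rfl, Finset.sum_apply]
      refine Finset.sum_congr rfl fun μ _ => D_congr Z.bideg_of_isOriginal (fun c hc => ?_) μ
      obtain ⟨h1, h2, h3⟩ := EqUpTo.deg_of_bideg hc
      simp only [l]
      rw [h1, h2, h3, if_pos hm]
    · have h0 : F m = 0 := by_contra fun h => hm (hF m h)
      rw [h0]
      refine (Finset.sum_eq_zero fun μ _ => ?_).symm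
      have : D gh μ (l μ) m = D gh μ 0 m := by
        refine D_congr Z.bideg_of_isOriginal (fun c hc => ?_) μ
        obtain ⟨h1, h2, h3⟩ := EqUpTo.deg_of_bideg hc
        simp only [l]
        rw [h1, h2, if_neg hm, Pi.zero_apply]
      rw [this, show D gh μ (0 : SFun n I) = 0 by simpa using D_smul (gh := gh) μ 0 0]
      rfl

omit [Fintype I] in
/-- Forgetting the ghost numbers of the currents. -/
lemma isDiv_of_eq_sum (hF : HasGhost gh g F) {k : Fin n → SFun n I} (hk : ∀ μ, IsLocal gh (k μ))
    (e : F = ∑ μ, D gh μ (k μ)) : IsDiv gh g F := by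
  refine isDiv_of_eqUpTo hF fun N => ⟨fun μ => trunc gh N (k μ), fun μ => (hk μ).trunc_mem N, ?_⟩
  rw [e]
  exact EqUpTo.sum fun μ _ => (eqUpTo_trunc le_rfl _).D μ

lemma eulerL_of_isDiv (hF : IsDiv gh g F) (z : Z I) : eulerL gh z F = 0 := by
  obtain ⟨k, hk, rfl⟩ := hF
  obtain ⟨K, hK⟩ := exists_isBound gh
  refine eq_of_forall_eqUpTo (gh := gh) fun N => ?_
  have e : EqUpTo gh (N + K) (∑ μ, D gh μ (k μ))
      (∑ μ, (LocPoly.jet n gh).D μ ((hk μ).1.poly (N + K)) : LocPoly gh n).1 := by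
    rw [Submodule.coe_sum]
    refine EqUpTo.sum fun μ _ => ?_
    rw [LocPoly.coe_D]
    exact ((hk μ).1.eqUpTo_poly _).D μ
  refine (e.eulerL hK z).trans ?_
  rw [← LocPoly.coe_euler, JetAlgebra.euler_of_mem_divergences z
    (sum_mem fun μ _ => JetAlgebra.D_mem_divergences μ _)]
  exact EqUpTo.refl _

lemma brstZ_of_isDiv (hF : IsDiv gh g F) (hp : HasPar gh a F) (z : Z I) : brstZ gh F z = 0 := by
  have h : ∀ z, eulerR gh z F = 0 := fun z => by
    rw [eulerR_eq hp hF.isLocal.admissible, eulerL_of_isDiv hF, smul_zero]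
  cases z with
  | field i => rw [brstZ, h, neg_zero]
  | anti i => rw [brstZ, h]

/-- The characteristic consists of Euler derivatives, which vanish on divergences, so the field
depends only on the functional. -/
lemma brst_of_isDiv_left (hF : IsDiv gh g F) (hp : HasPar gh a F) (G : SFun n I) :
    brst gh F G = 0 := by
  rw [brst]
  simp only [brstZ_of_isDiv hF hp, Dmulti_zero]
  funext m p
  simp [along, mul_zero_left]

lemma bracket_of_isDiv_right (F : SFun n I) (hG : IsDiv gh g G) : bracket gh F G = 0 := by
  rw [bracket_eq]
  simp [eulerL_of_isDiv hG, mul_zero_right]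

lemma IsDiv.brst (hf : IsLocal gh f) (hfg : HasGhost gh g f) (hF : IsDiv gh g' F) :
    IsDiv gh (g' + (g + 1)) (brst gh f F) := by
  obtain ⟨k, hk, rfl⟩ := hF
  refine ⟨fun μ => BV.brst gh f (k μ), fun μ => ⟨hf.brst hfg.hasPar (hk μ).1,
    hfg.brst (hk μ).2⟩, ?_⟩
  rw [brst_sum f fun μ _ => (hk μ).1.D μ]
  exact Finset.sum_congr rfl fun μ _ => brst_D hf hfg.hasPar (hk μ).1 μ

/-- The antibracket is the Hamiltonian vector field up to a divergence. -/
lemma isDiv_brst_sub_bracket (hf : IsLocal gh f) (hfg : HasGhost gh g f) (hF : IsLocal gh F)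
    (hFg : HasGhost gh g' F) :
    IsDiv gh (g' + (g + 1)) (brst gh f F - bracket gh f F) := by
  obtain ⟨K, hK⟩ := exists_isBound gh
  refine isDiv_of_eqUpTo ?_ fun N => ?_
  · rw [sub_eq_add_neg, ← neg_one_smul ℝ]
    exact (hfg.brst hFg).add ((hfg.bracket hFg).smul _)
  · have hp := hfg.hasPar.poly hf (N + K)
    have ef := hf.eqUpTo_poly (N + K)
    have eF := hF.eqUpTo_poly (N + K)
    obtain ⟨k, hk⟩ := JetAlgebra.mem_divergences.1 (JetAlgebra.evol_ham_sub_mem (conjugation n gh)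
      (LocPoly.mem_gr hp) (hF.poly (N + K)))
    refine ⟨fun μ => (k μ).1, fun μ => (k μ).2, ?_⟩
    have := congrArg Subtype.val hk
    rw [Submodule.coe_sub, LocPoly.coe_evol_ham hp, LocPoly.coe_antibr hp,
      Submodule.coe_sum] at this
    simp only [LocPoly.coe_D] at this
    rw [← this]
    exact (ef.brst hK eF).sub (ef.bracket hK eF)

end BV

namespace BV

variable {n : ℕ} {I : Type*} [Fintype I] {gh : I → ℕ} {L F G : SFun n I} {g : ℤ} {a : ZMod 2}

/-! Cohomology of the BRST differential in negative ghost number -/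

namespace IsMasterAction

variable (hL : IsMasterAction gh L)

include hL

lemma isLocal_brst (hF : IsLocal gh F) : IsLocal gh (brst gh L F) :=
  hL.isLocal.brst hL.ghost.hasPar hF

lemma hasGhost_brst (hF : HasGhost gh g F) : HasGhost gh (g + 1) (brst gh L F) := by
  simpa using hL.ghost.brst hF

/-- As `L` is even, the graded commutator of `s` with itself is `2 s²`. It is the field of `(L, L)`,
which is zero because `(L, L)` is a divergence. -/
lemma brst_brst (hF : IsLocal gh F) : brst gh L (brst gh L F) = 0 := by
  have hp := hL.ghost.hasPar
  have h1 := brst_commutator hL.isLocal hp hL.isLocal hp hF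
  obtain ⟨k, hk, e⟩ := hL.master
  have hg := hL.ghost.bracket hL.ghost
  rw [brst_of_isDiv_left (isDiv_of_eq_sum hg hk e) hg.hasPar] at h1
  simp only [Int.cast_zero, zero_add, mul_one, sg_one, neg_smul, one_smul, sub_neg_eq_add] at h1
  rw [← two_smul ℝ] at h1
  exact (smul_eq_zero.1 h1).resolve_left two_ne_zero

omit [Fintype I] hL in
/-- The BRST differential lowers the antifield number by at most one. -/
lemma brst_congr_antifd (hg : HasGhost gh 0 L) {m : Mon n I}
    (h : ∀ c : Mon n I, c.antifd gh ≤ m.antifd gh + 1 → F c = G c) :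
    brst gh L F m = brst gh L G m := by
  classical
  funext p
  refine finsum_congr fun v => ?_
  rw [mul_apply, mul_apply]
  split_ifs
  · refine Finset.sum_congr rfl fun ab hab => ?_
    rw [Finset.HasAntidiagonal.mem_antidiagonal] at hab
    by_cases hQ : Dmulti gh v.2 (brstZ gh L v.1) ab.1 = 0
    · simp [hQ]
    have h1 := hasGhost_iff.2 ((hg.brstZ v.1).Dmulti (gh := gh)
      (fun _ => Z.ghost_of_isOriginal) v.2) ab.1 hQ
    -- The coefficient of `∂/∂Φ*_i` is a derivative of `sΦ*_i`, of ghost number `-gh i`; each of its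
    -- monomials therefore has antifield number at least `gh i`, one less than that of `Φ*_i`.
    have h2 : v.1.antifd gh ≤ ab.1.antifd gh + 1 := by
      rcases v with ⟨i | i, ν⟩
      · simp [Z.antifd]
      · simp only [Z.ghost, Z.puregh, Z.antifd] at h1 ⊢
        push_cast at h1
        omega
    rw [partialL_congr Z.bideg_of_isOriginal fun c hc => h c ?_]
    rw [wt_bideg, wt_bideg, Z.bideg, Prod.mk_add_mk, Prod.mk.injEq] at hc
    rw [← hab, Mon.antifd_add]
    omega
  · rfl

/-- The lowest component of `R`, in antifield number `k + 1`, is closed under the Koszul–Tate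
differential, hence exact by properness. Subtracting `s G` with `G` in antifield number `k + 2`
removes it and creates nothing lower, since `s` lowers the antifield number by at most one. -/
lemma exists_step {k : ℕ} {R : SFun n I} (h : IsLocal gh R ∧ HasGhost gh g R ∧ brst gh L R = 0 ∧
      ∀ m : Mon n I, m.antifd gh ≤ k → R m = 0) :
    ∃ G : SFun n I, (IsLocal gh G ∧ HasGhost gh (g - 1) G ∧ HasAntifd gh (k + 2) G) ∧
      IsLocal gh (R - brst gh L G) ∧ HasGhost gh g (R - brst gh L G) ∧
      brst gh L (R - brst gh L G) = 0 ∧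
      ∀ m : Mon n I, m.antifd gh ≤ k + 1 → (R - brst gh L G) m = 0 := by
  classical
  obtain ⟨hR, hg, hc, h0⟩ := h
  have hr0 : ∀ m, antifdPart gh (k + 1) R m ≠ 0 → m.antifd gh = k + 1 ∧ R m ≠ 0 := fun m hm => by
    rw [antifdPart] at hm
    split_ifs at hm with h1
    · exact ⟨h1, hm⟩
    · exact absurd rfl hm
  have hr : IsLocal gh (antifdPart gh (k + 1) R) := by
    refine ⟨fun m => ?_, fun m hm => hR.admissible m (hr0 m hm).2, fun a b =>
      (hR.finite a b).subset fun m hm => ⟨(hr0 m hm.1).2, hm.2⟩⟩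
    rw [antifdPart]
    split_ifs
    · exact hR.coeff m
    · exact IsLocalCoeff.zero
  have hclosed : antifdPart gh k (brst gh L (antifdPart gh (k + 1) R)) = 0 := by
    funext m
    rw [antifdPart]
    split_ifs with hm
    -- In antifield number `k`, `s R` sees only the components of `R` up to `k + 1`, where `R`
    -- coincides with its lowest part.
    · rw [brst_congr_antifd hL.ghost (G := R) fun c hc => ?_, hc]
      rw [antifdPart]
      split_ifs with h1
      · rfl
      · exact (h0 c (by omega)).symm
    · rfl
  obtain ⟨G, hG, hGg, hGa, e⟩ := hL.proper k g _ hr (fun m hm => hg m (hr0 m hm).2)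
    (fun m hm => (hr0 m hm).1) hclosed
  have hbg : HasGhost gh g (brst gh L G) := by simpa using hL.hasGhost_brst hGg
  refine ⟨G, ⟨hG, hGg, hGa⟩, ?_, ?_, ?_, ?_⟩
  · rw [sub_eq_add_neg, ← neg_one_smul ℝ]
    exact hR.add ((hL.isLocal_brst hG).smul _)
  · rw [sub_eq_add_neg, ← neg_one_smul ℝ]
    exact hg.add (hbg.smul _)
  · rw [sub_eq_add_neg, ← neg_one_smul ℝ, brst_add L hR ((hL.isLocal_brst hG).smul _),
      brst_smul, hL.brst_brst hG, hc, smul_zero, add_zero]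
  · intro m hm
    rw [Pi.sub_apply]
    rcases hm.lt_or_eq with hlt | heq
    · rw [h0 m (by omega), brst_congr_antifd hL.ghost (G := 0) fun c hc => ?_, brst_zero]
      · simp
      · by_contra hne
        have := hGa c hne
        omega
    · have := congrFun e m
      rw [antifdPart, antifdPart, if_pos heq, if_pos heq] at this
      rw [this, sub_self]

/-- The BRST differential is acyclic on local functions of negative ghost number. -/
theorem exists_brst_eq (hg : g < 0) (hF : IsLocal gh F) (hFg : HasGhost gh g F)
    (hc : brst gh L F = 0) : ∃ G, IsLocal gh G ∧ HasGhost gh (g - 1) G ∧ brst gh L G = F := by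
  classical
  choose! Γ hΓ using fun (k : ℕ) (R : SFun n I) => hL.exists_step (g := g) (k := k) (R := R)
  let R : ℕ → SFun n I := fun k => Nat.rec F (fun k R => R - brst gh L (Γ k R)) k
  have hR : ∀ k, IsLocal gh (R k) ∧ HasGhost gh g (R k) ∧ brst gh L (R k) = 0 ∧
      ∀ m : Mon n I, m.antifd gh ≤ k → R k m = 0 := by
    intro k
    induction k with
    | zero =>
      -- The induction starts because negative ghost number forces positive antifield number.
      refine ⟨hF, hFg, hc, fun m hm => ?_⟩
      by_contra h
      have := hFg m h
      omega
    | succ k ih => exact (hΓ k (R k) ih).2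
  set G : ℕ → SFun n I := fun k => Γ k (R k) with hGdef
  have hG : ∀ k, IsLocal gh (G k) ∧ HasGhost gh (g - 1) (G k) ∧ HasAntifd gh (k + 2) (G k) :=
    fun k => (hΓ k (R k) (hR k)).1
  have hsum : ∀ k, F = R k + brst gh L (∑ j ∈ Finset.range k, G j) := by
    intro k
    induction k with
    | zero => simp [brst_zero, R]
    | succ k ih =>
      rw [Finset.sum_range_succ, brst_add L (IsLocal.sum fun j _ => (hG j).1) (hG k).1]
      change F = (R k - brst gh L (G k)) + _
      rw [sub_add_add_cancel]
      exact ih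
  have hG0 : ∀ j m, Mon.antifd gh m ≠ j + 2 → G j m = 0 := fun j m hm => by
    by_contra h
    exact hm ((hG j).2.2 m h)
  -- This is the formal sum of all `G k`: only `G k` lives in antifield number `k + 2`. Below
  -- antifield number two the truncated subtraction selects `G 0`, which is zero there.
  refine ⟨fun m => G (m.antifd gh - 2) m, ⟨fun m => (hG _).1.coeff m,
    fun m h => (hG _).1.admissible m h, fun a b => ?_⟩, fun m h => (hG _).2.1 m h, ?_⟩
  · refine ((hG (b - 2)).1.finite a b).subset fun m hm => ⟨?_, hm.2⟩
    have := hm.1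
    rwa [hm.2.2] at this
  · funext m
    rw [hsum (m.antifd gh), Pi.add_apply, (hR _).2.2.2 m le_rfl, zero_add]
    refine brst_congr_antifd hL.ghost fun c hc => ?_
    rw [Finset.sum_apply]
    -- At `m`, only components with `c.antifd ≤ m.antifd + 1` matter, so the index `c.antifd - 2`
    -- lies in the partial sum of length `m.antifd`; the remainder at that stage vanishes at `m`.
    rcases lt_or_ge (c.antifd gh) 2 with hlt | hge
    · rw [hG0 _ c (by omega), Finset.sum_eq_zero fun j _ => hG0 j c (by omega)]
    · rw [Finset.sum_eq_single (c.antifd gh - 2) (fun j _ hj => hG0 j c (by omega))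
        fun hn => absurd (Finset.mem_range.2 (by omega)) hn]

end IsMasterAction

end BV

namespace BV

variable {n : ℕ} {I : Type*} [Fintype I] {gh : I → ℕ} {L f h f' h' F G : SFun n I} {g g' : ℤ}

/-! Local BRST cohomology of densities -/

/-- The top form with density `F`. -/
def topForm (F : SFun n I) : Form n I := fun S => if S = Finset.univ then F else 0

omit [Fintype I] in
lemma topForm_univ (F : SFun n I) : topForm F Finset.univ = F := if_pos rfl

variable (gh L) in
/-- Densities of cocycles modulo `d`. -/
def IsCocycle (g : ℤ) (f : SFun n I) : Prop :=
  IsLocal gh f ∧ HasGhost gh g f ∧ IsDiv gh (g + 1) (brst gh L f)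

variable (gh L) in
/-- Densities of coboundaries modulo `d`. -/
def IsCoboundary (g : ℤ) (f : SFun n I) : Prop :=
  ∃ b, IsLocal gh b ∧ HasGhost gh (g - 1) b ∧ IsDiv gh g (f - brst gh L b)

omit [Fintype I] in
lemma brst_eq_zero_of_s {α : Form n I} {S : Finset (Fin n)} (h : s gh L α S = 0) :
    brst gh L (α S) = 0 :=
  (smul_eq_zero.1 h).resolve_left (pow_ne_zero _ (by norm_num))

omit [Fintype I] in
lemma neg_one_pow_smul_smul (k : ℕ) (F : SFun n I) : (-1 : ℝ) ^ k • (-1 : ℝ) ^ k • F = F := by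
  rw [smul_smul, ← pow_add, Even.neg_one_pow ⟨k, rfl⟩, one_smul]

omit [Fintype I] in
lemma IsForm.eq_topForm {α : Form n I} (hα : IsForm gh g n α) :
    α = topForm (α Finset.univ) := by
  funext S
  rw [topForm]
  split_ifs with hS
  · rw [hS]
  · refine hα.degree S fun hc => hS ?_
    rw [← Finset.card_eq_iff_eq_univ, Fintype.card_fin]
    exact_mod_cast hc

omit [Fintype I] in
lemma isForm_topForm (hF : IsLocal gh F) (hg : HasGhost gh g F) : IsForm gh g n (topForm F) where
  isLocal S := by
    rw [topForm]
    split_ifs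
    exacts [hF, IsLocal.zero]
  ghost S := by
    rw [topForm]
    split_ifs
    exacts [hg, fun _ h => absurd rfl h]
  degree S hS := by
    rw [topForm, if_neg]
    rintro rfl
    simp at hS

omit [Fintype I] in
lemma s_topForm (L F : SFun n I) : s gh L (topForm F) = topForm ((-1 : ℝ) ^ n • brst gh L F) := by
  funext S
  rw [s, topForm, topForm]
  split_ifs with hS
  · rw [hS, Finset.card_univ, Fintype.card_fin]
  · rw [brst_zero, smul_zero]

/-- The sign in front of `∂_μ` in the horizontal differential of a form of degree `n - 1`. -/
def dSign (μ : Fin n) : ℝ := (-1) ^ ((Finset.univ : Finset (Fin n)).filter (· < μ)).card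

lemma dSign_mul_self (μ : Fin n) : dSign μ * dSign μ = 1 := by
  rw [dSign, ← pow_add]
  exact Even.neg_one_pow ⟨_, rfl⟩

omit [Fintype I] in
lemma d_eq_topForm {η : Form n I} (hη : IsForm gh g (n - 1) η) :
    d gh η = topForm (∑ μ, D gh μ (dSign μ • η (Finset.univ.erase μ))) := by
  funext T
  rw [topForm]
  split_ifs with hT
  · subst hT
    rw [d]
    refine Finset.sum_congr rfl fun μ _ => ?_
    rw [D_smul, dSign]
  · refine Finset.sum_eq_zero fun μ hμ => ?_
    rw [hη.degree (T.erase μ) fun hc => hT ?_]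
    · rw [show D gh μ (0 : SFun n I) = 0 by simpa using D_smul (gh := gh) μ 0 0, smul_zero]
    · rw [Finset.card_erase_of_mem hμ, Nat.cast_sub (Finset.card_pos.2 ⟨μ, hμ⟩)] at hc
      rw [← Finset.card_eq_iff_eq_univ, Fintype.card_fin]
      push_cast at hc
      omega

/-- The form of degree `n - 1` of a current. -/
def currentForm (k : Fin n → SFun n I) : Form n I := fun S =>
  ∑ μ, if S = Finset.univ.erase μ then dSign μ • k μ else 0

omit [Fintype I] in
lemma currentForm_erase (k : Fin n → SFun n I) (μ : Fin n) :
    currentForm k (Finset.univ.erase μ) = dSign μ • k μ := by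
  rw [currentForm, Finset.sum_eq_single μ, if_pos rfl]
  · intro l _ hl
    rw [if_neg]
    intro h
    have := h.symm ▸ Finset.notMem_erase μ (Finset.univ : Finset (Fin n))
    simp [Ne.symm hl] at this
  · simp

omit [Fintype I] in
lemma isForm_currentForm {k : Fin n → SFun n I} (hk : ∀ μ, IsLocal gh (k μ) ∧ HasGhost gh g (k μ)) :
    IsForm gh g (n - 1) (currentForm k) where
  isLocal S := IsLocal.sum fun μ _ => by
    split_ifs
    exacts [(hk μ).1.smul _, IsLocal.zero]
  ghost S := HasGhost.sum fun μ _ => by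
    split_ifs
    exacts [(hk μ).2.smul _, fun _ h => absurd rfl h]
  degree S hS := Finset.sum_eq_zero fun μ _ => by
    rw [if_neg]
    rintro rfl
    have := μ.pos
    rw [Finset.card_erase_of_mem (Finset.mem_univ _), Finset.card_univ, Fintype.card_fin] at hS
    omega

omit [Fintype I] in
lemma d_currentForm {k : Fin n → SFun n I} (hk : ∀ μ, IsLocal gh (k μ) ∧ HasGhost gh g (k μ)) :
    d gh (currentForm k) = topForm (∑ μ, D gh μ (k μ)) := by
  rw [d_eq_topForm (isForm_currentForm hk)]
  simp only [currentForm_erase, smul_smul, dSign_mul_self, one_smul]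

omit [Fintype I] in
lemma isDiv_d {η : Form n I} (hη : IsForm gh g (n - 1) η) : IsDiv gh g (d gh η Finset.univ) := by
  rw [d_eq_topForm hη, topForm_univ]
  exact ⟨_, fun μ => ⟨(hη.isLocal _).smul _, (hη.ghost _).smul _⟩, rfl⟩

omit [Fintype I] in
lemma IsDiv.exists_form (hF : IsDiv gh g F) :
    ∃ η, IsForm gh g (n - 1) η ∧ d gh η = topForm F := by
  obtain ⟨k, hk, rfl⟩ := hF
  exact ⟨currentForm k, isForm_currentForm hk, d_currentForm hk⟩

omit [Fintype I] in
lemma topForm_add (F G : SFun n I) : topForm (F + G) = topForm F + topForm G := by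
  funext S
  rw [Pi.add_apply, topForm, topForm, topForm]
  split_ifs <;> simp

omit [Fintype I] in
lemma topForm_smul (r : ℝ) (F : SFun n I) : topForm (r • F) = r • topForm F := by
  funext S
  rw [Pi.smul_apply, topForm, topForm]
  split_ifs <;> simp

/-- Reduces the cohomology in top degree to densities modulo divergences. The sign `(-1)^n` from
moving `s` past `dⁿx` is absorbed in the current. -/
lemma topForm_mem_cocycles : topForm f ∈ cocycles gh L g n ↔ IsCocycle gh L g f := by
  constructor
  · rintro ⟨hf, η, hη, e⟩
    have h1 := hf.isLocal Finset.univ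
    have h2 := hf.ghost Finset.univ
    rw [topForm_univ] at h1 h2
    refine ⟨h1, h2, ?_⟩
    have e' := congrFun e Finset.univ
    rw [s_topForm, Pi.add_apply, topForm_univ, Pi.zero_apply] at e'
    have := ((isDiv_d hη).neg).smul ((-1) ^ n)
    rwa [← eq_neg_of_add_eq_zero_left e', neg_one_pow_smul_smul] at this
  · rintro ⟨h1, h2, h3⟩
    obtain ⟨η, hη, e⟩ := (h3.smul ((-1) ^ n)).neg.exists_form
    refine ⟨isForm_topForm h1 h2, η, hη, ?_⟩
    rw [s_topForm, e, ← topForm_add, add_neg_cancel]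
    funext S
    rw [topForm, ite_self, Pi.zero_apply]

lemma topForm_mem_coboundaries : topForm f ∈ coboundaries gh L g n ↔ IsCoboundary gh L g f := by
  constructor
  · rintro ⟨β, η, hβ, hη, e⟩
    refine ⟨(-1 : ℝ) ^ n • β Finset.univ, (hβ.isLocal _).smul _, (hβ.ghost _).smul _, ?_⟩
    have e' := congrFun e Finset.univ
    rw [topForm_univ, Pi.add_apply, s, Finset.card_univ, Fintype.card_fin, ← brst_smul] at e'
    rw [e', add_sub_cancel_left]
    exact isDiv_d hη
  · rintro ⟨b, hb, hbg, hd⟩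
    obtain ⟨η, hη, e⟩ := hd.exists_form
    refine ⟨topForm ((-1 : ℝ) ^ n • b), η, isForm_topForm (hb.smul _) (hbg.smul _), hη, ?_⟩
    rw [e, s_topForm, brst_smul, neg_one_pow_smul_smul, ← topForm_add, add_sub_cancel]

lemma eq_topForm_of_mem_cocycles (α : cocycles gh L g n) :
    (α : Form n I) = topForm ((α : Form n I) Finset.univ) := α.2.1.eq_topForm

lemma isCocycle_of_mem (α : cocycles gh L g n) :
    IsCocycle gh L g ((α : Form n I) Finset.univ) :=
  topForm_mem_cocycles.1 (eq_topForm_of_mem_cocycles α ▸ α.2)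

variable (gh L) in
/-- The class of a density. -/
def densityClass (hf : IsCocycle gh L g f) : H gh L g n :=
  cls gh L ⟨topForm f, topForm_mem_cocycles.2 hf⟩

lemma cls_eq_densityClass (α : cocycles gh L g n) :
    cls gh L α = densityClass gh L (isCocycle_of_mem α) :=
  congrArg _ (Subtype.ext (eq_topForm_of_mem_cocycles α))

lemma exists_densityClass_eq (x : H gh L g n) :
    ∃ f, ∃ hf : IsCocycle gh L g f, densityClass gh L hf = x := by
  obtain ⟨α, rfl⟩ := Submodule.Quotient.mk_surjective _ x
  exact ⟨_, _, (cls_eq_densityClass α).symm⟩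

lemma densityClass_eq_iff {hf : IsCocycle gh L g f} {hf' : IsCocycle gh L g f'} :
    densityClass gh L hf = densityClass gh L hf' ↔ IsCoboundary gh L g (f - f') := by
  rw [densityClass, densityClass, cls, cls, Submodule.Quotient.eq, Submodule.submoduleOf, Submodule.mem_comap,
    ← topForm_mem_coboundaries, sub_eq_add_neg f, ← neg_one_smul ℝ f', topForm_add, topForm_smul,
    neg_one_smul, ← sub_eq_add_neg]
  rfl

lemma densityClass_eq_zero_iff {hf : IsCocycle gh L g f} :
    densityClass gh L hf = 0 ↔ IsCoboundary gh L g f := by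
  rw [densityClass, cls, Submodule.Quotient.mk_eq_zero, Submodule.submoduleOf,
    Submodule.mem_comap, ← topForm_mem_coboundaries]
  rfl

lemma densityClass_add (hf : IsCocycle gh L g f) (hf' : IsCocycle gh L g f')
    (hF : IsCocycle gh L g F) (e : F = f + f') :
    densityClass gh L hF = densityClass gh L hf + densityClass gh L hf' :=
  congrArg (cls gh L) (Subtype.ext (e ▸ topForm_add f f'))

lemma densityClass_smul (r : ℝ) (hf : IsCocycle gh L g f) (hF : IsCocycle gh L g F)
    (e : F = r • f) : densityClass gh L hF = r • densityClass gh L hf :=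
  congrArg (cls gh L) (Subtype.ext (e ▸ topForm_smul r f))

omit [Fintype I] in
lemma IsDiv.isCoboundary (hf : IsDiv gh g f) : IsCoboundary gh L g f :=
  ⟨0, IsLocal.zero, fun _ h => absurd rfl h, by rwa [brst_zero, sub_zero]⟩

omit [Fintype I] in
lemma IsCoboundary.smul (r : ℝ) (hf : IsCoboundary gh L g f) : IsCoboundary gh L g (r • f) := by
  obtain ⟨b, h1, h2, h3⟩ := hf
  refine ⟨r • b, h1.smul r, h2.smul r, ?_⟩
  rw [brst_smul, ← smul_sub]
  exact h3.smul r

/-! The antibracket on cohomology -/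

lemma antibracket_eq (α η : Form n I) :
    antibracket gh α η = topForm (bracket gh (α Finset.univ) (η Finset.univ)) := by
  funext S
  rw [antibracket, topForm]

/-- Euler derivatives are infinite sums over multi-indices, whose additivity is available for
polynomials; truncation transfers it. -/
lemma bracket_add_right (f : SFun n I) {a : ZMod 2} (hf : IsLocal gh f) (hp : HasPar gh a f)
    (hF : IsLocal gh F) (hG : IsLocal gh G) :
    bracket gh f (F + G) = bracket gh f F + bracket gh f G := by
  obtain ⟨K, hK⟩ := exists_isBound gh
  refine eq_of_forall_eqUpTo (gh := gh) fun N => ?_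
  have ef := hf.eqUpTo_poly (N + K)
  have eF := hF.eqUpTo_poly (N + K)
  have eG := hG.eqUpTo_poly (N + K)
  refine (ef.bracket hK (eF.add eG)).trans (EqUpTo.trans ?_
    ((ef.bracket hK eF).add (ef.bracket hK eG)).symm)
  rw [← Submodule.coe_add, ← LocPoly.coe_antibr (hp.poly hf _), ← LocPoly.coe_antibr (hp.poly hf _),
    ← LocPoly.coe_antibr (hp.poly hf _), ← Submodule.coe_add, JetAlgebra.antibr,
    JetAlgebra.antibr, JetAlgebra.antibr, ← Finset.sum_add_distrib]
  simp only [map_add, mul_add]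
  exact EqUpTo.refl _

omit [Fintype I] in
lemma eulerL_smul (z : Z I) (r : ℝ) (F : SFun n I) :
    eulerL gh z (r • F) = r • eulerL gh z F := by
  funext m p
  simp only [eulerL, Pi.smul_apply, smul_finsum]
  refine finsum_congr fun ν => ?_
  rw [partialL_smul, Dmulti_smul, Pi.smul_apply, Pi.smul_apply, smul_eq_mul, smul_eq_mul]
  ring

lemma bracket_smul_right (f F : SFun n I) (r : ℝ) :
    bracket gh f (r • F) = r • bracket gh f F := by
  rw [bracket_eq, bracket_eq, Finset.smul_sum]
  exact Finset.sum_congr rfl fun z _ => by rw [eulerL_smul, mul_smul_right]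

lemma bracket_add_left (hf : IsLocal gh f) (hfg : HasGhost gh g f) (hf' : IsLocal gh f')
    (hfg' : HasGhost gh g f') (hF : IsLocal gh F) (hFg : HasGhost gh g' F) :
    bracket gh (f + f') F = bracket gh f F + bracket gh f' F := by
  rw [bracket_symm (hf.add hf') (hfg.add hfg').hasPar hF hFg.hasPar,
    bracket_symm hf hfg.hasPar hF hFg.hasPar, bracket_symm hf' hfg'.hasPar hF hFg.hasPar,
    bracket_add_right F hF hFg.hasPar hf hf', smul_add, neg_add]

lemma bracket_smul_left (r : ℝ) (hf : IsLocal gh f) (hfg : HasGhost gh g f)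
    (hF : IsLocal gh F) (hFg : HasGhost gh g' F) :
    bracket gh (r • f) F = r • bracket gh f F := by
  rw [bracket_symm (hf.smul r) (hfg.smul r).hasPar hF hFg.hasPar,
    bracket_symm hf hfg.hasPar hF hFg.hasPar, bracket_smul_right, smul_comm, smul_neg]

/-- Bilinear maps descend to quotients. -/
lemma exists_liftQ₂ {M N P : Type*} [AddCommGroup M] [AddCommGroup N] [AddCommGroup P]
    [Module ℝ M] [Module ℝ N] [Module ℝ P] {p : Submodule ℝ M} {q : Submodule ℝ N}
    (C : M →ₗ[ℝ] N →ₗ[ℝ] P) (hp : ∀ X Y, X ∈ p → C X Y = 0) (hq : ∀ X Y, Y ∈ q → C X Y = 0) :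
    ∃ B : M ⧸ p →ₗ[ℝ] N ⧸ q →ₗ[ℝ] P,
      ∀ X Y, B (Submodule.Quotient.mk X) (Submodule.Quotient.mk Y) = C X Y :=
  ⟨p.liftQ (q.liftQ C.flip fun Y hY => LinearMap.ext fun X => hq X Y hY).flip fun X hX =>
    LinearMap.ext fun Y => by
      obtain ⟨Y, rfl⟩ := Submodule.Quotient.mk_surjective q Y
      exact hp X Y hX, fun _ _ => rfl⟩

namespace IsMasterAction

variable (hL : IsMasterAction gh L)

include hL

/-- Cocycles generate vector fields that commute with the BRST differential. -/
lemma brst_brst_comm (hf : IsCocycle gh L g f) (hF : IsLocal gh F) :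
    brst gh L (brst gh f F) = sg ((g : ZMod 2) + 1) • brst gh f (brst gh L F) := by
  obtain ⟨h1, h2, h3⟩ := hf
  have hc := brst_commutator hL.isLocal hL.ghost.hasPar h1 h2.hasPar hF
  -- Both `s f` and `s f - (L, f)` are divergences, hence so is `(L, f)`, and its vector field, the
  -- commutator of `s` with the field of `f`, is zero.
  have hd := isDiv_brst_sub_bracket hL.isLocal hL.ghost h1 h2
  rw [zero_add] at hd
  have hd' := h3.sub hd
  rw [sub_sub_cancel] at hd'
  rw [brst_of_isDiv_left hd' (hL.ghost.bracket h2).hasPar, sub_eq_zero] at hc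
  simpa using hc

lemma isDiv_brst_brst (hf : IsCocycle gh L g f) (hh : IsCocycle gh L g' h) :
    IsDiv gh (g' + (g + 1) + 1) (brst gh L (brst gh f h)) := by
  rw [hL.brst_brst_comm hf hh.1]
  have := (hh.2.2.brst hf.1 hf.2.1).smul (sg ((g : ZMod 2) + 1))
  rwa [add_right_comm] at this

lemma isCocycle_brst (hf : IsCocycle gh L g f) (hh : IsCocycle gh L g' h) :
    IsCocycle gh L (g' + (g + 1)) (brst gh f h) :=
  ⟨hf.1.brst hf.2.1.hasPar hh.1, hf.2.1.brst hh.2.1, hL.isDiv_brst_brst hf hh⟩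

lemma isCocycle_of_isDiv (hF : IsDiv gh g F) : IsCocycle gh L g F := by
  refine ⟨hF.isLocal, ?_, ?_⟩
  · obtain ⟨k, hk, rfl⟩ := hF
    exact HasGhost.sum fun μ _ => (hk μ).2.D μ
  · simpa using hF.brst hL.isLocal hL.ghost

/-- Modulo divergences the bracket is the field of `f` applied to `h`, and that field commutes with
total derivatives and, up to sign, with `s`. -/
lemma isCocycle_bracket (hf : IsCocycle gh L g f) (hh : IsCocycle gh L g' h) :
    IsCocycle gh L (g' + (g + 1)) (bracket gh f h) := by
  have hd := isDiv_brst_sub_bracket hf.1 hf.2.1 hh.1 hh.2.1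
  have hc := hL.isCocycle_brst hf hh
  refine ⟨hf.1.bracket hf.2.1.hasPar hh.1, hf.2.1.bracket hh.2.1, ?_⟩
  have := hc.2.2.sub (hL.isCocycle_of_isDiv hd).2.2
  rw [sub_eq_add_neg, sub_eq_add_neg, ← neg_one_smul ℝ, ← neg_one_smul ℝ (bracket gh f h),
    brst_add L hc.1 ((hf.1.bracket hf.2.1.hasPar hh.1).smul _), brst_smul] at this
  simpa using this

/-- The divergence in `h` does not contribute to the bracket, and the field of `f` carries `s b` to
`± s` of its value on `b`. -/
lemma isCoboundary_brst (hf : IsCocycle gh L g f) (hh : IsCoboundary gh L g' h) :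
    IsCoboundary gh L (g' + (g + 1)) (bracket gh f h) := by
  obtain ⟨b, h1, h2, h3⟩ := hh
  have hb := hL.isLocal_brst h1
  have hbg : HasGhost gh g' (brst gh L b) := by simpa using hL.hasGhost_brst h2
  have e : bracket gh f h = bracket gh f (brst gh L b) := by
    have := bracket_add_right f hf.1 hf.2.1.hasPar h3.isLocal hb
    rwa [sub_add_cancel, bracket_of_isDiv_right f h3, zero_add] at this
  have hd := isDiv_brst_sub_bracket hf.1 hf.2.1 hb hbg
  refine ⟨sg ((g : ZMod 2) + 1) • brst gh f b, (hf.1.brst hf.2.1.hasPar h1).smul _, ?_, ?_⟩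
  · have := (hf.2.1.brst h2).smul (sg ((g : ZMod 2) + 1))
    rwa [show g' - 1 + (g + 1) = g' + (g + 1) - 1 by ring] at this
  · rw [brst_smul, hL.brst_brst_comm hf h1, smul_smul, sg_mul_self, one_smul, e, ← neg_sub]
    exact hd.neg

lemma isCoboundary_bracket_left (hf : IsCoboundary gh L g f) (hf' : IsCocycle gh L g f)
    (hh : IsCocycle gh L g' h) : IsCoboundary gh L (g' + (g + 1)) (bracket gh f h) := by
  rw [bracket_symm hf'.1 hf'.2.1.hasPar hh.1 hh.2.1.hasPar, ← neg_smul,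
    show g' + (g + 1) = g + (g' + 1) by ring]
  exact (hL.isCoboundary_brst hh hf).smul _

/-- The antibracket map in local BRST cohomology. -/
lemma exists_bracketMap (g g' : ℤ) {g'' : ℤ} (hg : g'' = g' + (g + 1)) :
    ∃ B : H gh L g n →ₗ[ℝ] H gh L g' n →ₗ[ℝ] H gh L g'' n,
      ∀ {f h : SFun n I} (hf : IsCocycle gh L g f) (hh : IsCocycle gh L g' h)
        (hb : IsCocycle gh L g'' (bracket gh f h)),
        B (densityClass gh L hf) (densityClass gh L hh) = densityClass gh L hb := by
  -- Keeping the target ghost number as a separate variable lets the map later be stated with values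
  -- in ghost number `g` instead of `g + (-1 + 1)`.
  subst hg
  let C : cocycles gh L g n →ₗ[ℝ] cocycles gh L g' n →ₗ[ℝ] H gh L (g' + (g + 1)) n :=
    LinearMap.mk₂ ℝ
      (fun X Y => densityClass gh L (hL.isCocycle_bracket (isCocycle_of_mem X)
        (isCocycle_of_mem Y)))
      (fun X X' Y => densityClass_add _ _ _ <|
        bracket_add_left (isCocycle_of_mem X).1 (isCocycle_of_mem X).2.1
          (isCocycle_of_mem X').1 (isCocycle_of_mem X').2.1 (isCocycle_of_mem Y).1
          (isCocycle_of_mem Y).2.1)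
      (fun r X Y => densityClass_smul _ _ _ <|
        bracket_smul_left r (isCocycle_of_mem X).1 (isCocycle_of_mem X).2.1
          (isCocycle_of_mem Y).1 (isCocycle_of_mem Y).2.1)
      (fun X Y Y' => densityClass_add _ _ _ <|
        bracket_add_right _ (isCocycle_of_mem X).1 (isCocycle_of_mem X).2.1.hasPar
          (isCocycle_of_mem Y).1 (isCocycle_of_mem Y').1)
      (fun r X Y => densityClass_smul _ _ _ <|
        bracket_smul_right _ _ r)
  have cob : ∀ {g : ℤ} (Y : cocycles gh L g n),
      Y ∈ (coboundaries gh L g n).submoduleOf (cocycles gh L g n) →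
      IsCoboundary gh L g ((Y : Form n I) Finset.univ) := fun Y hY => by
    change (Y : Form n I) ∈ coboundaries gh L _ n at hY
    rw [eq_topForm_of_mem_cocycles Y] at hY
    exact topForm_mem_coboundaries.1 hY
  have hC : ∀ X Y, Y ∈ (coboundaries gh L g' n).submoduleOf (cocycles gh L g' n) →
      C X Y = 0 := fun X Y hY =>
    (densityClass_eq_zero_iff (hf := hL.isCocycle_bracket (isCocycle_of_mem X)
      (isCocycle_of_mem Y))).2 (hL.isCoboundary_brst (isCocycle_of_mem X) (cob Y hY))
  have hC' : ∀ X Y, X ∈ (coboundaries gh L g n).submoduleOf (cocycles gh L g n) →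
      C X Y = 0 := fun X Y hX =>
    (densityClass_eq_zero_iff (hf := hL.isCocycle_bracket (isCocycle_of_mem X)
      (isCocycle_of_mem Y))).2 (hL.isCoboundary_bracket_left (cob X hX) (isCocycle_of_mem X)
      (isCocycle_of_mem Y))
  obtain ⟨B, hB⟩ := exists_liftQ₂ C hC' hC
  refine ⟨B, fun {f h} hf hh hb => (hB _ _).trans ?_⟩
  have e : ∀ {F} (hF : IsCocycle gh L (g' + (g + 1)) F), F = bracket gh f h →
      densityClass gh L hF = densityClass gh L hb := fun hF e => by subst e; rfl
  refine e (hL.isCocycle_bracket (isCocycle_of_mem _) (isCocycle_of_mem _)) ?_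
  change bracket gh (topForm f Finset.univ) (topForm h Finset.univ) = _
  rw [topForm_univ, topForm_univ]

end IsMasterAction

end BV

namespace BV

variable {n : ℕ} {I : Type*} [Fintype I] {gh : I → ℕ} {L f h f' h' F G : SFun n I} {g : ℤ}

lemma IsCocycle.add (hf : IsCocycle gh L g f) (hf' : IsCocycle gh L g f') :
    IsCocycle gh L g (f + f') := by
  refine ⟨hf.1.add hf'.1, hf.2.1.add hf'.2.1, ?_⟩
  rw [brst_add L hf.1 hf'.1]
  exact hf.2.2.add hf'.2.2

omit [Fintype I] in
lemma IsCocycle.smul (r : ℝ) (hf : IsCocycle gh L g f) : IsCocycle gh L g (r • f) := by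
  refine ⟨hf.1.smul r, hf.2.1.smul r, ?_⟩
  rw [brst_smul]
  exact hf.2.2.smul r

lemma densityClass_eq_add {hF : IsCocycle gh L g F} {hf : IsCocycle gh L g f}
    {hf' : IsCocycle gh L g f'} (h : IsDiv gh g (F - (f + f'))) :
    densityClass gh L hF = densityClass gh L hf + densityClass gh L hf' := by
  rw [← densityClass_add hf hf' (hf.add hf') rfl, densityClass_eq_iff]
  exact h.isCoboundary

/-! Ghost number `-1` -/

/-- Each bracket may be traded for a vector field at the cost of a divergence; the inner divergence
then disappears inside the outer bracket. -/
lemma isDiv_bracket_bracket_sub (hf : IsLocal gh f) (hfg : HasGhost gh (-1) f)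
    (hh : IsLocal gh h) (hhg : HasGhost gh (-1) h) (hF : IsLocal gh F) (hFg : HasGhost gh g F) :
    IsDiv gh g (bracket gh f (bracket gh h F) - brst gh f (brst gh h F)) := by
  have h1 := isDiv_brst_sub_bracket hh hhg hF hFg
  have h2 := isDiv_brst_sub_bracket hf hfg (hh.brst hhg.hasPar hF) (hhg.brst hFg)
  have h3 := bracket_add_right f hf hfg.hasPar h1.isLocal (hh.bracket hhg.hasPar hF)
  rw [sub_add_cancel, bracket_of_isDiv_right f h1, zero_add] at h3
  rw [h3, neg_add_cancel, add_zero, add_zero] at h2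
  simpa using h2.neg

/-- The Jacobi identity up to a divergence. -/
lemma isDiv_jacobi (hf : IsLocal gh f) (hfg : HasGhost gh (-1) f)
    (hh : IsLocal gh h) (hhg : HasGhost gh (-1) h) (hF : IsLocal gh F) (hFg : HasGhost gh g F) :
    IsDiv gh g (bracket gh f (bracket gh h F) -
      (bracket gh (bracket gh f h) F + bracket gh h (bracket gh f F))) := by
  have h1 := isDiv_bracket_bracket_sub hf hfg hh hhg hF hFg
  have h2 := isDiv_bracket_bracket_sub hh hhg hf hfg hF hFg
  have h3 := isDiv_brst_sub_bracket (hf.bracket hfg.hasPar hh) (hfg.bracket hhg) hF hFg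
  -- In ghost number `-1` the shifted parity is zero, so the graded commutator is an ordinary one.
  have h4 := brst_commutator hf hfg.hasPar hh hhg.hasPar hF
  rw [← h4] at h3
  simp only [Int.cast_neg, Int.cast_one, neg_add_cancel, mul_zero, sg_zero, one_smul, add_zero]
    at h3
  have := (h1.sub h2).add h3
  convert this using 1
  abel

namespace IsMasterAction

variable (hL : IsMasterAction gh L)

include hL

lemma isCocycle_bracket_neg_one (hf : IsCocycle gh L (-1) f) (hF : IsCocycle gh L g F) :
    IsCocycle gh L g (bracket gh f F) := by
  simpa using hL.isCocycle_bracket hf hF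

lemma isCocycle_brst_neg_one (hf : IsCocycle gh L (-1) f) (hF : IsCocycle gh L g F) :
    IsCocycle gh L g (brst gh f F) := by
  simpa using hL.isCocycle_brst hf hF

end IsMasterAction

end BV

namespace BV

variable {n : ℕ} {I : Type*} [Fintype I] {gh : I → ℕ} {L f h f' h' F G : SFun n I} {g : ℤ}

/-! Covariantizable classes -/

variable (gh L) in
/-- Currents for a density that are BRST closed. -/
def HasClosedCurrent (f : SFun n I) : Prop :=
  ∃ k : Fin n → SFun n I, (∀ μ, IsLocal gh (k μ) ∧ HasGhost gh 0 (k μ) ∧ brst gh L (k μ) = 0) ∧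
    brst gh L f = ∑ μ, D gh μ (k μ)

omit [Fintype I] in
lemma hasClosedCurrent_zero : HasClosedCurrent gh L 0 := by
  refine ⟨0, fun μ => ⟨IsLocal.zero, fun _ h => absurd rfl h, brst_zero L⟩, ?_⟩
  rw [brst_zero]
  refine (Finset.sum_eq_zero fun μ _ => ?_).symm
  simpa using D_smul (gh := gh) μ 0 0

lemma HasClosedCurrent.add (hf : IsLocal gh f) (hf' : IsLocal gh f')
    (h : HasClosedCurrent gh L f) (h' : HasClosedCurrent gh L f') :
    HasClosedCurrent gh L (f + f') := by
  obtain ⟨k, hk, e⟩ := h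
  obtain ⟨k', hk', e'⟩ := h'
  refine ⟨k + k', fun μ => ⟨(hk μ).1.add (hk' μ).1, (hk μ).2.1.add (hk' μ).2.1, ?_⟩, ?_⟩
  · rw [Pi.add_apply, brst_add L (hk μ).1 (hk' μ).1, (hk μ).2.2, (hk' μ).2.2, add_zero]
  · rw [brst_add L hf hf', e, e', ← Finset.sum_add_distrib]
    exact Finset.sum_congr rfl fun μ _ => (D_add μ (hk μ).1 (hk' μ).1).symm

omit [Fintype I] in
lemma HasClosedCurrent.smul (r : ℝ) (h : HasClosedCurrent gh L f) :
    HasClosedCurrent gh L (r • f) := by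
  obtain ⟨k, hk, e⟩ := h
  refine ⟨r • k, fun μ => ⟨(hk μ).1.smul r, (hk μ).2.1.smul r, ?_⟩, ?_⟩
  · rw [Pi.smul_apply, brst_smul, (hk μ).2.2, smul_zero]
  · rw [brst_smul, e, Finset.smul_sum]
    exact Finset.sum_congr rfl fun μ _ => (D_smul μ _ r).symm

/-- Translates the descent `α, η 1` into a density and its current. The factor `-(-1)^n` comes from
writing `s α + d j = 0` as `s f = ∂_μ k^μ`. -/
lemma isCovariantizable_iff {x : H gh L (-1) n} : IsCovariantizable gh L x ↔
    ∃ f, ∃ hf : IsCocycle gh L (-1) f, densityClass gh L hf = x ∧ HasClosedCurrent gh L f := by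
  constructor
  · rintro ⟨α, rfl, η, h0, hη, hs, hl⟩
    have h1 : IsForm gh 0 (n - 1) (η 1) := by simpa using hη 1 le_rfl
    have e := congrFun (hs 0 one_pos) Finset.univ
    rw [h0, Pi.add_apply, zero_add, d_eq_topForm h1, topForm_univ, s, Finset.card_univ,
      Fintype.card_fin, Pi.zero_apply] at e
    refine ⟨_, isCocycle_of_mem α, (cls_eq_densityClass α).symm,
      fun μ => (-(-1 : ℝ) ^ n) • dSign μ • η 1 (Finset.univ.erase μ), fun μ =>
      ⟨((h1.isLocal _).smul _).smul _, ((h1.ghost _).smul _).smul _, ?_⟩, ?_⟩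
    · rw [brst_smul, brst_smul, brst_eq_zero_of_s (congrFun hl _), smul_zero, smul_zero]
    · simp only [D_smul, ← Finset.smul_sum] at e ⊢
      rw [neg_smul, ← smul_neg, ← eq_neg_of_add_eq_zero_left e, neg_one_pow_smul_smul]
  · rintro ⟨f, hf, rfl, k, hk, e⟩
    have hk' : ∀ μ, IsLocal gh (-(-1 : ℝ) ^ n • k μ) ∧ HasGhost gh 0 (-(-1 : ℝ) ^ n • k μ) :=
      fun μ => ⟨(hk μ).1.smul _, (hk μ).2.1.smul _⟩
    -- Only the members `0` and `1` of the descent are constrained, so the values beyond are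
    -- immaterial.
    refine ⟨_, rfl, fun j => if j = 0 then topForm f else
      currentForm fun μ => -(-1 : ℝ) ^ n • k μ, rfl, fun j hj => ?_, fun j hj => ?_, ?_⟩
    · interval_cases j
      · simpa using isForm_topForm hf.1 hf.2.1
      · simpa using isForm_currentForm hk'
    · obtain rfl : j = 0 := by omega
      change s gh L (topForm f) + d gh (currentForm fun μ => -(-1 : ℝ) ^ n • k μ) = 0
      rw [s_topForm, d_currentForm hk', e, ← topForm_add]
      simp only [D_smul, ← Finset.smul_sum]
      rw [neg_smul, add_neg_cancel]
      funext S
      rw [topForm, ite_self, Pi.zero_apply]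
    · change s gh L (currentForm fun μ => -(-1 : ℝ) ^ n • k μ) = 0
      funext S
      rw [s, currentForm, brst_sum L fun μ _ => ?_, Finset.sum_eq_zero fun μ _ => ?_, smul_zero,
        Pi.zero_apply]
      · split_ifs
        · rw [brst_smul, brst_smul, (hk μ).2.2, smul_zero, smul_zero]
        · exact brst_zero L
      · split_ifs
        exacts [(hk' μ).1.smul _, IsLocal.zero]

variable (gh L) in
/-- The covariantizable classes. -/
def covariantizable : Submodule ℝ (H gh L (-1) n) where
  carrier := {x | IsCovariantizable gh L x}
  zero_mem' := isCovariantizable_iff.2 ⟨0, ⟨IsLocal.zero, fun _ h => absurd rfl h, by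
    rw [brst_zero]; exact IsDiv.zero⟩, densityClass_eq_zero_iff.2 IsDiv.zero.isCoboundary,
    hasClosedCurrent_zero⟩
  add_mem' := fun hx hy => by
    obtain ⟨f, hf, rfl, hc⟩ := isCovariantizable_iff.1 hx
    obtain ⟨f', hf', rfl, hc'⟩ := isCovariantizable_iff.1 hy
    exact isCovariantizable_iff.2 ⟨f + f', hf.add hf', densityClass_add _ _ _ rfl,
      hc.add hf.1 hf'.1 hc'⟩
  smul_mem' := fun r x hx => by
    obtain ⟨f, hf, rfl, hc⟩ := isCovariantizable_iff.1 hx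
    exact isCovariantizable_iff.2 ⟨r • f, hf.smul r, densityClass_smul _ _ _ rfl, hc.smul r⟩

/-- The shifted parity is even, so the bracket is antisymmetric already for densities, without any
divergence. -/
lemma bracket_self (hf : IsCocycle gh L (-1) f) : bracket gh f f = 0 := by
  have h := bracket_symm hf.1 hf.2.1.hasPar hf.1 hf.2.1.hasPar
  rw [show (((-1 : ℤ) : ZMod 2) + 1) = 0 from rfl, zero_mul, sg_zero, one_smul] at h
  exact self_eq_neg.1 h

namespace IsMasterAction

variable (hL : IsMasterAction gh L)

include hL

/-- The field of `f` is even and commutes with `s` and with total derivatives; it maps a closed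
current of `F` to one of the transformed density. -/
lemma hasClosedCurrent_brst (hf : IsCocycle gh L (-1) f) (hF : IsLocal gh F)
    (hc : HasClosedCurrent gh L F) : HasClosedCurrent gh L (brst gh f F) := by
  have comm : ∀ {G}, IsLocal gh G → brst gh L (brst gh f G) = brst gh f (brst gh L G) :=
    fun hG => by
      have := hL.brst_brst_comm hf hG
      rwa [show (((-1 : ℤ) : ZMod 2) + 1) = 0 from rfl, sg_zero, one_smul] at this
  obtain ⟨k, hk, e⟩ := hc
  refine ⟨fun μ => brst gh f (k μ), fun μ => ⟨hf.1.brst hf.2.1.hasPar (hk μ).1, ?_, ?_⟩, ?_⟩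
  · simpa using hf.2.1.brst (hk μ).2.1
  · rw [comm (hk μ).1, (hk μ).2.2, brst_zero]
  · rw [comm hF, e, brst_sum f fun μ _ => (hk μ).1.D μ]
    exact Finset.sum_congr rfl fun μ _ => brst_D hf.1 hf.2.1.hasPar (hk μ).1 μ

/-- Densities with closed currents act trivially in ghost number `-2`. -/
lemma isCoboundary_bracket_of_hasClosedCurrent (hf : IsCocycle gh L (-1) f)
    (hc : HasClosedCurrent gh L f) (hF : IsCocycle gh L (-2) F) :
    IsCoboundary gh L (-2) (bracket gh f F) := by
  have hp := hF.2.1.hasPar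
  have comm : ∀ {G}, IsLocal gh G → brst gh L (brst gh F G) = -brst gh F (brst gh L G) :=
    fun hG => by
      have := hL.brst_brst_comm hF hG
      rwa [show (((-2 : ℤ) : ZMod 2) + 1) = 1 from rfl, sg_one, neg_one_smul] at this
  obtain ⟨k, hk, e⟩ := hc
  -- The field of `F` anticommutes with `s`, so it sends the closed `k μ`, of ghost number `0`, to a
  -- closed function of ghost number `-1`, where `s` is acyclic. Closedness of the current is used
  -- here.
  have hb : ∀ μ, ∃ G, IsLocal gh G ∧ HasGhost gh (-1 - 1) G ∧ brst gh L G = brst gh F (k μ) :=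
    fun μ => hL.exists_brst_eq (by norm_num) (hF.1.brst hp (hk μ).1)
      (by simpa using hF.2.1.brst (hk μ).2.1)
      (by rw [comm (hk μ).1, (hk μ).2.2, brst_zero, neg_zero])
  choose l hl hlg hle using hb
  have hD : IsLocal gh (∑ μ, D gh μ (l μ)) := IsLocal.sum fun μ _ => (hl μ).D μ
  have hB := hF.1.brst hp hf.1
  have hBg : HasGhost gh (-2) (brst gh F f) := by simpa using hF.2.1.brst hf.2.1
  have hDiv : IsDiv gh (-2) (∑ μ, D gh μ (l μ)) := ⟨l, fun μ => ⟨hl μ, hlg μ⟩, rfl⟩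
  -- `s` of the field of `F` on `f` is minus the divergence of the transformed current, which the
  -- divergence of `l` compensates. Acyclicity is applied a second time, to the closed sum.
  obtain ⟨b, h1, h2, h3⟩ := hL.exists_brst_eq (g := -2) (by norm_num) (hB.add hD)
    (hBg.add (HasGhost.sum fun μ _ => (hlg μ).D μ)) (by
      rw [brst_add L hB hD, comm hf.1, e, brst_sum F fun μ _ => (hk μ).1.D μ,
        brst_sum L fun μ _ => (hl μ).D μ, neg_add_eq_zero]
      refine Finset.sum_congr rfl fun μ _ => ?_
      rw [brst_D hF.1 hp (hk μ).1, brst_D hL.isLocal hL.ghost.hasPar (hl μ), hle])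
  have hd := isDiv_brst_sub_bracket hF.1 hF.2.1 hf.1 hf.2.1
  have hcob : IsCoboundary gh L (-2) (bracket gh F f) := by
    refine ⟨b, h1, h2, ?_⟩
    rw [show (-1 : ℤ) + (-2 + 1) = -2 by norm_num] at hd
    have := (hd.add hDiv).neg
    rw [h3]
    convert this using 1
    abel
  rw [bracket_symm hf.1 hf.2.1.hasPar hF.1 hp, ← neg_smul]
  exact hcob.smul _

end IsMasterAction

end BV

/-! ### The Lie bracket, the action and the main theorem -/

namespace BV

variable {n : ℕ} {I : Type*} [Fintype I] {gh : I → ℕ} {L : SFun n I}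

namespace IsMasterAction

variable (hL : IsMasterAction gh L)

include hL

/-- The antibracket with classes of ghost number `-1`. -/
lemma exists_bracketMap_neg_one (g : ℤ) :
    ∃ B : H gh L (-1) n →ₗ[ℝ] H gh L g n →ₗ[ℝ] H gh L g n,
      ∀ {f h : SFun n I} (hf : IsCocycle gh L (-1) f) (hh : IsCocycle gh L g h),
        B (densityClass gh L hf) (densityClass gh L hh) =
          densityClass gh L (hL.isCocycle_bracket_neg_one hf hh) := by
  obtain ⟨B, hB⟩ := hL.exists_bracketMap (-1) g (g'' := g) (by simp)
  exact ⟨B, fun hf hh => hB hf hh _⟩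

/-- Returns from densities to forms, and shows that `B` is computed by the antibracket of arbitrary
representatives. -/
lemma exists_antibracket_eq {g : ℤ} {B : H gh L (-1) n →ₗ[ℝ] H gh L g n →ₗ[ℝ] H gh L g n}
    (hB : ∀ {f h : SFun n I} (hf : IsCocycle gh L (-1) f) (hh : IsCocycle gh L g h),
      B (densityClass gh L hf) (densityClass gh L hh) =
        densityClass gh L (hL.isCocycle_bracket_neg_one hf hh))
    (X : cocycles gh L (-1) n) (M : cocycles gh L g n) : ∃ W : cocycles gh L g n,
      (W : Form n I) = antibracket gh (X : Form n I) (M : Form n I) ∧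
      B (cls gh L X) (cls gh L M) = cls gh L W := by
  refine ⟨⟨_, topForm_mem_cocycles.2 (hL.isCocycle_bracket_neg_one (isCocycle_of_mem X)
    (isCocycle_of_mem M))⟩, (antibracket_eq _ _).symm, ?_⟩
  rw [cls_eq_densityClass X, cls_eq_densityClass M]
  exact hB _ _

/-- Serves twice: with `B = lie` it is the Jacobi identity, with `B` the action it is the module
law. -/
lemma jacobi {g : ℤ} {lie : H gh L (-1) n →ₗ[ℝ] H gh L (-1) n →ₗ[ℝ] H gh L (-1) n}
    (hl : ∀ {f h : SFun n I} (hf : IsCocycle gh L (-1) f) (hh : IsCocycle gh L (-1) h),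
      lie (densityClass gh L hf) (densityClass gh L hh) =
        densityClass gh L (hL.isCocycle_bracket_neg_one hf hh))
    {B : H gh L (-1) n →ₗ[ℝ] H gh L g n →ₗ[ℝ] H gh L g n}
    (hB : ∀ {f h : SFun n I} (hf : IsCocycle gh L (-1) f) (hh : IsCocycle gh L g h),
      B (densityClass gh L hf) (densityClass gh L hh) =
        densityClass gh L (hL.isCocycle_bracket_neg_one hf hh))
    (x y : H gh L (-1) n) (z : H gh L g n) : B x (B y z) = B (lie x y) z + B y (B x z) := by
  obtain ⟨a, ha, rfl⟩ := exists_densityClass_eq x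
  obtain ⟨b, hb, rfl⟩ := exists_densityClass_eq y
  obtain ⟨c, hc, rfl⟩ := exists_densityClass_eq z
  rw [hl, hB, hB, hB, hB, hB]
  exact densityClass_eq_add (isDiv_jacobi ha.1 ha.2.1 hb.1 hb.2.1 hc.1 hc.2.1)

end IsMasterAction

end BV

end
theorem mainTheorem8 {n : ℕ} {I : Type*} [Fintype I] (gh : I → ℕ) (L : BV.SFun n I)
    (hL : BV.IsMasterAction gh L) :
    ∃ (lie : BV.H gh L (-1) n →ₗ[ℝ] BV.H gh L (-1) n →ₗ[ℝ] BV.H gh L (-1) n)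
      (act : BV.H gh L (-1) n →ₗ[ℝ] BV.H gh L (-2) n →ₗ[ℝ] BV.H gh L (-2) n)
      (cov : Submodule ℝ (BV.H gh L (-1) n)),
      -- the bracket and the action are the antibracket map in cohomology
      (∀ X Y : BV.cocycles gh L (-1) n, ∃ W : BV.cocycles gh L (-1) n,
        (W : BV.Form n I) = BV.antibracket gh (X : BV.Form n I) (Y : BV.Form n I) ∧
        lie (BV.cls gh L X) (BV.cls gh L Y) = BV.cls gh L W) ∧
      (∀ (X : BV.cocycles gh L (-1) n) (M : BV.cocycles gh L (-2) n),
        ∃ W : BV.cocycles gh L (-2) n,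
        (W : BV.Form n I) = BV.antibracket gh (X : BV.Form n I) (M : BV.Form n I) ∧
        act (BV.cls gh L X) (BV.cls gh L M) = BV.cls gh L W) ∧
      -- they make `H^{-1,n}(s|d)` a Lie algebra and `H^{-2,n}(s|d)` a module over it
      (∀ x, lie x x = 0) ∧
      (∀ x y z, lie x (lie y z) = lie (lie x y) z + lie y (lie x z)) ∧
      (∀ x y m, act (lie x y) m = act x (act y m) - act y (act x m)) ∧
      -- covariantizable classes form an ideal, which acts trivially
      (∀ x, x ∈ cov ↔ BV.IsCovariantizable gh L x) ∧
      (∀ x, ∀ y ∈ cov, lie x y ∈ cov) ∧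
      (∀ x ∈ cov, ∀ m, act x m = 0) := by
  obtain ⟨lie, hlie⟩ := hL.exists_bracketMap_neg_one (-1)
  obtain ⟨act, hact⟩ := hL.exists_bracketMap_neg_one (-2)
  refine ⟨lie, act, BV.covariantizable gh L, hL.exists_antibracket_eq hlie,
    hL.exists_antibracket_eq hact, fun x => ?_, hL.jacobi hlie hlie,
    fun x y m => eq_sub_of_add_eq (hL.jacobi hlie hact x y m).symm, fun x => Iff.rfl,
    fun x y hy => ?_, fun x hx m => ?_⟩
  · obtain ⟨a, ha, rfl⟩ := BV.exists_densityClass_eq x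
    rw [hlie, BV.densityClass_eq_zero_iff, BV.bracket_self ha]
    exact BV.IsDiv.zero.isCoboundary
  · obtain ⟨a, ha, rfl⟩ := BV.exists_densityClass_eq x
    obtain ⟨b, hb, rfl, hc⟩ := BV.isCovariantizable_iff.1 hy
    -- The class of the bracket is represented by the field of `a` applied to `b`, which differs
    -- from it by a divergence and carries the closed current.
    refine BV.isCovariantizable_iff.2 ⟨_, hL.isCocycle_brst_neg_one ha hb, ?_,
      hL.hasClosedCurrent_brst ha hb.1 hc⟩
    rw [hlie, BV.densityClass_eq_iff]
    have := BV.isDiv_brst_sub_bracket ha.1 ha.2.1 hb.1 hb.2.1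
    rw [neg_add_cancel, add_zero] at this
    exact this.isCoboundary
  · obtain ⟨a, ha, rfl, hc⟩ := BV.isCovariantizable_iff.1 hx
    obtain ⟨c, hm, rfl⟩ := BV.exists_densityClass_eq m
    rw [hact, BV.densityClass_eq_zero_iff]
    exact hL.isCoboundary_bracket_of_hasClosedCurrent ha hc hm
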